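/- \textbf{Setup.} Let $D$ be an oriented link diagram and $Kh(D)$ its Khovanov homology over $\mathbb{Q}$, computed from the cube of resolutions with generators the enhanced states (every loop of a state is marked by $v_+$ or $v_-$) and edge maps $v_+\otimes v_+\mapsto v_+$, $v_\pm\otimes v_\mp\mapsto v_-$, $v_-\otimes v_-\mapsto 0$ and $v_+\mapsto v_+\otimes v_-+v_-\otimes v_+$, $v_-\mapsto v_-\otimes v_-$. Lee's homomorphism $\Phi$ is defined on the same chain groups, with the same signs, by the edge maps $v_-\otimes v_-\mapsto v_+$, $v_-\mapsto v_+\otimes v_+$ (all other generators go to $0$). A \emph{nontrivial state cycle} is a single enhanced state $\alpha$ with $d\alpha=0$ and $[\alpha]\neq0$. Suppose that $n$ arcs of $D$ can be joined by a transverse line which touches nothing else and meets all of them in the same orientation, and that in $\alpha$ these arcs lie on pairwise distinct loops, all marked by $v_-$. Let $B=\prod_k\omega_k\tau_{i_k}\omega_k^{-1}$ be a quasipositive braid word on $n$ strands, and let $D'$ be the diagram obtained from $D$ by replacing the $n$ arcs (a trivial braid near the line) by $B$ (a \emph{quasipositive modification of $D$ compatible with $\alpha$}). Let $\widetilde\alpha$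 be the enhanced state of $D'$ in which the crossings of $D$ are smoothed as in $\alpha$, the positive crossings of $B$ are $0$-smoothed, the negative crossings of $B$ are $1$-smoothed, and every loop is marked as in $\alpha$. Let $\Psi_J$ be an associated Jacobsson homomorphism: a composition of the maps of Jacobsson for moves which reduce $B$ to the trivial braid, each of which either $0$-resolves a positive crossing of the braid (a $1$-handle followed by undoing a positive Reidemeister I twist) or cancels a pair $\tau_i^{\pm1}\tau_i^{\mp1}$ by a Reidemeister II move. \textbf{Theorem.} Such maps $\Psi_J$ exist; the enhanced state $\widetilde\alpha$ is well defined and is a state cycle; the chain maps $\Psi_J$ and $\Phi$ induce homomorphisms $\Psi_J\colon Kh(D')\to Kh(D)$ and $\Phi$ on $Kh(D)$ and on $Kh(D')$. For every such $\Psi_J$ there is a sign $\varepsilon\in\{1,-1\}$ such that $$\Psi_J([\widetilde\alpha])=\varepsilon[\alpha],\qquad \Psi_J(\Phi([\widetilde\alpha]))=\Phi(\Psi_J([\widetilde\alpha]))=\varepsilon\,\Phi([\alpha]).$$ In particular, Lee pairs lift: if $[\alpha]\ne0$ and $\Phi([\alpha])\neq0$, then $[\widetilde\alpha]\neq0$ and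 $\Phi([\widetilde\alpha])\neq0$. -/

import Mathlib

noncomputable section

namespace LeeLift

open scoped Classical

/-! ### The Frobenius tables -/

/-- The two generators `v₊`, `v₋` of `V`. -/
inductive Gen : Type
  | plus
  | minus

/-- Structure constants of a pair of edge maps `V ⊗ V → V` and `V → V ⊗ V`:
`mul x y z` is the coefficient of `z` in the image of `x ⊗ y`, and
`comul x y z` is the coefficient of `y ⊗ z` in the image of `x`. -/
structure EdgeTable where
  mul : Gen → Gen → Gen → ℚ
  comul : Gen → Gen → Gen → ℚ

/-- The maps `μ`, `Δ` of the Khovanov differential. -/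
def khovanovTable : EdgeTable where
  mul
    | .plus, .plus, .plus => 1
    | .plus, .minus, .minus => 1
    | .minus, .plus, .minus => 1
    | _, _, _ => 0
  comul
    | .plus, .plus, .minus => 1
    | .plus, .minus, .plus => 1
    | .minus, .minus, .minus => 1
    | _, _, _ => 0

/-- The maps `μ_Φ`, `Δ_Φ` of Lee's homomorphism:
`v₋ ⊗ v₋ ↦ v₊`, `v₋ ↦ v₊ ⊗ v₊`, and everything else goes to zero. -/
def leeTable : EdgeTable where
  mul
    | .minus, .minus, .plus => 1
    | _, _, _ => 0
  comul
    | .minus, .plus, .plus => 1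
    | _, _, _ => 0

/-! ### States, enhanced states and the cube of resolutions -/

/-- What the cube of resolutions of a link diagram is built from.  The diagram is cut into arcs by
finitely many points.  `join p q` says that `p` and `q` are the ends of an arc which contains no
crossing.  The crossings are labelled (and ordered) by natural numbers, and the four ends at the
crossing `c` are numbered in cyclic order so that the `0`-smoothing connects `0` with `1` and `2`
with `3`, and the `1`-smoothing connects `1` with `2` and `3` with `0`. -/
structure Pattern (P : Type) where
  points : Finset P
  crossings : Finset ℕ
  corner : ℕ → Fin 4 → P
  join : P → P → Prop

namespace Pattern

/-- Adjacent points in the state whose set of `1`-smoothed crossings is `ones`. -/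
def Link {P : Type} (S : Pattern P) (ones : Finset ℕ) (p q : P) : Prop :=
  S.join p q ∨ ∃ c ∈ S.crossings,
    if c ∈ ones then
      (p = S.corner c 1 ∧ q = S.corner c 2) ∨ (p = S.corner c 3 ∧ q = S.corner c 0)
    else
      (p = S.corner c 0 ∧ q = S.corner c 1) ∨ (p = S.corner c 2 ∧ q = S.corner c 3)

/-- Two points lie on the same loop of the state given by `ones`. -/
def SameLoop {P : Type} (S : Pattern P) (ones : Finset ℕ) : P → P → Prop :=
  Relation.EqvGen (S.Link ones)

/-- An enhanced state: a choice of smoothings (`ones` is the set of `1`-smoothed crossings) and a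
marking of every loop by `v₊` or `v₋` (`plus` is the set of points on loops marked by `v₊`). -/
@[ext]
structure EnhancedState {P : Type} (S : Pattern P) where
  ones : Finset ℕ
  ones_subset : ones ⊆ S.crossings
  plus : Finset P
  plus_subset : plus ⊆ S.points
  plus_iff : ∀ p q, S.SameLoop ones p q → (p ∈ plus ↔ q ∈ plus)

instance {P : Type} (S : Pattern P) : Finite S.EnhancedState := by
  have h : Function.Injective (fun s : S.EnhancedState =>
      ((⟨s.ones, Finset.mem_powerset.2 s.ones_subset⟩,
        ⟨s.plus, Finset.mem_powerset.2 s.plus_subset⟩) :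
        S.crossings.powerset × S.points.powerset)) := by
    intro s t hst
    simp only [Prod.mk.injEq, Subtype.mk.injEq] at hst
    exact EnhancedState.ext hst.1 hst.2
  exact Finite.of_injective _ h

instance {P : Type} (S : Pattern P) : Fintype S.EnhancedState := Fintype.ofFinite _

/-- The marking of the loop through `p`. -/
def EnhancedState.mark {P : Type} {S : Pattern P} (s : S.EnhancedState) (p : P) : Gen :=
  if p ∈ s.plus then .plus else .minus

/-- The chain group: the rational vector space on the enhanced states
(the direct sum over all heights). -/
abbrev Chain {P : Type} (S : Pattern P) : Type := S.EnhancedState →₀ ℚ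

/-- The chain which is a single generator. -/
def EnhancedState.chain {P : Type} {S : Pattern P} (s : S.EnhancedState) : S.Chain :=
  Finsupp.single s 1

/-- The linear map with matrix entries `a s t`
(`a s t` is the coefficient of `t` in the image of `s`). -/
def ofCoeff {P Q : Type} {S : Pattern P} {T : Pattern Q}
    (a : S.EnhancedState → T.EnhancedState → ℚ) : S.Chain →ₗ[ℚ] T.Chain :=
  Finsupp.linearCombination ℚ (fun s => ∑ t, Finsupp.single t (a s t))

/-- The markings of `s` and `t` agree on all loops of `s` which avoid the points in `A`;
`f` says where the points of `S` are found in `T`. -/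
def AgreeOff {P Q : Type} {S : Pattern P} {T : Pattern Q} (f : P → Q) (A : Set P)
    (s : S.EnhancedState) (t : T.EnhancedState) : Prop :=
  ∀ p ∈ S.points, (∀ a ∈ A, ¬ S.SameLoop s.ones p a) → s.mark p = t.mark (f p)

/-- The coefficient for surgery between two arcs.  The arcs before surgery contain `x` and `y`,
the arcs after surgery contain `x'` and `y'`.  If the two arcs lie on one loop, it is pinched
into two loops; otherwise two loops are merged. -/
def surgeryCoeff {P Q : Type} {S : Pattern P} {T : Pattern Q} (E : EdgeTable)
    (s : S.EnhancedState) (t : T.EnhancedState) (x y : P) (x' y' : Q) : ℚ :=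
  if S.SameLoop s.ones x y then E.comul (s.mark x) (t.mark x') (t.mark y')
  else E.mul (s.mark x) (s.mark y) (t.mark x')

/-- The sum of the signed edge maps, over all edges of the cube from the state of `s` to the state
of `t` (there is at most one).  The sign of the edge at `c` is `(-1)` to the number of
`1`-smoothed crossings before `c`.  Opposite ends of `c` lie on different arcs of either smoothing,
so the surgery is described by the ends `0` and `2`. -/
def edgeCoeff {P : Type} {S : Pattern P} (E : EdgeTable) (s t : S.EnhancedState) : ℚ :=
  ∑ c ∈ S.crossings \ s.ones,
    if t.ones = insert c s.ones ∧ AgreeOff id {S.corner c 0, S.corner c 2} s t then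
      (-1) ^ (s.ones.filter (· < c)).card *
        surgeryCoeff E s t (S.corner c 0) (S.corner c 2) (S.corner c 0) (S.corner c 2)
    else 0

/-- The Khovanov differential. -/
def d {P : Type} (S : Pattern P) : S.Chain →ₗ[ℚ] S.Chain := ofCoeff (edgeCoeff khovanovTable)

/-- Lee's homomorphism on chains. -/
def lee {P : Type} (S : Pattern P) : S.Chain →ₗ[ℚ] S.Chain := ofCoeff (edgeCoeff leeTable)

/-- Khovanov homology with rational coefficients (all bidegrees together):
cycles modulo boundaries. -/
abbrev Kh {P : Type} (S : Pattern P) : Type :=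
  LinearMap.ker S.d ⧸ (LinearMap.range S.d).comap (LinearMap.ker S.d).subtype

/-- The homology class of a cycle. -/
def Kh.mk {P : Type} {S : Pattern P} (z : S.Chain) (hz : S.d z = 0) : S.Kh :=
  Submodule.Quotient.mk (⟨z, hz⟩ : LinearMap.ker S.d)

/-- A linear map on chains takes cycles to cycles and boundaries to boundaries. -/
structure Descends {P Q : Type} {S : Pattern P} {T : Pattern Q}
    (f : S.Chain →ₗ[ℚ] T.Chain) : Prop where
  cycle : ∀ z, S.d z = 0 → T.d (f z) = 0
  boundary : ∀ x, ∃ y, f (S.d x) = T.d y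

/-- The map induced on homology. -/
def Kh.map {P Q : Type} {S : Pattern P} {T : Pattern Q} (f : S.Chain →ₗ[ℚ] T.Chain)
    (hf : Descends f) : S.Kh →ₗ[ℚ] T.Kh :=
  Submodule.mapQ _ _
    (f.restrict (p := LinearMap.ker S.d) (q := LinearMap.ker T.d) (fun z hz => hf.cycle z hz))
    (by
      rintro ⟨z, hz⟩ ⟨x, hx⟩
      obtain ⟨y, hy⟩ := hf.boundary x
      exact ⟨y, by rw [← hy, hx]; rfl⟩)

/-- A state cycle: a single generator which is a cycle. -/
def EnhancedState.IsStateCycle {P : Type} {S : Pattern P} (s : S.EnhancedState) : Prop :=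
  S.d s.chain = 0

/-! ### The elementary Jacobsson maps -/

/-- The diagram obtained by attaching a `1`-handle next to the crossing `c`, between the arcs which
end at its corners `0` and `1`.  Both arcs are cut: the outer parts (still ending in the old points
`corner c 0`, `corner c 1`) are joined to each other, and the inner parts, with the new end points
`inr false`, `inr true`, are joined to each other, so that the crossing now sits on a kink. -/
def handle {P : Type} (S : Pattern P) (c : ℕ) : Pattern (P ⊕ Bool) where
  points := S.points.disjSum Finset.univ
  crossings := S.crossings
  corner b := if b = c then
      ![Sum.inr false, Sum.inr true, Sum.inl (S.corner c 2), Sum.inl (S.corner c 3)]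
    else fun i => Sum.inl (S.corner b i)
  join
    | .inl p, .inl q => S.join p q ∨ (p = S.corner c 0 ∧ q = S.corner c 1)
    | .inr u, .inr v => u = false ∧ v = true
    | _, _ => False

/-- The Jacobsson map of the saddle (Morse) move which attaches this `1`-handle. -/
def handleMap {P : Type} (S : Pattern P) (c : ℕ) : S.Chain →ₗ[ℚ] (S.handle c).Chain :=
  ofCoeff fun s t =>
    if t.ones = s.ones ∧ AgreeOff Sum.inl {S.corner c 0, S.corner c 1} s t then
      surgeryCoeff khovanovTable s t (S.corner c 0) (S.corner c 1)
        (Sum.inl (S.corner c 0)) (Sum.inr false)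
    else 0

/-- The Jacobsson map of the positive Reidemeister I move which removes the kink at `c`, where
`S'` is the diagram after the move: if `c` is `0`-smoothed, the kink gives a separate
small loop, and `p ⊗ v₋ ↦ p` (the second factor being the small loop); all other enhanced states
go to zero. -/
def unkinkMap {P : Type} (S S' : Pattern P) (c : ℕ) : (S.handle c).Chain →ₗ[ℚ] S'.Chain :=
  ofCoeff fun s t =>
    if c ∉ s.ones ∧ t.ones = s.ones ∧ s.mark (Sum.inr false) = .minus ∧
        ∀ p ∈ S.points, s.mark (Sum.inl p) = t.mark p then 1
    else 0

/-- The Jacobsson map of the cobordism which `0`-resolves the positive crossing `c`: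
a `1`-handle followed by undoing a positive Reidemeister I twist. -/
def resolveMap {P : Type} (S S' : Pattern P) (c : ℕ) : S.Chain →ₗ[ℚ] S'.Chain :=
  unkinkMap S S' c ∘ₗ handleMap S c

/-- The Jacobsson map of the Reidemeister II move which removes the positive crossing `c` and the
negative crossing `c'` between two parallel strands, where `S'` is the diagram after the move.
The point `x` is an outer end of one crossing, `y` is the diagonally opposite outer end of the
other crossing, and `o` lies between the two crossings.

If `c` is `0`-smoothed and `c'` is `1`-smoothed, both smoothings are parallel to the strands, and
the markings are kept.  If `c` is `1`-smoothed and `c'` is `0`-smoothed, there is a small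
loop through `o`; if it is marked by `v₋` it is removed and the two outer arcs `p`, `q` are replaced
by the result `p:q`, `q:p` of the saddle between them.  Everything else goes to zero.  The crossings
`c`, `c'` are meant to be neighbours in the ordering; the common sign makes up for the
deletion of one `1`-smoothed crossing. -/
def reidemeisterTwoMap {P : Type} (S S' : Pattern P) (c c' : ℕ) (x o y : P) :
    S.Chain →ₗ[ℚ] S'.Chain :=
  ofCoeff fun s t =>
    (-1) ^ (s.ones.filter (max c c' < ·)).card *
      if t.ones = (s.ones.erase c).erase c' then
        if c ∉ s.ones ∧ c' ∈ s.ones ∧ ∀ p ∈ S.points, s.mark p = t.mark p then 1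
        else if c ∈ s.ones ∧ c' ∉ s.ones ∧ s.mark o = .minus ∧ AgreeOff id {x, y, o} s t then
          -surgeryCoeff khovanovTable s t x y x y
        else 0
      else 0

end Pattern

/-! ### Oriented link diagrams

Every link diagram is, up to isotopy of the plane, a finite stack of horizontal slices, each of
which contains at most one cap, cup or crossing. -/

/-- A horizontal slice.  The strands are numbered from the left, starting with `0`.
* `straight`: vertical strands only;
* `cup i`: a local minimum, which creates the strands `i` and `i + 1`;
* `cap i`: a local maximum, which ends the strands `i` and `i + 1`;
* `cross i b`: the strands `i` and `i + 1` cross, and the over-strand goes from bottom left to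
  top right if `b = true`, from bottom right to top left if `b = false`. -/
inductive Slice : Type
  | straight
  | cup (i : ℕ)
  | cap (i : ℕ)
  | cross (i : ℕ) (b : Bool)

namespace Slice

/-- The slice fits between a lower level and an upper level, each given by the list of the
orientations of its strands (`true` for upward). -/
def Fits : Slice → List Bool → List Bool → Prop
  | straight, l, u => u = l
  | cup i, l, u => ∃ A B o, A.length = i ∧ l = A ++ B ∧ u = A ++ [o, !o] ++ B
  | cap i, l, u => ∃ A B o, A.length = i ∧ l = A ++ [o, !o] ++ B ∧ u = A ++ B
  | cross i _, l, u => ∃ A B o o', A.length = i ∧ l = A ++ [o, o'] ++ B ∧ u = A ++ [o', o] ++ B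

def IsCrossing : Slice → Prop
  | cross _ _ => True
  | _ => False

/-- The strand ends joined by the arcs in a slice between the levels `k` and `k + 1` (without those
that meet at a crossing). -/
def Join (k : ℕ) : Slice → ℕ × ℕ → ℕ × ℕ → Prop
  | straight, p, q => ∃ j, p = (k, j) ∧ q = (k + 1, j)
  | cup i, p, q => (∃ j < i, p = (k, j) ∧ q = (k + 1, j)) ∨
      (∃ j ≥ i, p = (k, j) ∧ q = (k + 1, j + 2)) ∨ (p = (k + 1, i) ∧ q = (k + 1, i + 1))
  | cap i, p, q => (∃ j < i, p = (k, j) ∧ q = (k + 1, j)) ∨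
      (∃ j ≥ i, p = (k, j + 2) ∧ q = (k + 1, j)) ∨ (p = (k, i) ∧ q = (k, i + 1))
  | cross i _, p, q => ∃ j, j ≠ i ∧ j ≠ i + 1 ∧ p = (k, j) ∧ q = (k + 1, j)

/-- The four ends at a crossing in cyclic order.  If the over-strand goes from bottom left to top
right, the `0`-smoothing consists of two vertical arcs; otherwise the `1`-smoothing does. -/
def corner (k : ℕ) : Slice → Fin 4 → ℕ × ℕ
  | cross i true => ![(k, i), (k + 1, i), (k + 1, i + 1), (k, i + 1)]
  | cross i false => ![(k, i + 1), (k, i), (k + 1, i), (k + 1, i + 1)]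
  | _ => fun _ => (k, 0)

end Slice

/-- An oriented link diagram.  Slice `k` (for `k < len`) lies between the levels `k` and `k + 1`, and
`level k` lists the orientations of the strands at level `k`. -/
structure Diagram where
  len : ℕ
  level : ℕ → List Bool
  slice : ℕ → Slice
  level_zero : level 0 = []
  level_len : level len = []
  fits : ∀ k < len, (slice k).Fits (level k) (level (k + 1))

/-- The diagram cut at all levels; the point `(k, i)` is on strand `i` at level `k`, and crossings are
labelled by the height of their slice. -/
def Diagram.pattern (D : Diagram) : Pattern (ℕ × ℕ) where
  points := (Finset.range (D.len + 1)).biUnion fun k =>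
    (Finset.range (D.level k).length).image fun i => (k, i)
  crossings := (Finset.range D.len).filter fun k => (D.slice k).IsCrossing
  corner k := (D.slice k).corner k
  join p q := ∃ k < D.len, (D.slice k).Join k p q

/-! ### Quasipositive braids and quasipositive modification -/

/-- The braid generator `τ_i` is `(i, true)`, its inverse is `(i, false)`. -/
abbrev Letter (n : ℕ) : Type := Fin (n - 1) × Bool

/-- A braid word on `n` strands, read from the bottom to the top; `none` is a trivial slice. -/
abbrev BraidWord (n : ℕ) : Type := List (Option (Letter n))

/-- A quasipositive braid `∏ₖ ωₖ τ_{iₖ} ωₖ⁻¹`, given by the list of all `(ωₖ, iₖ)`. -/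
abbrev QuasipositiveBraid (n : ℕ) : Type := List (List (Letter n) × Fin (n - 1))

/-- The braid word `∏ₖ ωₖ τ_{iₖ} ωₖ⁻¹`. -/
def QuasipositiveBraid.word {n : ℕ} (B : QuasipositiveBraid n) : BraidWord n :=
  B.flatMap fun f =>
    (f.1 ++ [(f.2, true)] ++ (f.1.map fun g => (g.1, !g.2)).reverse).map some

/-- An oriented link diagram outside of a rectangular box, which occupies `height` slices from level
`base` on and is crossed by `n` strands that enter at the bottom, leave at the top, and are all
oriented upwards or all oriented downwards. -/
structure BoxExterior (n height : ℕ) where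
  len : ℕ
  level : ℕ → List Bool
  slice : ℕ → Slice
  level_zero : level 0 = []
  level_len : level len = []
  base : ℕ
  base_le : base + height ≤ len
  left : List Bool
  right : List Bool
  ori : Bool
  level_box : ∀ k, base ≤ k → k ≤ base + height → level k = left ++ List.replicate n ori ++ right
  fits : ∀ k < len, (k < base ∨ base + height ≤ k) → (slice k).Fits (level k) (level (k + 1))

/-- The slice of a letter of a braid, with `a` further strands on its left. -/
def letterSlice {n : ℕ} (a : ℕ) : Option (Letter n) → Slice
  | none => .straight
  | some (i, b) => .cross (a + i) b

theorem letterSlice_fits {n : ℕ} (l r : List Bool) (o : Bool) (g : Option (Letter n)) :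
    (letterSlice l.length g).Fits (l ++ List.replicate n o ++ r)
      (l ++ List.replicate n o ++ r) := by
  match g with
  | none => rfl
  | some (i, b) =>
    have hn : n = i + (2 + (n - 2 - i)) := by have := i.2; omega
    have h : l ++ List.replicate n o ++ r =
        (l ++ List.replicate i o) ++ [o, o] ++ (List.replicate (n - 2 - i) o ++ r) := by
      conv_lhs => rw [hn, List.replicate_add, List.replicate_add]
      simp [List.replicate_succ]
    exact ⟨l ++ List.replicate i o, List.replicate (n - 2 - i) o ++ r, o, o, by simp, h, h⟩

namespace BoxExterior

/-- The diagram obtained by filling the box with a braid. -/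
def fill {n height : ℕ} (X : BoxExterior n height) (w : BraidWord n) : Diagram where
  len := X.len
  level := X.level
  slice k := if X.base ≤ k ∧ k < X.base + height then
      letterSlice X.left.length (w.getD (k - X.base) none)
    else X.slice k
  level_zero := X.level_zero
  level_len := X.level_len
  fits k hk := by
    split_ifs with h
    · rw [X.level_box k h.1 (by omega), X.level_box (k + 1) (by omega) (by omega)]
      exact letterSlice_fits _ _ _ _
    · exact X.fits k hk (by omega)

/-- The point where strand `i` of the box meets the horizontal line at level `base + j`. -/
def point {n height : ℕ} (X : BoxExterior n height) (j i : ℕ) : ℕ × ℕ :=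
  (X.base + j, X.left.length + i)

/-- The diagram `D`: the box is filled with the trivial braid. -/
abbrev trivialPattern {n height : ℕ} (X : BoxExterior n height) : Pattern (ℕ × ℕ) :=
  (X.fill (List.replicate height none)).pattern

/-- The diagram in which the box is filled with the braid word `w`. -/
abbrev braidPattern {n height : ℕ} (X : BoxExterior n height) (w : BraidWord n) :
    Pattern (ℕ × ℕ) :=
  (X.fill w).pattern

/-- The `n` parallel arcs in the box of `D` are braid-parallel with respect to the enhanced state
`s`: they come from separate loops, all marked by `v₋`.  (That they are joined by a transverse
line which touches nothing else and meets them in the same orientation is part of the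
shape of the box.) -/
def BraidParallel {n height : ℕ} (X : BoxExterior n height)
    (s : X.trivialPattern.EnhancedState) : Prop :=
  (∀ i < n, ∀ i' < n, i ≠ i' →
    ¬ X.trivialPattern.SameLoop s.ones (X.point 0 i) (X.point 0 i')) ∧
  ∀ i < n, s.mark (X.point 0 i) = .minus

/-- `s'` is the lift of `s`: the crossings of `D` are smoothed as in `s`, the positive crossings of
the braid are `0`-smoothed, its negative crossings are `1`-smoothed, and all loops are marked
as in `s`. -/
def IsLift {n height : ℕ} (X : BoxExterior n height) (w : BraidWord n)
    (s : X.trivialPattern.EnhancedState) (s' : (X.braidPattern w).EnhancedState) : Prop :=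
  s'.ones = s.ones ∪
    ((Finset.range height).filter fun j => ∃ i, w[j]? = some (some (i, false))).image
      (X.base + ·) ∧
  s'.plus = s.plus

/-- `Ψ` is the (chain level) Jacobsson homomorphism, from the diagram with braid word `w` in the box to
the diagram with the trivial braid in the box, of a cobordism which `0`-resolves positive
crossings of the braid and removes pairs `τ_i τ_i⁻¹`, `τ_i⁻¹ τ_i` (with only trivial slices between
them) by Reidemeister II moves, until no crossing is left in the box. -/
inductive IsJacobssonMap {n height : ℕ} (X : BoxExterior n height) :
    (w : BraidWord n) → ((X.braidPattern w).Chain →ₗ[ℚ] X.trivialPattern.Chain) → Prop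
  | done : IsJacobssonMap X (List.replicate height none) LinearMap.id
  | resolve (w : BraidWord n) (j : ℕ) (i : Fin (n - 1))
      (Ψ : (X.braidPattern (w.set j none)).Chain →ₗ[ℚ] X.trivialPattern.Chain) :
      w[j]? = some (some (i, true)) → IsJacobssonMap X (w.set j none) Ψ →
      IsJacobssonMap X w
        (Ψ ∘ₗ Pattern.resolveMap (X.braidPattern w) (X.braidPattern (w.set j none)) (X.base + j))
  | cancelPosNeg (w : BraidWord n) (j j' : ℕ) (i : Fin (n - 1))
      (Ψ : (X.braidPattern ((w.set j none).set j' none)).Chain →ₗ[ℚ] X.trivialPattern.Chain) :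
      j < j' → w[j]? = some (some (i, true)) → w[j']? = some (some (i, false)) →
      (∀ m, j < m → m < j' → w[m]? = some none) →
      IsJacobssonMap X ((w.set j none).set j' none) Ψ →
      IsJacobssonMap X w
        (Ψ ∘ₗ Pattern.reidemeisterTwoMap (X.braidPattern w)
          (X.braidPattern ((w.set j none).set j' none)) (X.base + j) (X.base + j')
          (X.point j i) (X.point (j + 1) i) (X.point (j' + 1) (i + 1)))
  | cancelNegPos (w : BraidWord n) (j j' : ℕ) (i : Fin (n - 1))
      (Ψ : (X.braidPattern ((w.set j none).set j' none)).Chain →ₗ[ℚ] X.trivialPattern.Chain) :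
      j < j' → w[j]? = some (some (i, false)) → w[j']? = some (some (i, true)) →
      (∀ m, j < m → m < j' → w[m]? = some none) →
      IsJacobssonMap X ((w.set j none).set j' none) Ψ →
      IsJacobssonMap X w
        (Ψ ∘ₗ Pattern.reidemeisterTwoMap (X.braidPattern w)
          (X.braidPattern ((w.set j none).set j' none)) (X.base + j') (X.base + j)
          (X.point j i) (X.point (j + 1) i) (X.point (j' + 1) (i + 1)))

end BoxExterior

/-- A Lee pair of state cycle type: the state cycle `s` and its image under Lee's homomorphism both
represent nontrivial homology classes. -/
def IsLeePair {P : Type} {S : Pattern P} (hΦ : Pattern.Descends S.lee)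
    (s : S.EnhancedState) (hs : s.IsStateCycle) : Prop :=
  Pattern.Kh.mk s.chain hs ≠ 0 ∧ Pattern.Kh.map S.lee hΦ (Pattern.Kh.mk s.chain hs) ≠ 0

end LeeLift

end

open LeeLift

noncomputable section

namespace LeeLift

open scoped Classical

/-! In the lift every crossing of the braid is smoothed vertically: positive ones by `0`, negative
ones by `1`. So the loops of the lift are the loops of `α`, with the same marks. It is a cycle
because an edge at a crossing of `D` has the same coefficient as in `D`, up to sign, while an edge
at a positive crossing of the braid merges two distinct loops marked `v₋`, and `v₋ ⊗ v₋ ↦ 0`.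

Each Jacobsson move forgets vertically smoothed crossings. Resolving `c` pinches off a small loop
and keeps the part where that loop is marked `v₋`; since `z ⊗ v₋` has coefficient `1` in `Δ(z)` and
the other generator tensored with `v₋` has coefficient `0`, nothing else happens
(`resolveMap_eq_proj`). The Reidemeister II map does the same, up to sign, where the negative
crossing is `1`-smoothed (`Bigon.map_eq_proj`). Hence every move takes a lift to `±` a lift, and `ε`
is the product of the signs. An edge of `Φ` out of a lift either survives with its coefficient or
changes a crossing that is about to be removed, and is then killed by the move. So the moves commute
with `Φ` on lifts (`Removal.proj_edge`, `Bigon.map_edge_lower`), and nothing is needed about `Φ` on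
other states. The induction over the moves is `IsJacobssonMap.good`.

For the passage to homology, the maps must respect `d`. Resolving is the quotient by a subcomplex;
the Reidemeister II map is handled by `Bigon.map_d`. For `Φ`, it is shown that `d + tΦ` squares to
zero for every rational `t`, as the cube differential of `ℚ[x] / (x² - t)`. The edge maps commute
with multiplication by `x` on a loop, and the all-`v₊` states generate, so anticommuting faces
reduce to the combinatorics of two surgeries (`surgery_square`). This uses planarity only in the
form that a change of smoothing merges two loops or splits one (`Surgical`). That in turn holds
because the strands of a planar state can be oriented alternately up and down: loops become cycles
of a permutation, and a change of smoothing multiplies it by a transposition.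

Moves exist because in `ω τ ω⁻¹` one can resolve `τ` and then cancel letters from the inside
outwards. -/

/-- The relation obtained from `R` by merging the classes of `x` and `y`. -/
def Join {P : Type} (R : P → P → Prop) (x y p q : P) : Prop :=
  R p q ∨ (R p x ∧ R y q) ∨ (R p y ∧ R x q)

/-- On the points in `A`, one of `R`, `R'` arises from the other one by merging the distinct classes
of `x` and `y`. -/
def Surgery {P : Type} (A : Finset P) (R R' : P → P → Prop) (x y : P) : Prop :=
  (¬ R x y ∧ ∀ p ∈ A, ∀ q ∈ A, R' p q ↔ Join R x y p q) ∨
  (¬ R' x y ∧ ∀ p ∈ A, ∀ q ∈ A, R p q ↔ Join R' x y p q)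

theorem Surgery.symm {P : Type} {A : Finset P} {R R' : P → P → Prop} {x y : P}
    (h : Surgery A R R' x y) : Surgery A R' R x y := Or.symm h

theorem Join.equivalence {P : Type} {R : P → P → Prop} (hR : Equivalence R) (x y : P) :
    Equivalence (Join R x y) where
  refl p := Or.inl (hR.refl p)
  symm := by
    rintro p q (h | ⟨h1, h2⟩ | ⟨h1, h2⟩)
    · exact Or.inl (hR.symm h)
    · exact Or.inr (Or.inr ⟨hR.symm h2, hR.symm h1⟩)
    · exact Or.inr (Or.inl ⟨hR.symm h2, hR.symm h1⟩)
  trans := by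
    have ht := @hR.trans
    have hs := @hR.symm
    rintro p q r (h | ⟨h1, h2⟩ | ⟨h1, h2⟩) (h' | ⟨h1', h2'⟩ | ⟨h1', h2'⟩) <;> unfold Join
    · exact Or.inl (ht h h')
    · exact Or.inr (Or.inl ⟨ht h h1', h2'⟩)
    · exact Or.inr (Or.inr ⟨ht h h1', h2'⟩)
    · exact Or.inr (Or.inl ⟨h1, ht h2 h'⟩)
    · exact Or.inr (Or.inl ⟨h1, h2'⟩)
    · exact Or.inl (ht h1 h2')
    · exact Or.inr (Or.inr ⟨h1, ht h2 h'⟩)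
    · exact Or.inl (ht h1 h2')
    · exact Or.inr (Or.inr ⟨h1, h2'⟩)

/-! ### Cycles of a permutation after multiplication by a transposition. -/

section Perm
open Equiv

variable {α : Type} [Finite α] [DecidableEq α]

/-- An equivalence relation which relates every point to its image contains the cycles. -/
theorem sameCycle_le {α : Type} [Finite α] {R : α → α → Prop} (hR : Equivalence R) {π : Perm α}
    (h : ∀ p, R p (π p)) {p q : α} (hpq : π.SameCycle p q) : R p q := by
  obtain ⟨n, rfl⟩ := hpq.exists_nat_pow_eq
  induction n with
  | zero => exact hR.refl p
  | succ n ih =>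
    rw [pow_succ', Perm.mul_apply]
    exact hR.trans (ih ⟨n, by simp⟩) (h _)

/-- The new permutation sends `x` to `π y` and then follows the `π`-orbit of `y`, which never meets
`x`. It therefore arrives at `y` after `m` steps, where `m` is the period of `y` under `π`. -/
theorem sameCycle_mul_swap_of_not {π : Perm α} {x y : α} (h : ¬ π.SameCycle x y) :
    (π * swap x y).SameCycle x y := by
  have hxy : x ≠ y := fun e => h (e ▸ Perm.SameCycle.refl _ _)
  have hex : ∃ m, 0 < m ∧ (π ^ m) y = y :=
    ⟨orderOf π, orderOf_pos π, by rw [pow_orderOf_eq_one]; rfl⟩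
  obtain ⟨hm, hmy⟩ := Nat.find_spec hex
  have hmin := fun k => @Nat.find_min _ _ hex k
  set m := Nat.find hex
  have key : ∀ i, i < m → ((π * swap x y) ^ (i + 1)) x = (π ^ (i + 1)) y := by
    intro i hi
    induction i with
    | zero => simp
    | succ i ih =>
      rw [pow_succ', Perm.mul_apply, ih (by omega), pow_succ' π (i + 1), Perm.mul_apply π,
        Perm.mul_apply, swap_apply_of_ne_of_ne]
      · intro e
        exact h (Perm.SameCycle.symm ⟨(i + 1 : ℕ), by rw [zpow_natCast]; exact e⟩)
      · intro e
        exact hmin (i + 1) hi ⟨by omega, e⟩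
  refine ⟨m, ?_⟩
  have := key (m - 1) (by omega)
  rw [Nat.sub_add_cancel hm] at this
  simpa [hmy] using this

/-- Let `m` be the first exponent with `π ^ m` taking `x` to `y`. The new orbit of `y` stays among
the points `π ^ i x` with `0 < i ≤ m`, since `y` is sent back to `π x`. None of these is `x`, by
minimality of `m`. -/
theorem not_sameCycle_mul_swap {π : Perm α} {x y : α} (hxy : x ≠ y) (h : π.SameCycle x y) :
    ¬ (π * swap x y).SameCycle x y := by
  have hex : ∃ m, (π ^ m) x = y := h.exists_nat_pow_eq
  have hmy := Nat.find_spec hex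
  have hmin := fun k => @Nat.find_min _ _ hex k
  set m := Nat.find hex
  have hm : 0 < m := by
    rcases Nat.eq_zero_or_pos m with h0 | h0
    · rw [h0] at hmy; exact absurd hmy hxy
    · exact h0
  have hne : ∀ i, 0 < i → i ≤ m → (π ^ i) x ≠ x := by
    intro i hi him e
    refine hmin (m - i) (by omega) ?_
    conv_lhs => rw [← e, ← Perm.mul_apply, ← pow_add, Nat.sub_add_cancel him]
    exact hmy
  have key : ∀ k : ℕ, ∃ i, 0 < i ∧ i ≤ m ∧ ((π * swap x y) ^ k) y = (π ^ i) x := by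
    intro k
    induction k with
    | zero => exact ⟨m, hm, le_rfl, hmy.symm⟩
    | succ k ih =>
      obtain ⟨i, hi, him, e⟩ := ih
      rw [pow_succ', Perm.mul_apply, e, Perm.mul_apply]
      rcases him.eq_or_lt with rfl | hlt
      · exact ⟨1, one_pos, hi, by rw [hmy, swap_apply_right, pow_one]⟩
      · refine ⟨i + 1, by omega, hlt, ?_⟩
        rw [swap_apply_of_ne_of_ne (hne i hi him) (hmin i hlt), pow_succ', Perm.mul_apply]
  intro hc
  obtain ⟨k, hk⟩ := hc.symm.exists_nat_pow_eq
  obtain ⟨i, hi, him, e⟩ := key k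
  exact hne i hi him (e.symm.trans hk)

/-- Each inclusion of equivalence relations need only be checked on single steps of a permutation,
and the two permutations differ only at `x` and `y`. -/
theorem sameCycle_mul_swap_iff {π : Perm α} {x y : α} (h : ¬ π.SameCycle x y) (p q : α) :
    (π * swap x y).SameCycle p q ↔ Join π.SameCycle x y p q := by
  have hxy' := sameCycle_mul_swap_of_not h
  have hπ := Perm.SameCycle.equivalence π
  have hπ' := Perm.SameCycle.equivalence (π * swap x y)
  have hle : ∀ {p q}, π.SameCycle p q → (π * swap x y).SameCycle p q := by
    refine sameCycle_le hπ' fun p => ?_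
    by_cases hx : p = x
    · subst hx
      refine hxy'.trans ⟨1, ?_⟩
      simp
    by_cases hy : p = y
    · subst hy
      refine hxy'.symm.trans ⟨1, ?_⟩
      simp
    · exact ⟨1, by simp [swap_apply_of_ne_of_ne hx hy]⟩
  constructor
  · refine sameCycle_le (Join.equivalence hπ x y) fun p => ?_
    by_cases hx : p = x
    · subst hx
      refine Or.inr (Or.inl ⟨hπ.refl _, 1, ?_⟩)
      simp
    by_cases hy : p = y
    · subst hy
      refine Or.inr (Or.inr ⟨hπ.refl _, 1, ?_⟩)
      simp
    · exact Or.inl ⟨1, by simp [swap_apply_of_ne_of_ne hx hy]⟩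
  · rintro (h | ⟨h1, h2⟩ | ⟨h1, h2⟩)
    · exact hle h
    · exact (hle h1).trans (hxy'.trans (hle h2))
    · exact (hle h1).trans (hxy'.symm.trans (hle h2))

/-- Multiplication by a transposition merges two cycles or splits one. -/
theorem sameCycle_surgery (π : Perm α) {x y : α} (hxy : x ≠ y) :
    (¬ π.SameCycle x y ∧ ∀ p q, (π * swap x y).SameCycle p q ↔ Join π.SameCycle x y p q) ∨
    (¬ (π * swap x y).SameCycle x y ∧
      ∀ p q, π.SameCycle p q ↔ Join (π * swap x y).SameCycle x y p q) := by
  by_cases h : π.SameCycle x y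
  · refine Or.inr ⟨not_sameCycle_mul_swap hxy h, fun p q => ?_⟩
    have := sameCycle_mul_swap_iff (not_sameCycle_mul_swap hxy h) p q
    rwa [mul_assoc, swap_mul_self, mul_one] at this
  · exact Or.inl ⟨h, sameCycle_mul_swap_iff h⟩

end Perm

/-- Two surgeries in either order: the types of the surgeries (merging or splitting) agree up to the
order, and if they do not agree surgery by surgery, then the loops at the two places are the
same at the end. -/
theorem surgery_square {P : Type} {A : Finset P} {R Rb Rc Ru : P → P → Prop}
    (hR : Equivalence R) (hRb : Equivalence Rb) (hRc : Equivalence Rc) (hRu : Equivalence Ru)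
    {b b' c c' : P} (mb : b ∈ A) (mb' : b' ∈ A) (mc : c ∈ A) (mc' : c' ∈ A)
    (h1 : Surgery A R Rb b b') (h2 : Surgery A Rb Ru c c')
    (h3 : Surgery A R Rc c c') (h4 : Surgery A Rc Ru b b') :
    ((R b b' ↔ Rc b b') ∧ (Rb c c' ↔ R c c')) ∨
    ((R b b' ↔ R c c') ∧ (Rb c c' ↔ Rc b b') ∧
      ((Ru b c ∧ Ru b' c') ∨ (Ru b c' ∧ Ru b' c))) := by
  have s1 := @hR.symm
  have s2 := @hRb.symm
  have s3 := @hRc.symm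
  have s4 := @hRu.symm
  have t1 := @hR.trans
  have t2 := @hRb.trans
  have t3 := @hRc.trans
  have t4 := @hRu.trans
  have r1 := hR.refl
  have r2 := hRb.refl
  have r3 := hRc.refl
  have r4 := hRu.refl
  -- Only the six relations among the four points matter. Specialised to them, each of the sixteen
  -- combinations of merging and splitting is a finite problem.
  have inst : ∀ {Q Q' : P → P → Prop}, (∀ p ∈ A, ∀ q ∈ A, Q p q ↔ Q' p q) →
      (Q b b' ↔ Q' b b') ∧ (Q b c ↔ Q' b c) ∧ (Q b c' ↔ Q' b c') ∧
      (Q b' c ↔ Q' b' c) ∧ (Q b' c' ↔ Q' b' c') ∧ (Q c c' ↔ Q' c c') :=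
    fun h => ⟨h _ mb _ mb', h _ mb _ mc, h _ mb _ mc', h _ mb' _ mc, h _ mb' _ mc', h _ mc _ mc'⟩
  unfold Surgery at *
  rcases h1 with ⟨n1, h1⟩ | ⟨n1, h1⟩ <;> rcases h2 with ⟨n2, h2⟩ | ⟨n2, h2⟩ <;>
  rcases h3 with ⟨n3, h3⟩ | ⟨n3, h3⟩ <;> rcases h4 with ⟨n4, h4⟩ | ⟨n4, h4⟩ <;>
  (replace h1 := inst h1; replace h2 := inst h2; replace h3 := inst h3; replace h4 := inst h4
   clear inst hR hRb hRc hRu mb mb' mc mc'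
   simp only [Join] at h1 h2 h3 h4
   grind)

/-! ### The Frobenius algebra deformed by `t`. -/

/-- The tables of the Frobenius algebra `ℚ[x] / (x² - t)` with `v₊ = 1` and `v₋ = x`. -/
def deformedTable (t : ℚ) : EdgeTable where
  mul x y z := khovanovTable.mul x y z + t * leeTable.mul x y z
  comul x y z := khovanovTable.comul x y z + t * leeTable.comul x y z

/-- Exchanges `v₊` and `v₋`. -/
def Gen.swap : Gen → Gen
  | .plus => .minus
  | .minus => .plus

@[simp] theorem Gen.swap_swap (g : Gen) : g.swap.swap = g := by cases g <;> rfl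

theorem Gen.swap_eq_iff {g h : Gen} : g.swap = h ↔ g = h.swap := by
  cases g <;> cases h <;> simp [Gen.swap]

/-- The coefficient of multiplication by `x` in `ℚ[x] / (x² - t)` at a generator. -/
def Gen.weight (t : ℚ) : Gen → ℚ
  | .plus => 1
  | .minus => t

/-! ### Edge maps are linear over multiplication by `x` on a loop. -/

namespace Pattern
variable {P Q : Type}

/-- What the chain complex of a link diagram needs from planarity: changing a smoothing merges two
loops or splits one. -/
structure Surgical (S : Pattern P) : Prop where
  link_mem : ∀ o p q, S.Link o p q → (p ∈ S.points ↔ q ∈ S.points)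
  corner_mem : ∀ c ∈ S.crossings, ∀ i, S.corner c i ∈ S.points
  surgery : ∀ o ⊆ S.crossings, ∀ c ∈ S.crossings, c ∉ o →
    Surgery S.points (S.SameLoop o) (S.SameLoop (insert c o)) (S.corner c 0) (S.corner c 2)

theorem sameLoop_equivalence (S : Pattern P) (o : Finset ℕ) : Equivalence (S.SameLoop o) :=
  Relation.EqvGen.is_equivalence _

theorem SameLoop.symm {S : Pattern P} {o : Finset ℕ} {p q : P} (h : S.SameLoop o p q) :
    S.SameLoop o q p := (S.sameLoop_equivalence o).symm h

theorem SameLoop.trans {S : Pattern P} {o : Finset ℕ} {p q r : P} (h : S.SameLoop o p q)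
    (h' : S.SameLoop o q r) : S.SameLoop o p r := (S.sameLoop_equivalence o).trans h h'

theorem SameLoop.refl (S : Pattern P) (o : Finset ℕ) (p : P) : S.SameLoop o p p :=
  (S.sameLoop_equivalence o).refl p

theorem Surgical.sameLoop_mem {S : Pattern P} (hS : S.Surgical) {o : Finset ℕ} {p q : P}
    (h : S.SameLoop o p q) : p ∈ S.points ↔ q ∈ S.points := by
  induction h with
  | rel p q h => exact hS.link_mem o p q h
  | refl p => rfl
  | symm p q _ ih => exact ih.symm
  | trans p q r _ _ ih ih' => exact ih.trans ih'

variable {S : Pattern P}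

theorem EnhancedState.mark_eq_plus {s : S.EnhancedState} {p : P} :
    s.mark p = .plus ↔ p ∈ s.plus := by
  unfold EnhancedState.mark; split_ifs with h <;> simp [h]

theorem EnhancedState.mark_eq_minus {s : S.EnhancedState} {p : P} :
    s.mark p = .minus ↔ p ∉ s.plus := by
  unfold EnhancedState.mark; split_ifs with h <;> simp [h]

theorem EnhancedState.mark_eq_mark {T : Pattern Q} {s : S.EnhancedState} {t : T.EnhancedState}
    {p : P} {q : Q} : s.mark p = t.mark q ↔ (p ∈ s.plus ↔ q ∈ t.plus) := by
  unfold EnhancedState.mark; split_ifs <;> simp [*]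

theorem EnhancedState.mark_congr (s : S.EnhancedState) {p q : P} (h : S.SameLoop s.ones p q) :
    s.mark p = s.mark q := EnhancedState.mark_eq_mark.2 (s.plus_iff p q h)

theorem EnhancedState.ext_mark {s t : S.EnhancedState} (h : s.ones = t.ones)
    (hm : ∀ p ∈ S.points, s.mark p = t.mark p) : s = t := by
  refine EnhancedState.ext h (Finset.ext fun p => ?_)
  by_cases hp : p ∈ S.points
  · exact EnhancedState.mark_eq_mark.1 (hm p hp)
  · exact iff_of_false (fun h => hp (s.plus_subset h)) (fun h => hp (t.plus_subset h))

section flip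

/-- The enhanced state in which the mark of the loop through `p` is exchanged. -/
def flip (hS : S.Surgical) (p : P) (s : S.EnhancedState) : S.EnhancedState where
  ones := s.ones
  ones_subset := s.ones_subset
  plus := S.points.filter fun q => if S.SameLoop s.ones p q then q ∉ s.plus else q ∈ s.plus
  plus_subset := Finset.filter_subset _ _
  plus_iff q r h := by
    have h1 := hS.sameLoop_mem h
    have h2 := s.plus_iff q r h
    have h3 : S.SameLoop s.ones p q ↔ S.SameLoop s.ones p r :=
      ⟨fun h' => h'.trans h, fun h' => h'.trans h.symm⟩
    simp only [Finset.mem_filter, h1, h2, h3]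

variable (hS : S.Surgical)

@[simp] theorem flip_ones (p : P) (s : S.EnhancedState) : (flip hS p s).ones = s.ones := rfl

theorem mark_flip (p : P) (s : S.EnhancedState) {q : P} (hq : q ∈ S.points) :
    (flip hS p s).mark q = if S.SameLoop s.ones p q then (s.mark q).swap else s.mark q := by
  unfold EnhancedState.mark flip
  by_cases h : S.SameLoop s.ones p q <;> by_cases h' : q ∈ s.plus <;> simp [h, h', hq, Gen.swap]

theorem flip_flip (p : P) (s : S.EnhancedState) : flip hS p (flip hS p s) = s := by
  refine EnhancedState.ext_mark rfl fun q hq => ?_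
  rw [mark_flip hS _ _ hq, mark_flip hS _ _ hq, flip_ones]
  split_ifs <;> simp

theorem flip_eq_iff {p : P} {s t : S.EnhancedState} : flip hS p s = t ↔ s = flip hS p t :=
  ⟨fun h => by rw [← h, flip_flip], fun h => by rw [h, flip_flip]⟩

theorem flip_comm (p q : P) (s : S.EnhancedState) :
    flip hS p (flip hS q s) = flip hS q (flip hS p s) := by
  refine EnhancedState.ext_mark rfl fun r hr => ?_
  simp only [mark_flip hS _ _ hr, flip_ones]
  split_ifs <;> rfl

theorem flip_congr {p q : P} {s : S.EnhancedState} (h : S.SameLoop s.ones p q) :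
    flip hS p s = flip hS q s := by
  refine EnhancedState.ext_mark rfl fun r hr => ?_
  have : S.SameLoop s.ones p r ↔ S.SameLoop s.ones q r :=
    ⟨fun h' => h.symm.trans h', fun h' => h.trans h'⟩
  simp only [mark_flip hS _ _ hr, this]

/-- The unsigned coefficient of the edge map at `c`, for enhanced states over the ends of the edge. -/
def localCoeff (E : EdgeTable) (c : ℕ) (s u : S.EnhancedState) : ℚ :=
  if AgreeOff id {S.corner c 0, S.corner c 2} s u then
    surgeryCoeff E s u (S.corner c 0) (S.corner c 2) (S.corner c 0) (S.corner c 2)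
  else 0

theorem agreeOff_pair {T : Pattern Q} {f : P → Q} {x y : P} {s : S.EnhancedState}
    {u : T.EnhancedState} : AgreeOff f {x, y} s u ↔ ∀ q ∈ S.points,
      ¬ S.SameLoop s.ones q x → ¬ S.SameLoop s.ones q y → s.mark q = u.mark (f q) := by
  simp [AgreeOff]

theorem localCoeff_eq (E : EdgeTable) (c : ℕ) (s u : S.EnhancedState) :
    localCoeff E c s u = if ∀ q ∈ S.points, ¬ S.SameLoop s.ones q (S.corner c 0) →
        ¬ S.SameLoop s.ones q (S.corner c 2) → s.mark q = u.mark q then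
      if S.SameLoop s.ones (S.corner c 0) (S.corner c 2) then
        E.comul (s.mark (S.corner c 0)) (u.mark (S.corner c 0)) (u.mark (S.corner c 2))
      else E.mul (s.mark (S.corner c 0)) (s.mark (S.corner c 2)) (u.mark (S.corner c 0))
    else 0 := by
  unfold localCoeff surgeryCoeff
  simp only [agreeOff_pair, id]

/-- This is the linearity of an edge map over `x` on the loop through `p`, in matrix entries: the
flip acts on the source on the left and on the target on the right. Either that loop takes part in
the surgery, and the identity is the compatibility of `μ` or `Δ` with `x`, or it is untouched. -/
theorem localCoeff_flip (t : ℚ) {c : ℕ} {s u : S.EnhancedState} (hc : c ∈ S.crossings)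
    (hcs : c ∉ s.ones) (hu : u.ones = insert c s.ones) {p : P} (hp : p ∈ S.points) :
    (s.mark p).weight t * localCoeff (deformedTable t) c (flip hS p s) u =
      (u.mark p).swap.weight t * localCoeff (deformedTable t) c s (flip hS p u) := by
  have hx := hS.corner_mem c hc 0
  have hy := hS.corner_mem c hc 2
  have hsurg := hS.surgery s.ones s.ones_subset c hc hcs
  rw [← hu] at hsurg
  have mS := fun {a b : P} => s.mark_congr (p := a) (q := b)
  have mU := fun {a b : P} => u.mark_congr (p := a) (q := b)
  have hfs := fun q (hq : q ∈ S.points) => mark_flip hS p s hq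
  have hfu := fun q (hq : q ∈ S.points) => mark_flip hS p u hq
  have hR := S.sameLoop_equivalence s.ones
  have hR' := S.sameLoop_equivalence u.ones
  rw [localCoeff_eq, localCoeff_eq, flip_ones]
  generalize S.corner c 0 = x at *
  generalize S.corner c 2 = y at *
  unfold Surgery Join at hsurg
  generalize S.SameLoop s.ones = R at *
  generalize S.SameLoop u.ones = R' at *
  have s1 := @hR.symm
  have t1 := @hR.trans
  have r1 := hR.refl
  have s2 := @hR'.symm
  have t2 := @hR'.trans
  have r2 := hR'.refl
  by_cases hoff : R p x ∨ R p y
  · have hA : (∀ q ∈ S.points, ¬ R q x → ¬ R q y → (flip hS p s).mark q = u.mark q) ↔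
        (∀ q ∈ S.points, ¬ R q x → ¬ R q y → s.mark q = (flip hS p u).mark q) := by
      refine forall₄_congr fun q hq h1 h2 => ?_
      rw [hfs q hq, hfu q hq, if_neg, if_neg]
      · rcases hsurg with ⟨-, h⟩ | ⟨-, h⟩
        · rw [h p hp q hq]; grind
        · have := h p hp q hq; grind
      · grind
    rw [if_congr hA rfl rfl]
    split_ifs with h1 h2
    · rcases hsurg with ⟨h, -⟩ | ⟨hn, h⟩
      · exact absurd h2 h
      have hpx : R p x := by grind
      have hpy : R p y := by grind
      -- After a split the point `p` lies on exactly one of the two new loops.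
      have : (R' p x ∧ ¬ R' p y) ∨ (R' p y ∧ ¬ R' p x) := by
        have := (h p hp x hx).1 hpx; grind
      rw [hfs x hx, if_pos hpx, hfu x hx, hfu y hy, mS hpx]
      rcases this with ⟨k1, k2⟩ | ⟨k1, k2⟩ <;> rw [if_pos k1, if_neg k2, mU k1] <;>
      cases s.mark x <;> cases u.mark x <;> cases u.mark y <;>
        simp [Gen.weight, Gen.swap, deformedTable, khovanovTable, leeTable]
    · rcases hsurg with ⟨hn, h⟩ | ⟨-, h⟩
      swap
      · exact absurd ((h x hx y hy).2 (by grind)) h2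
      have hpx : R' p x := (h p hp x hx).2 (by grind)
      rw [hfs x hx, hfs y hy, hfu x hx, if_pos hpx, mU hpx]
      rcases hoff with k | k
      · have k2 : ¬ R p y := by grind
        rw [if_pos k, if_neg k2, mS k]
        cases s.mark x <;> cases u.mark x <;> cases s.mark y <;>
        simp [Gen.weight, Gen.swap, deformedTable, khovanovTable, leeTable]
      · have k2 : ¬ R p x := by grind
        rw [if_pos k, if_neg k2, mS k]
        cases s.mark x <;> cases u.mark x <;> cases s.mark y <;>
        simp [Gen.weight, Gen.swap, deformedTable, khovanovTable, leeTable]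
    · simp
  · push Not at hoff
    -- A loop away from the surgery consists of the same points before and after.
    have hRR' : ∀ q ∈ S.points, R p q ↔ R' p q := by
      intro q hq
      rcases hsurg with ⟨-, h⟩ | ⟨-, h⟩
      · rw [h p hp q hq]; grind
      · have h1 := h p hp x hx
        have h2 := h p hp y hy
        rw [h p hp q hq]; grind
    have hA : (∀ q ∈ S.points, ¬ R q x → ¬ R q y → (flip hS p s).mark q = u.mark q) ↔
        (∀ q ∈ S.points, ¬ R q x → ¬ R q y → s.mark q = (flip hS p u).mark q) := by
      refine forall₄_congr fun q hq h1 h2 => ?_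
      rw [hfs q hq, hfu q hq, if_congr (hRR' q hq) rfl rfl]
      split_ifs
      · exact Gen.swap_eq_iff
      · rfl
    rw [if_congr hA rfl rfl]
    have e1 := hfs x hx
    have e2 := hfs y hy
    have e3 := hfu x hx
    have e4 := hfu y hy
    rw [if_neg hoff.1] at e1
    rw [if_neg hoff.2] at e2
    rw [if_neg (by rw [← hRR' x hx]; exact hoff.1)] at e3
    rw [if_neg (by rw [← hRR' y hy]; exact hoff.2)] at e4
    -- If the markings agree off the surgery, then in particular at `p`, which makes the two weights
    -- equal; otherwise both coefficients vanish.
    by_cases h1 : ∀ q ∈ S.points, ¬ R q x → ¬ R q y → s.mark q = (flip hS p u).mark q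
    · have h3 := h1 p hp hoff.1 hoff.2
      rw [hfu p hp, if_pos (r2 p)] at h3
      rw [if_pos h1, if_pos h1, h3, e1, e2, e3, e4]
    · rw [if_neg h1, if_neg h1, mul_zero, mul_zero]

end flip

end Pattern

/-! ### The faces of the cube anticommute; `d` and `Φ` anticommute. -/

namespace Pattern
variable {P Q : Type}

section ofCoeff
variable {S : Pattern P} {T : Pattern Q}

theorem ofCoeff_chain_apply (a : S.EnhancedState → T.EnhancedState → ℚ) (s : S.EnhancedState)
    (u : T.EnhancedState) : ofCoeff a s.chain u = a s u := by
  simp only [ofCoeff, EnhancedState.chain, Finsupp.linearCombination_single, one_smul,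
    Finsupp.finsetSum_apply]
  rw [Finset.sum_eq_single u]
  · simp
  · intro v _ hv
    exact Finsupp.single_eq_of_ne hv.symm
  · simp

theorem chain_ext {M : Type*} [AddCommGroup M] [Module ℚ M] {f g : S.Chain →ₗ[ℚ] M}
    (h : ∀ s : S.EnhancedState, f s.chain = g s.chain) : f = g := by
  refine Finsupp.lhom_ext' fun s => LinearMap.ext_ring ?_
  exact h s

end ofCoeff

variable {S : Pattern P}

/-- The signed edge maps for all edges of the cube at the crossing `c`. -/
def edgeMap (S : Pattern P) (E : EdgeTable) (c : ℕ) : S.Chain →ₗ[ℚ] S.Chain :=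
  ofCoeff fun s u => if c ∈ S.crossings ∧ c ∉ s.ones ∧ u.ones = insert c s.ones then
    (-1) ^ (s.ones.filter (· < c)).card * localCoeff E c s u else 0

theorem ofCoeff_edgeCoeff (E : EdgeTable) :
    ofCoeff (edgeCoeff (S := S) E) = ∑ c ∈ S.crossings, edgeMap S E c := by
  refine chain_ext fun s => Finsupp.ext fun u => ?_
  rw [LinearMap.sum_apply, Finsupp.finsetSum_apply, ofCoeff_chain_apply, edgeCoeff]
  simp only [edgeMap, ofCoeff_chain_apply]
  rw [Finset.sdiff_eq_filter, Finset.sum_filter]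
  refine Finset.sum_congr rfl fun c hc => ?_
  simp only [hc, true_and, localCoeff, ite_and]
  split_ifs <;> simp

variable (hS : S.Surgical) (t : ℚ)

/-- Multiplication by `x` on the loop through `p`. -/
def mulX (p : P) : S.Chain →ₗ[ℚ] S.Chain :=
  Finsupp.linearCombination ℚ fun s => (s.mark p).weight t • (flip hS p s).chain

theorem mulX_chain (p : P) (s : S.EnhancedState) :
    mulX hS t p s.chain = (s.mark p).weight t • (flip hS p s).chain := by
  simp [mulX, EnhancedState.chain]

/-- The transposed description of `mulX`: flipping is an involution, so the entry at `u` comes only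
from `flip hS p u`, whose mark at `p` is the opposite one. -/
theorem mulX_apply {p : P} (hp : p ∈ S.points) (z : S.Chain) (u : S.EnhancedState) :
    mulX hS t p z u = (u.mark p).swap.weight t * z (flip hS p u) := by
  have : Finsupp.lapply u ∘ₗ mulX hS t p =
      (u.mark p).swap.weight t • (Finsupp.lapply (R := ℚ) (M := ℚ) (flip hS p u)) := by
    refine chain_ext fun s => ?_
    rw [LinearMap.comp_apply, mulX_chain]
    simp only [LinearMap.smul_apply, Finsupp.lapply_apply, map_smul,
      EnhancedState.chain, smul_eq_mul, Finsupp.single_apply, flip_eq_iff]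
    split_ifs with h
    · rw [h, mark_flip hS _ _ hp, if_pos (SameLoop.refl _ _ _)]
    · simp
  exact LinearMap.congr_fun this z

theorem edgeMap_mulX (c : ℕ) {p : P} (hp : p ∈ S.points) :
    edgeMap S (deformedTable t) c ∘ₗ mulX hS t p = mulX hS t p ∘ₗ edgeMap S (deformedTable t) c := by
  refine chain_ext fun s => Finsupp.ext fun u => ?_
  simp only [LinearMap.comp_apply, mulX_chain, map_smul, Finsupp.smul_apply, mulX_apply hS t hp,
    edgeMap, ofCoeff_chain_apply, flip_ones, smul_eq_mul]
  by_cases h : c ∈ S.crossings ∧ c ∉ s.ones ∧ u.ones = insert c s.ones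
  · have := localCoeff_flip hS t h.1 h.2.1 h.2.2 hp
    simp only [h, not_false_eq_true, and_self, if_true]
    linear_combination (-1) ^ (s.ones.filter (· < c)).card * this
  · simp only [h, if_false, mul_zero]

theorem mulX_comm {p q : P} (hp : p ∈ S.points) (hq : q ∈ S.points) (z : S.Chain) :
    mulX hS t p (mulX hS t q z) = mulX hS t q (mulX hS t p z) := by
  ext u
  simp only [mulX_apply hS t hp, mulX_apply hS t hq, mark_flip hS _ _ hp, mark_flip hS _ _ hq,
    flip_comm hS p q]
  by_cases h : S.SameLoop u.ones p q
  · rw [if_pos h, if_pos h.symm, u.mark_congr h]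
  · rw [if_neg h, if_neg fun h' => h h'.symm]; ring

/-- The enhanced state with all loops marked by `v₊`. -/
def allPlus (o : Finset ℕ) (ho : o ⊆ S.crossings) : S.EnhancedState where
  ones := o
  ones_subset := ho
  plus := S.points
  plus_subset := subset_rfl
  plus_iff _ _ h := hS.sameLoop_mem h

/-- The chain of the enhanced state with all loops marked by `v₊`. -/
def plusChain (o : Finset ℕ) : S.Chain :=
  if ho : o ⊆ S.crossings then (allPlus hS o ho).chain else 0

theorem mulX_plusChain_congr {p q : P} {o : Finset ℕ} (h : S.SameLoop o p q) :
    mulX hS t p (plusChain hS o) = mulX hS t q (plusChain hS o) := by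
  unfold plusChain
  split_ifs with ho
  · have h' : S.SameLoop (allPlus hS o ho).ones p q := h
    rw [mulX_chain, mulX_chain, flip_congr hS h', EnhancedState.mark_congr _ h']
  · simp

/-- The complex is generated by the states with all loops marked by `v₊`, under `mulX`. -/
theorem ext_of_plusChain {M : Type*} [AddCommGroup M] [Module ℚ M] {f g : S.Chain →ₗ[ℚ] M}
    (Y : P → M →ₗ[ℚ] M) (hf : ∀ p ∈ S.points, f ∘ₗ mulX hS t p = Y p ∘ₗ f)
    (hg : ∀ p ∈ S.points, g ∘ₗ mulX hS t p = Y p ∘ₗ g)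
    (h : ∀ o, f (plusChain hS o) = g (plusChain hS o)) : f = g := by
  refine chain_ext fun s => ?_
  induction hn : (S.points \ s.plus).card using Nat.strong_induction_on generalizing s with
  | _ n ih =>
    by_cases hs : S.points ⊆ s.plus
    · have : s.chain = plusChain hS s.ones := by
        rw [plusChain, dif_pos s.ones_subset]
        exact congrArg _ (EnhancedState.ext rfl (subset_antisymm s.plus_subset hs))
      rw [this, h]
    · obtain ⟨p, hp, hps⟩ := Finset.not_subset.1 hs
      have hm : (flip hS p s).mark p = .plus := by
        rw [mark_flip hS _ _ hp, if_pos (SameLoop.refl _ _ _), EnhancedState.mark_eq_minus.2 hps]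
        rfl
      -- The weight of `v₊` is `1`, so a state with a loop marked `v₋` is exactly `x` times the
      -- state where this loop is marked `v₊`. The latter has fewer points marked `v₋`.
      have key : s.chain = mulX hS t p (flip hS p s).chain := by
        rw [mulX_chain, hm, flip_flip, Gen.weight, one_smul]
      have hlt : (S.points \ (flip hS p s).plus).card < n := by
        rw [← hn]
        refine Finset.card_lt_card (Finset.ssubset_iff_of_subset ?_ |>.2 ⟨p, ?_, ?_⟩)
        · intro q hq
          rw [Finset.mem_sdiff] at hq ⊢
          refine ⟨hq.1, fun hqs => hq.2 ?_⟩
          rw [← EnhancedState.mark_eq_plus, mark_flip hS _ _ hq.1, if_neg]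
          · exact EnhancedState.mark_eq_plus.2 hqs
          · intro hpq
            exact hps ((s.plus_iff _ _ hpq).2 hqs)
        · exact Finset.mem_sdiff.2 ⟨hp, hps⟩
        · exact fun h => (Finset.mem_sdiff.1 h).2 (EnhancedState.mark_eq_plus.1 hm)
      have := ih _ hlt _ rfl
      rw [key]
      have e1 := LinearMap.congr_fun (hf p hp) (flip hS p s).chain
      have e2 := LinearMap.congr_fun (hg p hp) (flip hS p s).chain
      simp only [LinearMap.comp_apply] at e1 e2
      rw [e1, e2, this]

/-- What the edge map at `c` over the state `o` does to the unit. -/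
def edgeFactor (o : Finset ℕ) (c : ℕ) : S.Chain →ₗ[ℚ] S.Chain :=
  if S.SameLoop o (S.corner c 0) (S.corner c 2) then
    mulX hS t (S.corner c 0) + mulX hS t (S.corner c 2)
  else LinearMap.id

theorem edgeMap_edgeFactor (o : Finset ℕ) (b : ℕ) {c : ℕ} (hc : c ∈ S.crossings) (z : S.Chain) :
    edgeMap S (deformedTable t) b (edgeFactor hS t o c z) =
      edgeFactor hS t o c (edgeMap S (deformedTable t) b z) := by
  have h i := LinearMap.congr_fun (edgeMap_mulX hS t b (hS.corner_mem c hc i)) z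
  simp only [LinearMap.comp_apply] at h
  unfold edgeFactor
  split_ifs <;> simp [h]

theorem edgeFactor_comm (o o' : Finset ℕ) {b c : ℕ} (hb : b ∈ S.crossings) (hc : c ∈ S.crossings)
    (z : S.Chain) : edgeFactor hS t o b (edgeFactor hS t o' c z) =
      edgeFactor hS t o' c (edgeFactor hS t o b z) := by
  have h i j := mulX_comm hS t (hS.corner_mem b hb i) (hS.corner_mem c hc j) z
  unfold edgeFactor
  split_ifs <;> simp [h]
  abel

theorem edgeMap_plusChain_of_not {o : Finset ℕ} {c : ℕ} (hc : ¬ (c ∈ S.crossings ∧ c ∉ o)) :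
    edgeMap S (deformedTable t) c (plusChain hS o) = 0 := by
  unfold plusChain
  split_ifs with ho
  · ext u
    rw [edgeMap, ofCoeff_chain_apply, if_neg (fun h => hc ⟨h.1, h.2.1⟩)]; rfl
  · simp

/-- Only `1 · 1 = 1` and `Δ(1) = x ⊗ 1 + 1 ⊗ x` enter, and neither involves `t`. -/
theorem edgeMap_plusChain {o : Finset ℕ} {c : ℕ} (hc : c ∈ S.crossings) (hco : c ∉ o) :
    edgeMap S (deformedTable t) c (plusChain hS o) =
      (-1 : ℚ) ^ (o.filter (· < c)).card • edgeFactor hS t o c (plusChain hS (insert c o)) := by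
  by_cases ho : o ⊆ S.crossings
  swap
  · have : ¬ insert c o ⊆ S.crossings := fun h => ho ((Finset.subset_insert _ _).trans h)
    simp [plusChain, ho, this]
  have ho' : insert c o ⊆ S.crossings := Finset.insert_subset hc ho
  rw [plusChain, plusChain, dif_pos ho, dif_pos ho']
  set s := allPlus hS o ho with hs
  set s' := allPlus hS _ ho' with hs'
  have hones : s.ones = o := rfl
  have hones' : s'.ones = insert c o := rfl
  have hm : ∀ p ∈ S.points, s.mark p = .plus := fun p hp => EnhancedState.mark_eq_plus.2 hp
  have hm' : ∀ p ∈ S.points, s'.mark p = .plus := fun p hp => EnhancedState.mark_eq_plus.2 hp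
  have hx := hS.corner_mem c hc 0
  have hy := hS.corner_mem c hc 2
  ext u
  rw [edgeMap, ofCoeff_chain_apply, Finsupp.smul_apply, smul_eq_mul]
  simp only [hones, hc, hco, true_and, not_false_eq_true]
  have hsurg := hS.surgery o ho c hc hco
  by_cases hu : u.ones = insert c o
  swap
  · rw [if_neg hu]
    have : ∀ v : S.EnhancedState, v.ones = insert c o → v.chain u = 0 := fun v hv =>
      Finsupp.single_eq_of_ne fun e => hu (e ▸ hv)
    unfold edgeFactor
    split_ifs <;> simp [mulX_chain, this, hones']
  rw [if_pos hu]
  congr 1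
  rw [localCoeff_eq, hones, hm _ hx, hm _ hy]
  have hR' := S.sameLoop_equivalence (insert c o)
  have hR := S.sameLoop_equivalence o
  unfold edgeFactor
  split_ifs with h1 h2 h2
  · -- splitting
    obtain ⟨hn, h⟩ : ¬ _ ∧ _ := hsurg.resolve_left fun h => h.1 h2
    rw [LinearMap.add_apply, mulX_chain, mulX_chain, hm' _ hx, hm' _ hy, Gen.weight, one_smul,
      one_smul, Finsupp.add_apply]
    have key : ∀ z w, ((z = S.corner c 0 ∧ w = S.corner c 2) ∨
        (z = S.corner c 2 ∧ w = S.corner c 0)) →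
        (flip hS z s').chain u = if u.mark z = .minus ∧ u.mark w = .plus then 1 else 0 := by
      intro z w hzw
      have hz : z ∈ S.points := by rcases hzw with ⟨rfl, rfl⟩ | ⟨rfl, rfl⟩ <;> assumption
      have hw : w ∈ S.points := by rcases hzw with ⟨rfl, rfl⟩ | ⟨rfl, rfl⟩ <;> assumption
      have hzw' : ¬ S.SameLoop (insert c o) z w := by
        rcases hzw with ⟨rfl, rfl⟩ | ⟨rfl, rfl⟩
        · exact hn
        · exact fun h => hn h.symm
      rw [EnhancedState.chain, Finsupp.single_apply]
      refine if_congr ⟨?_, ?_⟩ rfl rfl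
      · rintro rfl
        rw [mark_flip hS _ _ hz, mark_flip hS _ _ hw, hm' _ hz, hm' _ hw, hones',
          if_pos (SameLoop.refl _ _ _), if_neg hzw']
        exact ⟨rfl, rfl⟩
      · rintro ⟨k1, k2⟩
        refine EnhancedState.ext_mark hu.symm fun q hq => ?_
        rw [mark_flip hS _ _ hq, hm' _ hq, hones']
        split_ifs with k3
        · rw [← u.mark_congr (hu ▸ k3), k1]; rfl
        · by_cases k4 : S.SameLoop (insert c o) w q
          · rw [← k2]; exact (u.mark_congr (hu ▸ k4))
          · rw [← h1 q hq, hm q hq]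
            · rw [h q hq _ hx]; unfold Join
              have := @hR'.symm; have := @hR'.trans; grind
            · rw [h q hq _ hy]; unfold Join
              have := @hR'.symm; have := @hR'.trans; grind
    rw [key _ (S.corner c 2) (Or.inl ⟨rfl, rfl⟩), key _ (S.corner c 0) (Or.inr ⟨rfl, rfl⟩)]
    cases u.mark (S.corner c 0) <;> cases u.mark (S.corner c 2) <;>
      simp [deformedTable, khovanovTable, leeTable]
  · obtain ⟨hn, h⟩ : ¬ _ ∧ _ := hsurg.resolve_right fun h => h2 ((h.2 _ hx _ hy).2
      (Or.inr (Or.inl ⟨hR'.refl _, hR'.refl _⟩)))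
    rw [LinearMap.id_apply, EnhancedState.chain, Finsupp.single_apply]
    have : s' = u ↔ u.mark (S.corner c 0) = .plus := by
      constructor
      · rintro rfl; exact hm' _ hx
      · intro k
        refine EnhancedState.ext_mark hu.symm fun q hq => ?_
        rw [hm' q hq]
        by_cases k4 : S.SameLoop (insert c o) (S.corner c 0) q
        · rw [← k]; exact (u.mark_congr (hu ▸ k4))
        · rw [← h1 q hq, hm q hq]
          · rw [h _ hx _ hq] at k4; unfold Join at k4
            have := @hR.symm; have := @hR.refl; grind
          · rw [h _ hx _ hq] at k4; unfold Join at k4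
            have := @hR.symm; have := @hR.refl; grind
    rw [if_congr this rfl rfl]
    cases u.mark (S.corner c 0) <;> simp [deformedTable, khovanovTable, leeTable]
  -- Here `u` has a loop marked `v₋` away from the surgery, while all states on the right-hand side
  -- are marked `v₊` there; both sides are zero.
  all_goals
    push Not at h1
    obtain ⟨q, hq, hqx, hqy, hne⟩ := h1
    rw [hm q hq] at hne
  · have hz : ∀ z, S.SameLoop o z (S.corner c 0) → z ∈ S.points → (flip hS z s').chain u = 0 := by
      intro z hz hzp
      refine Finsupp.single_eq_of_ne fun e => hne ?_
      have hzq : ¬ S.SameLoop (insert c o) z q := by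
        intro hzq
        have h := (hsurg.resolve_left fun h => h.1 h2).2
        exact hqx (((h _ hzp _ hq).2 (Or.inl hzq)).symm.trans hz)
      rw [e, mark_flip hS _ _ hq, hones', if_neg hzq, hm' q hq]
    rw [LinearMap.add_apply, mulX_chain, mulX_chain, Finsupp.add_apply, Finsupp.smul_apply,
      Finsupp.smul_apply, hz _ (SameLoop.refl _ _ _) hx, hz _ h2.symm hy]
    simp
  · refine (Finsupp.single_eq_of_ne fun e => hne ?_).symm
    rw [e, hm' q hq]

/-- By `surgery_square` there are two possibilities. If each crossing has the same type on both
paths, the factors are the same and commute. If instead the types go with the order along the path,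
the corners of `b` and `c` lie on the same loops of the final state, where multiplication by `x`
depends only on the loop. -/
theorem edgeFactor_square {o : Finset ℕ} (ho : o ⊆ S.crossings) {b c : ℕ} (hbc : b ≠ c)
    (hb : b ∈ S.crossings) (hc : c ∈ S.crossings) (hbo : b ∉ o) (hco : c ∉ o) :
    edgeFactor hS t o b (edgeFactor hS t (insert b o) c (plusChain hS (insert c (insert b o)))) =
    edgeFactor hS t o c (edgeFactor hS t (insert c o) b (plusChain hS (insert c (insert b o)))) := by
  have hsub : ∀ {d}, d ∈ S.crossings → insert d o ⊆ S.crossings := fun h => Finset.insert_subset h ho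
  have key := surgery_square (S.sameLoop_equivalence o) (S.sameLoop_equivalence (insert b o))
    (S.sameLoop_equivalence (insert c o)) (S.sameLoop_equivalence (insert c (insert b o)))
    (hS.corner_mem b hb 0) (hS.corner_mem b hb 2) (hS.corner_mem c hc 0) (hS.corner_mem c hc 2)
    (hS.surgery o ho b hb hbo) (hS.surgery _ (hsub hb) c hc (by simp [hbc.symm, hco]))
    (hS.surgery o ho c hc hco)
    (by
      have := hS.surgery _ (hsub hc) b hb (by simp [hbc, hbo])
      rwa [Finset.insert_comm] at this)
  rcases key with ⟨h1, h2⟩ | ⟨h1, h2, h3⟩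
  · rw [edgeFactor_comm hS t _ _ hb hc]
    simp only [edgeFactor, h1, h2]
  · have hX : mulX hS t (S.corner b 0) (plusChain hS (insert c (insert b o))) +
          mulX hS t (S.corner b 2) (plusChain hS (insert c (insert b o))) =
        mulX hS t (S.corner c 0) (plusChain hS (insert c (insert b o))) +
          mulX hS t (S.corner c 2) (plusChain hS (insert c (insert b o))) := by
      rcases h3 with ⟨k1, k2⟩ | ⟨k1, k2⟩
      · rw [mulX_plusChain_congr hS t k1, mulX_plusChain_congr hS t k2]
      · rw [mulX_plusChain_congr hS t k1, mulX_plusChain_congr hS t k2, add_comm]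
    have hcomm i j := mulX_comm hS t (hS.corner_mem b hb i) (hS.corner_mem c hc j)
      (plusChain hS (insert c (insert b o)))
    unfold edgeFactor
    rw [if_congr h1 rfl rfl, if_congr h2 rfl rfl]
    split_ifs
    · rw [LinearMap.add_apply, LinearMap.add_apply, LinearMap.add_apply, LinearMap.add_apply]
      simp only [map_add, hcomm]
      abel
    · exact hX
    · exact hX.symm
    · rfl

theorem neg_one_pow_filter_insert {o : Finset ℕ} {b : ℕ} (hbo : b ∉ o) (p : ℕ → Prop) [DecidablePred p] :
    (-1 : ℚ) ^ ((insert b o).filter p).card =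
      (if p b then -1 else 1) * (-1) ^ (o.filter p).card := by
  rw [Finset.filter_insert]
  split_ifs with h
  · rw [Finset.card_insert_of_notMem (by simp [hbo]), pow_succ, mul_comm]
  · simp

theorem edgeMap_edgeMap_plusChain_of_not (o : Finset ℕ) {b c : ℕ}
    (h : ¬ (b ≠ c ∧ b ∈ S.crossings ∧ c ∈ S.crossings ∧ b ∉ o ∧ c ∉ o)) :
    edgeMap S (deformedTable t) c (edgeMap S (deformedTable t) b (plusChain hS o)) = 0 := by
  by_cases hb : b ∈ S.crossings ∧ b ∉ o
  · rw [edgeMap_plusChain hS t hb.1 hb.2, map_smul, edgeMap_edgeFactor hS t _ _ hb.1,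
      edgeMap_plusChain_of_not hS t, map_zero, smul_zero]
    rintro ⟨hc, hco⟩
    rw [Finset.mem_insert, not_or] at hco
    exact h ⟨fun e => hco.1 e.symm, hb.1, hc, hb.2, hco.2⟩
  · rw [edgeMap_plusChain_of_not hS t hb, map_zero]

/-- Faces of the cube anticommute. -/
theorem edgeMap_anticomm (hS : S.Surgical) (t : ℚ) (b c : ℕ) :
    edgeMap S (deformedTable t) c ∘ₗ edgeMap S (deformedTable t) b =
      -(edgeMap S (deformedTable t) b ∘ₗ edgeMap S (deformedTable t) c) := by
  have h b p (hp : p ∈ S.points) z := LinearMap.congr_fun (edgeMap_mulX hS t b hp) z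
  simp only [LinearMap.comp_apply] at h
  -- Both composites commute with every `mulX`, so they need only be compared on the all-`v₊`
  -- states.
  refine ext_of_plusChain hS t (mulX hS t)
    (fun p hp => LinearMap.ext fun z => by simp [h _ p hp])
    (fun p hp => LinearMap.ext fun z => by simp [h _ p hp]) fun o => ?_
  rw [LinearMap.neg_apply, LinearMap.comp_apply, LinearMap.comp_apply]
  by_cases hbc : b ≠ c ∧ b ∈ S.crossings ∧ c ∈ S.crossings ∧ b ∉ o ∧ c ∉ o
  swap
  · rw [edgeMap_edgeMap_plusChain_of_not hS t o hbc, edgeMap_edgeMap_plusChain_of_not hS t o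
      (by tauto), neg_zero]
  obtain ⟨hbc, hb, hc, hbo, hco⟩ := hbc
  by_cases ho : o ⊆ S.crossings
  swap
  · simp [plusChain, ho]
  rw [edgeMap_plusChain hS t hb hbo, edgeMap_plusChain hS t hc hco, map_smul, map_smul,
    edgeMap_edgeFactor hS t _ _ hb, edgeMap_edgeFactor hS t _ _ hc,
    edgeMap_plusChain hS t hc (by simp [hbc.symm, hco]),
    edgeMap_plusChain hS t hb (by simp [hbc, hbo]), map_smul, map_smul,
    neg_one_pow_filter_insert hbo (· < c), neg_one_pow_filter_insert hco (· < b),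
    Finset.insert_comm b c, edgeFactor_square hS t ho hbc hb hc hbo hco, smul_smul, smul_smul,
    ← neg_smul]
  congr 1
  -- Exactly one of `b`, `c` precedes the other, so exactly one of the two paths acquires an extra
  -- sign.
  rcases hbc.lt_or_gt with h | h
  · rw [if_pos h, if_neg h.not_gt]; ring
  · rw [if_neg h.not_gt, if_pos h]; ring

/-- Exchanging the two crossings in the double sum shows that the square is its own negative. -/
theorem ofCoeff_edgeCoeff_sq (hS : S.Surgical) (t : ℚ) :
    ofCoeff (edgeCoeff (S := S) (deformedTable t)) ∘ₗ ofCoeff (edgeCoeff (deformedTable t)) = 0 := by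
  have h : ofCoeff (edgeCoeff (S := S) (deformedTable t)) ∘ₗ ofCoeff (edgeCoeff (deformedTable t)) =
      -(ofCoeff (edgeCoeff (S := S) (deformedTable t)) ∘ₗ
        ofCoeff (edgeCoeff (deformedTable t))) := by
    refine LinearMap.ext fun z => ?_
    simp only [ofCoeff_edgeCoeff, LinearMap.neg_apply, LinearMap.comp_apply, LinearMap.sum_apply,
      map_sum]
    conv_rhs => rw [Finset.sum_comm]
    rw [← Finset.sum_neg_distrib]
    refine Finset.sum_congr rfl fun b _ => ?_
    rw [← Finset.sum_neg_distrib]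
    exact Finset.sum_congr rfl fun c _ => LinearMap.congr_fun (edgeMap_anticomm hS t _ _) z
  refine LinearMap.ext fun z => Finsupp.ext fun u => ?_
  exact self_eq_neg.1 (DFunLike.congr_fun (LinearMap.congr_fun h z) u)

theorem ofCoeff_deformed :
    ofCoeff (edgeCoeff (S := S) (deformedTable t)) = S.d + t • S.lee := by
  refine chain_ext fun s => Finsupp.ext fun u => ?_
  rw [LinearMap.add_apply, LinearMap.smul_apply, Finsupp.add_apply, Finsupp.smul_apply, d, lee,
    ofCoeff_chain_apply, ofCoeff_chain_apply, ofCoeff_chain_apply, smul_eq_mul]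
  simp only [edgeCoeff]
  rw [Finset.mul_sum, ← Finset.sum_add_distrib]
  refine Finset.sum_congr rfl fun c _ => ?_
  simp only [surgeryCoeff, deformedTable]
  split_ifs <;> ring

theorem d_d (hS : S.Surgical) (z : S.Chain) : S.d (S.d z) = 0 := by
  have := LinearMap.congr_fun (ofCoeff_edgeCoeff_sq hS 0) z
  simpa [ofCoeff_deformed] using this

/-- The square of `d + tΦ` is `d² + t(dΦ + Φd) + t²Φ²`. The difference of its values at `t = 1` and
`t = -1` is twice the middle coefficient. -/
theorem d_lee (hS : S.Surgical) (z : S.Chain) : S.d (S.lee z) = -S.lee (S.d z) := by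
  have h1 := LinearMap.congr_fun (ofCoeff_edgeCoeff_sq hS 1) z
  have h2 := LinearMap.congr_fun (ofCoeff_edgeCoeff_sq hS (-1)) z
  simp only [ofCoeff_deformed, LinearMap.comp_apply, LinearMap.add_apply, LinearMap.smul_apply,
    map_add, map_smul, LinearMap.zero_apply] at h1 h2
  have h3 : (2 : ℚ) • (S.d (S.lee z) + S.lee (S.d z)) = 0 := by
    have h := congrArg₂ (· - ·) h1 h2
    simp only [sub_zero] at h
    rw [← h]
    module
  exact eq_neg_of_add_eq_zero_left ((smul_eq_zero.1 h3).resolve_left two_ne_zero)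

theorem descends_lee (hS : S.Surgical) : Descends S.lee where
  cycle z hz := by rw [d_lee hS, hz, map_zero, neg_zero]
  boundary x := ⟨-S.lee x, by rw [map_neg, d_lee hS, neg_neg]⟩

end Pattern

/-! ### Planarity: loops of a smoothed diagram as cycles of a permutation. -/

theorem Surgery.swap {P : Type} {A : Finset P} {R R' : P → P → Prop} {x y : P}
    (hR : Equivalence R) (hR' : Equivalence R') (h : Surgery A R R' x y) : Surgery A R R' y x := by
  rcases h with ⟨h1, h2⟩ | ⟨h1, h2⟩
  · exact Or.inl ⟨fun h => h1 (hR.symm h), fun p hp q hq => by rw [h2 p hp q hq]; unfold Join; tauto⟩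
  · exact Or.inr ⟨fun h => h1 (hR'.symm h), fun p hp q hq => by rw [h2 p hp q hq]; unfold Join; tauto⟩

/-- Slides the base points along the loops, so as to pass from one diagonal of a crossing to the
other: `x'` is joined to `x` by one smoothing and to `y` by the other. -/
theorem Surgery.congr {P : Type} {A : Finset P} {R R' : P → P → Prop} {x y x' y' : P}
    (hR : Equivalence R) (hR' : Equivalence R') (h : Surgery A R R' x y)
    (h1 : R x x') (h2 : R y y') (h3 : R' x y') (h4 : R' y x') : Surgery A R R' x' y' := by
  have := @hR.symm; have := @hR'.symm; have := @hR.trans; have := @hR'.trans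
  rcases h with ⟨k1, k2⟩ | ⟨k1, k2⟩
  · exact Or.inl ⟨by grind, fun p hp q hq => by rw [k2 p hp q hq]; unfold Join; grind⟩
  · exact Or.inr ⟨by grind, fun p hp q hq => by rw [k2 p hp q hq]; unfold Join; grind⟩

theorem eqvGen_le {P : Type} {r R : P → P → Prop} (hR : Equivalence R) (h : ∀ p q, r p q → R p q)
    {p q : P} (hpq : Relation.EqvGen r p q) : R p q := by
  induction hpq with
  | rel p q hpq => exact h p q hpq
  | refl p => exact hR.refl p
  | symm p q _ ih => exact hR.symm ih
  | trans p q r _ _ ih ih' => exact hR.trans ih ih'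

/-- A slice of a diagram after smoothing: `hook i` is a crossing which is smoothed by
a cap and a cup. -/
inductive Smoothed : Type
  | straight
  | cup (i : ℕ)
  | cap (i : ℕ)
  | hook (i : ℕ)

namespace Smoothed

/-- The slice fits between levels with `l` and `u` strands. -/
def Fits : Smoothed → ℕ → ℕ → Prop
  | straight, l, u => u = l
  | cup a, l, u => u = l + 2 ∧ a ≤ l
  | cap a, l, u => l = u + 2 ∧ a ≤ u
  | hook a, l, u => u = l ∧ a + 2 ≤ l

/-- The strand ends joined in a smoothed slice between the levels `k` and `k + 1`. -/
def Join (k : ℕ) : Smoothed → ℕ × ℕ → ℕ × ℕ → Prop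
  | straight, p, q => ∃ j, p = (k, j) ∧ q = (k + 1, j)
  | cup i, p, q => (∃ j < i, p = (k, j) ∧ q = (k + 1, j)) ∨
      (∃ j ≥ i, p = (k, j) ∧ q = (k + 1, j + 2)) ∨ (p = (k + 1, i) ∧ q = (k + 1, i + 1))
  | cap i, p, q => (∃ j < i, p = (k, j) ∧ q = (k + 1, j)) ∨
      (∃ j ≥ i, p = (k, j + 2) ∧ q = (k + 1, j)) ∨ (p = (k, i) ∧ q = (k, i + 1))
  | hook i, p, q => (∃ j, j ≠ i ∧ j ≠ i + 1 ∧ p = (k, j) ∧ q = (k + 1, j)) ∨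
      (p = (k, i) ∧ q = (k, i + 1)) ∨ (p = (k + 1, i) ∧ q = (k + 1, i + 1))

/-- The other end of the arc which leaves the lower level at strand `i`. -/
def up (k i : ℕ) : Smoothed → ℕ × ℕ
  | straight => (k + 1, i)
  | cup a => (k + 1, if i < a then i else i + 2)
  | cap a => if i < a then (k + 1, i) else if i = a then (k, a + 1) else
      if i = a + 1 then (k, a) else (k + 1, i - 2)
  | hook a => if i = a then (k, a + 1) else if i = a + 1 then (k, a) else (k + 1, i)

/-- The other end of the arc which leaves the upper level at strand `i`. -/
def down (k i : ℕ) : Smoothed → ℕ × ℕ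
  | straight => (k, i)
  | cap a => (k, if i < a then i else i + 2)
  | cup a => if i < a then (k, i) else if i = a then (k + 1, a + 1) else
      if i = a + 1 then (k + 1, a) else (k, i - 2)
  | hook a => if i = a then (k + 1, a + 1) else if i = a + 1 then (k + 1, a) else (k, i)

/-- Arcs that run through a slice are shifted by `0` or `±2` strands, and arcs that turn back join
neighbours. So passing keeps the parity of the strand and turning changes it, which makes the
alternating orientation consistent. -/
theorem up_spec {s : Smoothed} {l u : ℕ} (hs : s.Fits l u) (k : ℕ) {i : ℕ} (hi : i < l) :
    (∃ j < u, j % 2 = i % 2 ∧ s.up k i = (k + 1, j) ∧ s.down k j = (k, i) ∧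
      s.Join k (k, i) (k + 1, j)) ∨
    (∃ j < l, j % 2 ≠ i % 2 ∧ s.up k i = (k, j) ∧ s.up k j = (k, i) ∧
      (s.Join k (k, i) (k, j) ∨ s.Join k (k, j) (k, i))) := by
  cases s with
  | straight => exact Or.inl ⟨i, by simp_all [Fits], rfl, rfl, rfl, i, rfl, rfl⟩
  | cup a =>
    obtain ⟨h1, h2⟩ := hs
    refine Or.inl ⟨if i < a then i else i + 2, ?_⟩
    by_cases h : i < a
    · simp only [h, if_true]
      refine ⟨by omega, trivial, by simp [up, h], by simp [down, h], Or.inl ⟨i, h, rfl, rfl⟩⟩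
    · simp only [h, if_false]
      refine ⟨by omega, by omega, by simp [up, h], ?_, Or.inr (Or.inl ⟨i, by omega, rfl, rfl⟩)⟩
      simp [down, show ¬ i + 2 < a by omega, show ¬ i + 2 = a by omega, show ¬ i + 1 = a by omega]
  | cap a =>
    obtain ⟨h1, h2⟩ := hs
    by_cases h : i < a
    · exact Or.inl ⟨i, by omega, rfl, by simp [up, h], by simp [down, h],
        Or.inl ⟨i, h, rfl, rfl⟩⟩
    by_cases h3 : i = a
    · subst h3
      exact Or.inr ⟨i + 1, by omega, by omega, by simp [up], by simp [up],
        Or.inl (Or.inr (Or.inr ⟨rfl, rfl⟩))⟩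
    by_cases h4 : i = a + 1
    · subst h4
      exact Or.inr ⟨a, by omega, by omega, by simp [up], by simp [up],
        Or.inr (Or.inr (Or.inr ⟨rfl, rfl⟩))⟩
    refine Or.inl ⟨i - 2, by omega, by omega, by simp [up, *], ?_,
      Or.inr (Or.inl ⟨i - 2, by omega, ?_, rfl⟩)⟩
    · simp [down, show ¬ i - 2 < a by omega]; omega
    · simp; omega
  | hook a =>
    obtain ⟨h1, h2⟩ := hs
    by_cases h3 : i = a
    · subst h3
      exact Or.inr ⟨i + 1, by omega, by omega, by simp [up], by simp [up],
        Or.inl (Or.inr (Or.inl ⟨rfl, rfl⟩))⟩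
    by_cases h4 : i = a + 1
    · subst h4
      exact Or.inr ⟨a, by omega, by omega, by simp [up], by simp [up],
        Or.inr (Or.inr (Or.inl ⟨rfl, rfl⟩))⟩
    exact Or.inl ⟨i, by omega, by omega, by simp [up, *], by simp [down, *],
      Or.inl ⟨i, h3, h4, rfl, rfl⟩⟩

theorem down_spec {s : Smoothed} {l u : ℕ} (hs : s.Fits l u) (k : ℕ) {i : ℕ} (hi : i < u) :
    (∃ j < l, j % 2 = i % 2 ∧ s.down k i = (k, j) ∧ s.up k j = (k + 1, i) ∧
      s.Join k (k, j) (k + 1, i)) ∨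
    (∃ j < u, j % 2 ≠ i % 2 ∧ s.down k i = (k + 1, j) ∧ s.down k j = (k + 1, i) ∧
      (s.Join k (k + 1, i) (k + 1, j) ∨ s.Join k (k + 1, j) (k + 1, i))) := by
  cases s with
  | straight => exact Or.inl ⟨i, by simp_all [Fits], rfl, rfl, rfl, i, rfl, rfl⟩
  | cap a =>
    obtain ⟨h1, h2⟩ := hs
    refine Or.inl ⟨if i < a then i else i + 2, ?_⟩
    by_cases h : i < a
    · simp only [h, if_true]
      refine ⟨by omega, trivial, by simp [down, h], by simp [up, h], Or.inl ⟨i, h, rfl, rfl⟩⟩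
    · simp only [h, if_false]
      refine ⟨by omega, by omega, by simp [down, h], ?_, Or.inr (Or.inl ⟨i, by omega, rfl, rfl⟩)⟩
      simp [up, show ¬ i + 2 < a by omega, show ¬ i + 2 = a by omega, show ¬ i + 1 = a by omega]
  | cup a =>
    obtain ⟨h1, h2⟩ := hs
    by_cases h : i < a
    · exact Or.inl ⟨i, by omega, rfl, by simp [down, h], by simp [up, h],
        Or.inl ⟨i, h, rfl, rfl⟩⟩
    by_cases h3 : i = a
    · subst h3
      exact Or.inr ⟨i + 1, by omega, by omega, by simp [down], by simp [down],
        Or.inl (Or.inr (Or.inr ⟨rfl, rfl⟩))⟩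
    by_cases h4 : i = a + 1
    · subst h4
      exact Or.inr ⟨a, by omega, by omega, by simp [down], by simp [down],
        Or.inr (Or.inr (Or.inr ⟨rfl, rfl⟩))⟩
    refine Or.inl ⟨i - 2, by omega, by omega, by simp [down, *], ?_,
      Or.inr (Or.inl ⟨i - 2, by omega, rfl, ?_⟩)⟩
    · simp [up, show ¬ i - 2 < a by omega]; omega
    · simp; omega
  | hook a =>
    obtain ⟨h1, h2⟩ := hs
    by_cases h3 : i = a
    · subst h3
      exact Or.inr ⟨i + 1, by omega, by omega, by simp [down], by simp [down],
        Or.inl (Or.inr (Or.inr ⟨rfl, rfl⟩))⟩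
    by_cases h4 : i = a + 1
    · subst h4
      exact Or.inr ⟨a, by omega, by omega, by simp [down], by simp [down],
        Or.inr (Or.inr (Or.inr ⟨rfl, rfl⟩))⟩
    exact Or.inl ⟨i, by omega, by omega, by simp [down, *], by simp [up, *],
      Or.inl ⟨i, h3, h4, rfl, rfl⟩⟩

theorem join_spec {s : Smoothed} {l u : ℕ} (hs : s.Fits l u) {k : ℕ} {p q : ℕ × ℕ}
    (h : s.Join k p q) :
    (∃ i j, p = (k, i) ∧ q = (k + 1, j) ∧ i % 2 = j % 2 ∧ s.up k i = q ∧ s.down k j = p ∧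
      (i < l ↔ j < u)) ∨
    (∃ i j, p = (k, i) ∧ q = (k, j) ∧ i % 2 ≠ j % 2 ∧ s.up k i = q ∧ s.up k j = p ∧
      i < l ∧ j < l) ∨
    (∃ i j, p = (k + 1, i) ∧ q = (k + 1, j) ∧ i % 2 ≠ j % 2 ∧ s.down k i = q ∧ s.down k j = p ∧
      i < u ∧ j < u) := by
  cases s with
  | straight =>
    obtain ⟨j, rfl, rfl⟩ := h
    exact Or.inl ⟨j, j, rfl, rfl, rfl, rfl, rfl, by rw [show u = l from hs]⟩
  | cup a =>
    obtain ⟨h1, h2⟩ := hs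
    rcases h with ⟨j, hj, rfl, rfl⟩ | ⟨j, hj, rfl, rfl⟩ | ⟨rfl, rfl⟩
    · exact Or.inl ⟨j, j, rfl, rfl, rfl, by simp [up, hj], by simp [down, hj], by omega⟩
    · refine Or.inl ⟨j, j + 2, rfl, rfl, by omega, ?_, ?_, by omega⟩
      · simp [up, show ¬ j < a by omega]
      · simp [down, show ¬ j + 2 < a by omega, show ¬ j + 2 = a by omega,
          show ¬ j + 1 = a by omega]
    · exact Or.inr (Or.inr ⟨a, a + 1, rfl, rfl, by omega, by simp [down], by simp [down],
        by omega, by omega⟩)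
  | cap a =>
    obtain ⟨h1, h2⟩ := hs
    rcases h with ⟨j, hj, rfl, rfl⟩ | ⟨j, hj, rfl, rfl⟩ | ⟨rfl, rfl⟩
    · exact Or.inl ⟨j, j, rfl, rfl, rfl, by simp [up, hj], by simp [down, hj], by omega⟩
    · refine Or.inl ⟨j + 2, j, rfl, rfl, by omega, ?_, ?_, by omega⟩
      · simp [up, show ¬ j + 2 < a by omega, show ¬ j + 2 = a by omega,
          show ¬ j + 1 = a by omega]
      · simp [down, show ¬ j < a by omega]
    · exact Or.inr (Or.inl ⟨a, a + 1, rfl, rfl, by omega, by simp [up], by simp [up],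
        by omega, by omega⟩)
  | hook a =>
    obtain ⟨h1, h2⟩ := hs
    rcases h with ⟨j, hj, hj', rfl, rfl⟩ | ⟨rfl, rfl⟩ | ⟨rfl, rfl⟩
    · exact Or.inl ⟨j, j, rfl, rfl, rfl, by simp [up, hj, hj'], by simp [down, hj, hj'], by omega⟩
    · exact Or.inr (Or.inl ⟨a, a + 1, rfl, rfl, by omega, by simp [up], by simp [up],
        by omega, by omega⟩)
    · exact Or.inr (Or.inr ⟨a, a + 1, rfl, rfl, by omega, by simp [down], by simp [down],
        by omega, by omega⟩)

/-- A closed stack of smoothed slices. -/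
structure Stack (len : ℕ) (width : ℕ → ℕ) (A : Finset (ℕ × ℕ)) (f : ℕ → Smoothed) : Prop where
  mem : ∀ k i, (k, i) ∈ A ↔ k ≤ len ∧ i < width k
  bot : width 0 = 0
  top : width len = 0
  fits : ∀ k < len, (f k).Fits (width k) (width (k + 1))

/-- Two points are the ends of an arc. -/
def Arc (len : ℕ) (f : ℕ → Smoothed) (p q : ℕ × ℕ) : Prop := ∃ k < len, (f k).Join k p q

/-- The loops are oriented so that strand `i` is directed upwards for even `i`, and downwards for
odd `i`.  This is the next point on the loop if `e = 0`, and the previous one if `e = 1`. -/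
def go (f : ℕ → Smoothed) (e : ℕ) (p : ℕ × ℕ) : ℕ × ℕ :=
  if p.2 % 2 = e then (f p.1).up p.1 p.2 else (f (p.1 - 1)).down (p.1 - 1) p.2

variable {len : ℕ} {width : ℕ → ℕ} {A : Finset (ℕ × ℕ)} {f : ℕ → Smoothed}

/-- An arc that turns back reverses both the vertical direction and the parity of the strand; one
that passes keeps both. Hence its two ends agree about its orientation, and the steps for `e` and
`e'` undo each other. -/
theorem Stack.go_spec (h : Stack len width A f) {e e' : ℕ} (he : e < 2) (he' : e + e' = 1)
    {p : ℕ × ℕ} (hp : p ∈ A) :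
    go f e p ∈ A ∧ go f e' (go f e p) = p ∧ (Arc len f p (go f e p) ∨ Arc len f (go f e p) p) := by
  obtain ⟨k, i⟩ := p
  obtain ⟨hk, hi⟩ := (h.mem k i).1 hp
  by_cases hie : i % 2 = e
  -- The top level has no strands, so there is a slice above.
  · have hk' : k < len := lt_of_le_of_ne hk fun e => by rw [e, h.top] at hi; omega
    have e1 : go f e (k, i) = (f k).up k i := if_pos hie
    rw [e1]
    rcases up_spec (h.fits k hk') k hi with ⟨j, hj, hj2, k1, k2, k3⟩ | ⟨j, hj, hj2, k1, k2, k3⟩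
    · rw [k1, h.mem]
      refine ⟨⟨hk', hj⟩, ?_, Or.inl ⟨k, hk', k3⟩⟩
      rw [go, if_neg (by simp only; omega)]
      exact k2
    · rw [k1, h.mem]
      refine ⟨⟨hk, hj⟩, ?_, k3.imp (fun k3 => ⟨k, hk', k3⟩) (fun k3 => ⟨k, hk', k3⟩)⟩
      rw [go, if_pos (by simp only; omega)]
      exact k2
  -- Level `0` has no strands, so the truncated subtraction in `go` is never applied to `0` here.
  · obtain ⟨k, rfl⟩ : ∃ m, k = m + 1 :=
      Nat.exists_eq_succ_of_ne_zero fun e => by rw [e, h.bot] at hi; omega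
    have e1 : go f e (k + 1, i) = (f k).down k i := if_neg hie
    rw [e1]
    rcases down_spec (h.fits k hk) k hi with ⟨j, hj, hj2, k1, k2, k3⟩ | ⟨j, hj, hj2, k1, k2, k3⟩
    · rw [k1, h.mem]
      refine ⟨⟨by omega, hj⟩, ?_, Or.inr ⟨k, hk, k3⟩⟩
      rw [go, if_pos (by simp only; omega)]
      exact k2
    · rw [k1, h.mem]
      refine ⟨⟨hk, hj⟩, ?_, k3.imp (fun k3 => ⟨k, hk, k3⟩) (fun k3 => ⟨k, hk, k3⟩)⟩
      rw [go, if_neg (by simp only; omega)]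
      exact k2

theorem Stack.arc_spec (h : Stack len width A f) {p q : ℕ × ℕ} (hpq : Arc len f p q) :
    (p ∈ A ↔ q ∈ A) ∧ (go f 0 p = q ∨ go f 0 q = p) := by
  obtain ⟨k, hk, hpq⟩ := hpq
  rcases join_spec (h.fits k hk) hpq with ⟨i, j, rfl, rfl, h1, h2, h3, h4⟩ |
    ⟨i, j, rfl, rfl, h1, h2, h3, h4, h5⟩ | ⟨i, j, rfl, rfl, h1, h2, h3, h4, h5⟩
  · refine ⟨by rw [h.mem, h.mem]; omega, ?_⟩
    rcases Nat.mod_two_eq_zero_or_one i with hi | hi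
    · exact Or.inl (by rw [go, if_pos hi]; exact h2)
    · exact Or.inr (by rw [go, if_neg (by simp only; omega)]; exact h3)
  · refine ⟨by rw [h.mem, h.mem]; omega, ?_⟩
    rcases Nat.mod_two_eq_zero_or_one i with hi | hi
    · exact Or.inl (by rw [go, if_pos hi]; exact h2)
    · exact Or.inr (by rw [go, if_pos (by simp only; omega)]; exact h3)
  · refine ⟨by rw [h.mem, h.mem]; omega, ?_⟩
    rcases Nat.mod_two_eq_zero_or_one i with hi | hi
    · exact Or.inr (by rw [go, if_neg (by simp only; omega)]; exact h3)
    · exact Or.inl (by rw [go, if_neg (by simp only; omega)]; exact h2)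

/-- The permutation which takes every point to the next one on its loop. -/
def Stack.next (h : Stack len width A f) : Equiv.Perm {p // p ∈ A} where
  toFun p := ⟨go f 0 p, (h.go_spec (e' := 1) (by omega) rfl p.2).1⟩
  invFun p := ⟨go f 1 p, (h.go_spec (e' := 0) (by omega) rfl p.2).1⟩
  left_inv p := Subtype.ext (h.go_spec (by omega) rfl p.2).2.1
  right_inv p := Subtype.ext (h.go_spec (by omega) rfl p.2).2.1

/-- Every arc is one step of `next`, in one of the two directions, and every step of `next` runs
along an arc. -/
theorem Stack.eqvGen_iff (h : Stack len width A f) (p q : {p // p ∈ A}) :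
    Relation.EqvGen (Arc len f) p q ↔ h.next.SameCycle p q := by
  constructor
  · have key : ∀ p q : ℕ × ℕ, Relation.EqvGen (Arc len f) p q → (p ∈ A ↔ q ∈ A) ∧
        ∀ (hp : p ∈ A) (hq : q ∈ A), h.next.SameCycle ⟨p, hp⟩ ⟨q, hq⟩ := by
      intro p q hpq
      induction hpq with
      | rel p q hpq =>
        refine ⟨(h.arc_spec hpq).1, fun hp hq => ?_⟩
        rcases (h.arc_spec hpq).2 with e | e
        · exact ⟨1, Subtype.ext e⟩
        · exact Equiv.Perm.SameCycle.symm ⟨1, Subtype.ext e⟩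
      | refl p => exact ⟨Iff.rfl, fun _ _ => Equiv.Perm.SameCycle.refl _ _⟩
      | symm p q _ ih => exact ⟨ih.1.symm, fun hp hq => (ih.2 hq hp).symm⟩
      | trans p q r _ _ ih ih' =>
        exact ⟨ih.1.trans ih'.1, fun hp hr => (ih.2 hp (ih.1.1 hp)).trans (ih'.2 (ih.1.1 hp) hr)⟩
    exact fun hpq => (key _ _ hpq).2 p.2 q.2
  · refine sameCycle_le (R := fun p q : {p // p ∈ A} => Relation.EqvGen (Arc len f) p q)
      ((Relation.EqvGen.is_equivalence _).comap _) fun p => ?_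
    rcases (h.go_spec (e := 0) (e' := 1) (by omega) rfl p.2).2.2 with k | k
    · exact Relation.EqvGen.rel _ _ k
    · exact Relation.EqvGen.symm _ _ (Relation.EqvGen.rel _ _ k)

/-- Replacing a trivial slice by a hook merges two loops or splits one. -/
theorem Stack.surgery {g : ℕ → Smoothed} (hf : Stack len width A f) (hg : Stack len width A g)
    {c a : ℕ} (hc : c < len) (hfc : f c = straight) (hgc : g c = hook a)
    (hfg : ∀ k, k ≠ c → f k = g k) :
    Surgery A (Relation.EqvGen (Arc len f)) (Relation.EqvGen (Arc len g)) (c, a) (c + 1, a + 1) ∧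
    Surgery A (Relation.EqvGen (Arc len f)) (Relation.EqvGen (Arc len g)) (c, a + 1) (c + 1, a) := by
  have hR := Relation.EqvGen.is_equivalence (Arc len f)
  have hR' := Relation.EqvGen.is_equivalence (Arc len g)
  have ha : a + 2 ≤ width c := by have := hg.fits c hc; rw [hgc] at this; exact this.2
  have hw : width (c + 1) = width c := by have := hf.fits c hc; rw [hfc] at this; exact this
  have m1 : (c, a) ∈ A := by rw [hf.mem]; omega
  have m2 : (c + 1, a + 1) ∈ A := by rw [hf.mem]; omega
  have m3 : (c, a + 1) ∈ A := by rw [hf.mem]; omega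
  have m4 : (c + 1, a) ∈ A := by rw [hf.mem]; omega
  have r1 : Relation.EqvGen (Arc len f) (c, a) (c + 1, a) :=
    .rel _ _ ⟨c, hc, by rw [hfc]; exact ⟨a, rfl, rfl⟩⟩
  have r2 : Relation.EqvGen (Arc len f) (c, a + 1) (c + 1, a + 1) :=
    .rel _ _ ⟨c, hc, by rw [hfc]; exact ⟨a + 1, rfl, rfl⟩⟩
  have r3 : Relation.EqvGen (Arc len g) (c, a) (c, a + 1) :=
    .rel _ _ ⟨c, hc, by rw [hgc]; exact Or.inr (Or.inl ⟨rfl, rfl⟩)⟩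
  have r4 : Relation.EqvGen (Arc len g) (c + 1, a) (c + 1, a + 1) :=
    .rel _ _ ⟨c, hc, by rw [hgc]; exact Or.inr (Or.inr ⟨rfl, rfl⟩)⟩
  -- The two diagonals are exchanged by sliding the base points along the arcs of slice `c`. Which
  -- of them is obtained directly depends on the parity of `a`.
  suffices h : Surgery A (Relation.EqvGen (Arc len f)) (Relation.EqvGen (Arc len g))
      (c, a) (c + 1, a + 1) ∨ Surgery A (Relation.EqvGen (Arc len f))
        (Relation.EqvGen (Arc len g)) (c, a + 1) (c + 1, a) by
    rcases h with h | h
    · exact ⟨h, (h.congr hR hR' r1 (hR.symm r2) r3 (hR'.symm r4)).swap hR hR'⟩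
    · exact ⟨(h.congr hR hR' r2 (hR.symm r1) (hR'.symm r3) r4).swap hR hR', h⟩
  have key : ∀ x y : {p // p ∈ A}, x ≠ y → hg.next x = hf.next y → hg.next y = hf.next x →
      (∀ p, p ≠ x → p ≠ y → hg.next p = hf.next p) →
      Surgery A (Relation.EqvGen (Arc len f)) (Relation.EqvGen (Arc len g)) x y := by
    intro x y hxy h1 h2 h3
    have hmul : hg.next = hf.next * Equiv.swap x y := by
      ext1 p
      rw [Equiv.Perm.mul_apply]
      by_cases hx : p = x
      · rw [hx, Equiv.swap_apply_left, h1]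
      by_cases hy : p = y
      · rw [hy, Equiv.swap_apply_right, h2]
      rw [Equiv.swap_apply_of_ne_of_ne hx hy, h3 p hx hy]
    have h := sameCycle_surgery hf.next hxy
    rw [← hmul] at h
    refine h.imp ?_ ?_ <;> rintro ⟨k1, k2⟩ <;>
      simp only [LeeLift.Join, ← Stack.eqvGen_iff] at k1 k2 ⊢ <;>
      exact ⟨k1, fun p hp q hq => k2 ⟨p, hp⟩ ⟨q, hq⟩⟩
  -- The successor changes only where the outgoing arc is one of the two strands in slice `c`. These
  -- points are on an even strand at level `c` or on an odd strand at level `c + 1`.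
  have hne : ∀ p ∈ A, (p.2 % 2 = 0 → p ≠ (c, a) ∧ p ≠ (c, a + 1)) →
      (p.2 % 2 ≠ 0 → p ≠ (c + 1, a) ∧ p ≠ (c + 1, a + 1)) → go g 0 p = go f 0 p := by
    rintro ⟨k, i⟩ hp n1 n2
    have hk0 : k ≠ 0 := by
      rintro rfl
      rw [hf.mem, hf.bot] at hp
      omega
    unfold go
    simp only [ne_eq, Prod.mk.injEq, not_and] at n1 n2 ⊢
    split_ifs with he
    · by_cases hk : k = c
      · subst hk
        rw [hfc, hgc]
        simp [up, (n1 he).1, (n1 he).2]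
      · rw [hfg k hk]
    · by_cases hk : k - 1 = c
      · rw [hk, hfc, hgc]
        have hk' : k = c + 1 := by omega
        simp [down, (n2 he).1 hk', (n2 he).2 hk']
      · rw [hfg _ hk]
  -- The two points whose successors are exchanged are `(c, a)`, `(c + 1, a + 1)` for even `a`, and
  -- `(c, a + 1)`, `(c + 1, a)` for odd `a`.
  rcases Nat.mod_two_eq_zero_or_one a with ha2 | ha2
  · refine Or.inl (key ⟨_, m1⟩ ⟨_, m2⟩ (by simp) (Subtype.ext ?_) (Subtype.ext ?_) ?_)
    · simp [next, go, ha2, show (a + 1) % 2 = 1 by omega, hgc, hfc, up, down]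
    · simp [next, go, ha2, show (a + 1) % 2 = 1 by omega, hgc, hfc, up, down]
    · rintro ⟨p, hp⟩ n1 n2
      refine Subtype.ext (hne p hp (fun h => ⟨fun e => n1 (Subtype.ext e), ?_⟩)
        (fun h => ⟨?_, fun e => n2 (Subtype.ext e)⟩))
      all_goals
        rintro rfl
        simp only at h
        omega
  · refine Or.inr (key ⟨_, m3⟩ ⟨_, m4⟩ (by simp) (Subtype.ext ?_) (Subtype.ext ?_) ?_)
    · simp [next, go, ha2, show (a + 1) % 2 = 0 by omega, hgc, hfc, up, down]
    · simp [next, go, ha2, show (a + 1) % 2 = 0 by omega, hgc, hfc, up, down]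
    · rintro ⟨p, hp⟩ n1 n2
      refine Subtype.ext (hne p hp (fun h => ⟨?_, fun e => n1 (Subtype.ext e)⟩)
        (fun h => ⟨fun e => n2 (Subtype.ext e), ?_⟩))
      all_goals
        rintro rfl
        simp only at h
        omega

end Smoothed

/-! ### Link diagrams give surgical patterns. -/

/-- A slice after smoothing; `one` says that a crossing is `1`-smoothed. -/
def Slice.smooth (one : Prop) : Slice → Smoothed
  | straight => .straight
  | cup i => .cup i
  | cap i => .cap i
  | cross i b => if one ↔ b = true then .hook i else .straight

namespace Diagram

/-- The smoothed slices of the state in which the crossings in `o` are `1`-smoothed. -/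
def smoothed (D : Diagram) (o : Finset ℕ) (k : ℕ) : Smoothed := (D.slice k).smooth (k ∈ o)

/-- A smoothed crossing is either two vertical arcs or a cap below a cup, depending on its type and
its smoothing. Up to direction, both sides are generated by the same arcs. -/
theorem sameLoop_iff (D : Diagram) (o : Finset ℕ) (p q : ℕ × ℕ) :
    D.pattern.SameLoop o p q ↔ Relation.EqvGen (Smoothed.Arc D.len (D.smoothed o)) p q := by
  have hcr : ∀ {k i b}, k < D.len → D.slice k = .cross i b → k ∈ D.pattern.crossings := by
    intro k i b hk h
    exact Finset.mem_filter.2 ⟨Finset.mem_range.2 hk, by rw [h]; trivial⟩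
  constructor
  · have hE := Relation.EqvGen.is_equivalence (Smoothed.Arc D.len (D.smoothed o))
    refine eqvGen_le hE fun p q h => ?_
    rcases h with ⟨k, hk, h⟩ | ⟨c, hc, h⟩
    · refine .rel _ _ ⟨k, hk, ?_⟩
      rw [smoothed]
      cases hs : D.slice k with
      | straight => rw [hs] at h; exact h
      | cup i => rw [hs] at h; exact h
      | cap i => rw [hs] at h; exact h
      | cross i b =>
        rw [hs] at h
        obtain ⟨j, h1, h2, h3, h4⟩ := h
        simp only [Slice.smooth]
        split_ifs
        · exact Or.inl ⟨j, h1, h2, h3, h4⟩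
        · exact ⟨j, h3, h4⟩
    · obtain ⟨hc, hcr⟩ := Finset.mem_filter.1 hc
      have hc := Finset.mem_range.1 hc
      have harc : ∀ p q, (D.smoothed o c).Join c p q →
          Relation.EqvGen (Smoothed.Arc D.len (D.smoothed o)) p q := fun p q h => .rel _ _ ⟨c, hc, h⟩
      cases hs : D.slice c with
      | straight => rw [hs] at hcr; exact hcr.elim
      | cup i => rw [hs] at hcr; exact hcr.elim
      | cap i => rw [hs] at hcr; exact hcr.elim
      | cross i b =>
        simp only [smoothed, hs, Slice.smooth] at harc
        simp only [pattern, hs] at h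
        cases b <;> simp only [Slice.corner, Bool.false_eq_true, iff_false, iff_true] at h harc <;>
          by_cases hco : c ∈ o <;> simp only [hco, not_true, not_false_eq_true, if_true, if_false] at h harc <;>
          rcases h with ⟨rfl, rfl⟩ | ⟨rfl, rfl⟩
        · exact harc _ _ ⟨i, rfl, rfl⟩
        · exact hE.symm (harc _ _ ⟨i + 1, rfl, rfl⟩)
        · exact hE.symm (harc _ _ (Or.inr (Or.inl ⟨rfl, rfl⟩)))
        · exact harc _ _ (Or.inr (Or.inr ⟨rfl, rfl⟩))
        · exact harc _ _ (Or.inr (Or.inr ⟨rfl, rfl⟩))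
        · exact hE.symm (harc _ _ (Or.inr (Or.inl ⟨rfl, rfl⟩)))
        · exact harc _ _ ⟨i, rfl, rfl⟩
        · exact hE.symm (harc _ _ ⟨i + 1, rfl, rfl⟩)
  · have hE := D.pattern.sameLoop_equivalence o
    refine eqvGen_le hE fun p q h => ?_
    obtain ⟨k, hk, h⟩ := h
    have hjoin : ∀ p q, (D.slice k).Join k p q → D.pattern.SameLoop o p q := fun p q h =>
      .rel _ _ (Or.inl ⟨k, hk, h⟩)
    rw [smoothed] at h
    cases hs : D.slice k with
    | straight => rw [hs] at h hjoin; exact hjoin _ _ h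
    | cup i => rw [hs] at h hjoin; exact hjoin _ _ h
    | cap i => rw [hs] at h hjoin; exact hjoin _ _ h
    | cross i b =>
      rw [hs] at hjoin
      have hlink : ∀ p q, (if k ∈ o then
          (p = D.pattern.corner k 1 ∧ q = D.pattern.corner k 2) ∨
            (p = D.pattern.corner k 3 ∧ q = D.pattern.corner k 0)
        else (p = D.pattern.corner k 0 ∧ q = D.pattern.corner k 1) ∨
            (p = D.pattern.corner k 2 ∧ q = D.pattern.corner k 3)) → D.pattern.SameLoop o p q :=
        fun p q h => .rel _ _ (Or.inr ⟨k, hcr hk hs, h⟩)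
      simp only [pattern, hs] at hlink
      simp only [hs, Slice.smooth] at h
      have hvert : ∀ j, j ≠ i → j ≠ i + 1 → D.pattern.SameLoop o (k, j) (k + 1, j) :=
        fun j h1 h2 => hjoin _ _ ⟨j, h1, h2, rfl, rfl⟩
      cases b <;> simp only [Slice.corner, Bool.false_eq_true, iff_false, iff_true] at h hlink <;>
        by_cases hco : k ∈ o <;> simp only [hco, not_true, not_false_eq_true, if_true, if_false] at h hlink
      · obtain ⟨j, rfl, rfl⟩ := h
        by_cases h1 : j = i
        · subst h1; exact hlink _ _ (Or.inl ⟨rfl, rfl⟩)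
        by_cases h2 : j = i + 1
        · subst h2; exact hE.symm (hlink _ _ (Or.inr ⟨rfl, rfl⟩))
        exact hvert j h1 h2
      · rcases h with ⟨j, h1, h2, rfl, rfl⟩ | ⟨rfl, rfl⟩ | ⟨rfl, rfl⟩
        · exact hvert j h1 h2
        · exact hE.symm (hlink _ _ (Or.inl ⟨rfl, rfl⟩))
        · exact hlink _ _ (Or.inr ⟨rfl, rfl⟩)
      · rcases h with ⟨j, h1, h2, rfl, rfl⟩ | ⟨rfl, rfl⟩ | ⟨rfl, rfl⟩
        · exact hvert j h1 h2
        · exact hE.symm (hlink _ _ (Or.inr ⟨rfl, rfl⟩))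
        · exact hlink _ _ (Or.inl ⟨rfl, rfl⟩)
      · obtain ⟨j, rfl, rfl⟩ := h
        by_cases h1 : j = i
        · subst h1; exact hlink _ _ (Or.inl ⟨rfl, rfl⟩)
        by_cases h2 : j = i + 1
        · subst h2; exact hE.symm (hlink _ _ (Or.inr ⟨rfl, rfl⟩))
        exact hvert j h1 h2

theorem mem_points (D : Diagram) (k i : ℕ) :
    (k, i) ∈ D.pattern.points ↔ k ≤ D.len ∧ i < (D.level k).length := by
  simp only [pattern, Finset.mem_biUnion, Finset.mem_image, Finset.mem_range, Prod.mk.injEq]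
  constructor
  · rintro ⟨k', h1, i', h2, rfl, rfl⟩
    exact ⟨by omega, h2⟩
  · rintro ⟨h1, h2⟩
    exact ⟨k, by omega, i, h2, rfl, rfl⟩

theorem stack (D : Diagram) (o : Finset ℕ) :
    Smoothed.Stack D.len (fun k => (D.level k).length) D.pattern.points (D.smoothed o) where
  mem := D.mem_points
  bot := by simp [D.level_zero]
  top := by simp [D.level_len]
  fits k hk := by
    have h := D.fits k hk
    unfold smoothed
    cases hs : D.slice k with
    | straight => rw [hs] at h; simp [Slice.smooth, Smoothed.Fits, show _ = _ from h]
    | cup i =>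
      rw [hs] at h
      obtain ⟨A, B, b, h1, h2, h3⟩ := h
      simp [Slice.smooth, Smoothed.Fits, h2, h3]; omega
    | cap i =>
      rw [hs] at h
      obtain ⟨A, B, b, h1, h2, h3⟩ := h
      simp [Slice.smooth, Smoothed.Fits, h2, h3]; omega
    | cross i b =>
      rw [hs] at h
      obtain ⟨A, B, b, b', h1, h2, h3⟩ := h
      simp only [Slice.smooth]
      split_ifs
      · simp [Smoothed.Fits, h2, h3]; omega
      · simp [Smoothed.Fits, h2, h3]

theorem exists_cross (D : Diagram) {c : ℕ} (hc : c ∈ D.pattern.crossings) :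
    c < D.len ∧ ∃ i b, D.slice c = .cross i b := by
  obtain ⟨h1, h2⟩ := Finset.mem_filter.1 hc
  refine ⟨Finset.mem_range.1 h1, ?_⟩
  cases hs : D.slice c with
  | cross i b => exact ⟨i, b, rfl⟩
  | _ => rw [hs] at h2; exact h2.elim

theorem corner_of_cross (D : Diagram) {c i : ℕ} {b : Bool} (hs : D.slice c = .cross i b) :
    D.pattern.corner c = (Slice.cross i b).corner c := by
  simp only [pattern, hs]

/-- The cube of resolutions of a diagram consists of planar surgeries. -/
theorem surgical (D : Diagram) : D.pattern.Surgical where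
  link_mem o p q h := by
    have key : ∀ p q, Relation.EqvGen (Smoothed.Arc D.len (D.smoothed o)) p q →
        (p ∈ D.pattern.points ↔ q ∈ D.pattern.points) :=
      fun p q => eqvGen_le (R := fun p q => p ∈ D.pattern.points ↔ q ∈ D.pattern.points)
        ⟨fun _ => Iff.rfl, Iff.symm, Iff.trans⟩ fun p q h => ((D.stack o).arc_spec h).1
    exact key p q ((D.sameLoop_iff o p q).1 (.rel _ _ h))
  corner_mem c hc j := by
    obtain ⟨hc, i, b, hs⟩ := D.exists_cross hc
    have h := D.fits c hc
    rw [hs] at h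
    obtain ⟨A, B, b1, b2, h1, h2, h3⟩ := h
    rw [D.corner_of_cross hs]
    cases b <;> fin_cases j <;> simp [Slice.corner, D.mem_points, h2, h3] <;> omega
  surgery o _ c hc hco := by
    obtain ⟨hc, i, b, hs⟩ := D.exists_cross hc
    have hR : ∀ o, D.pattern.SameLoop o = Relation.EqvGen (Smoothed.Arc D.len (D.smoothed o)) :=
      fun o => funext fun p => funext fun q => propext (D.sameLoop_iff o p q)
    have hne : ∀ k, k ≠ c → D.smoothed o k = D.smoothed (insert c o) k := by
      intro k hk
      simp [smoothed, hk]
    rw [hR, hR, D.corner_of_cross hs]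
    cases b
    -- For this type of crossing the `0`-smoothing is the hook, so the two stacks change roles, and
    -- the corners `0`, `2` lie on the other diagonal.
    · have h := (Smoothed.Stack.surgery (D.stack (insert c o)) (D.stack o) (a := i) hc
        (by simp [smoothed, hs, Slice.smooth]) (by simp [smoothed, hs, Slice.smooth, hco])
        fun k hk => (hne k hk).symm).2
      exact h.symm
    · exact (Smoothed.Stack.surgery (D.stack o) (D.stack (insert c o)) (a := i) hc
        (by simp [smoothed, hs, Slice.smooth, hco]) (by simp [smoothed, hs, Slice.smooth]) hne).1

end Diagram

/-! ### Forgetting crossings with a prescribed smoothing. -/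

namespace Pattern
variable {P : Type}

theorem map_ofCoeff_chain {M : Type*} [AddCommGroup M] [Module ℚ M] {S : Pattern P}
    {Q : Type} {T : Pattern Q} (a : S.EnhancedState → T.EnhancedState → ℚ)
    (f : T.Chain →ₗ[ℚ] M) (s : S.EnhancedState) :
    f (ofCoeff a s.chain) = ∑ t, a s t • f t.chain := by
  simp only [ofCoeff, EnhancedState.chain, Finsupp.linearCombination_single, one_smul, map_sum]
  refine Finset.sum_congr rfl fun t _ => ?_
  rw [← map_smul, Finsupp.smul_single, smul_eq_mul, mul_one]

theorem EnhancedState.chain_apply {S : Pattern P} (s t : S.EnhancedState) :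
    s.chain t = if s = t then 1 else 0 := Finsupp.single_apply

theorem edgeCoeff_eq_zero {S : Pattern P} {E : EdgeTable} {s t : S.EnhancedState}
    (h : ∀ b ∈ S.crossings, b ∉ s.ones → t.ones ≠ insert b s.ones) : edgeCoeff E s t = 0 := by
  refine Finset.sum_eq_zero fun b hb => if_neg fun h' => ?_
  rw [Finset.mem_sdiff] at hb
  exact h b hb.1 hb.2 h'.1

theorem edgeCoeff_eq {S : Pattern P} {E : EdgeTable} {s t : S.EnhancedState} {b : ℕ}
    (hb : b ∈ S.crossings) (hbs : b ∉ s.ones) (ht : t.ones = insert b s.ones) :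
    edgeCoeff E s t = (-1) ^ (s.ones.filter (· < b)).card * localCoeff E b s t := by
  rw [edgeCoeff, Finset.sum_eq_single b]
  · unfold localCoeff
    simp only [ht, true_and]
    split_ifs <;> simp
  · intro b' hb' hne
    rw [Finset.mem_sdiff] at hb'
    refine if_neg fun h => ?_
    have : b' ∈ insert b s.ones := by rw [← ht, h.1]; exact Finset.mem_insert_self _ _
    rcases Finset.mem_insert.1 this with h | h
    · exact hne h
    · exact hb'.2 h
  · intro h
    exact absurd (Finset.mem_sdiff.2 ⟨hb, hbs⟩) h

/-- The pattern `S'` is `S` with the crossings in `K` smoothed: those in `K₁` are `1`-smoothed and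
the others are `0`-smoothed. -/
structure Removal (S S' : Pattern P) (K K₁ : Finset ℕ) : Prop where
  points : S'.points = S.points
  crossings : S'.crossings = S.crossings \ K
  subset : K ⊆ S.crossings
  subset₁ : K₁ ⊆ K
  corner : ∀ b ∈ S'.crossings, S'.corner b = S.corner b
  sameLoop : ∀ o ⊆ S'.crossings, ∀ p q, S'.SameLoop o p q ↔ S.SameLoop (o ∪ K₁) p q

namespace Removal
variable {S S' : Pattern P} {K K₁ : Finset ℕ} (h : Removal S S' K K₁)

/-- The enhanced states of `S'` as enhanced states of `S`. -/
def lower (t : S'.EnhancedState) : S.EnhancedState where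
  ones := t.ones ∪ K₁
  ones_subset := Finset.union_subset
    (t.ones_subset.trans (h.crossings ▸ Finset.sdiff_subset)) (h.subset₁.trans h.subset)
  plus := t.plus
  plus_subset := h.points ▸ t.plus_subset
  plus_iff p q hpq := t.plus_iff p q ((h.sameLoop _ t.ones_subset p q).2 hpq)

@[simp] theorem lower_ones (t : S'.EnhancedState) : (h.lower t).ones = t.ones ∪ K₁ := rfl

@[simp] theorem mark_lower (t : S'.EnhancedState) (p : P) : (h.lower t).mark p = t.mark p := rfl

theorem notMem_of_mem (h : Removal S S' K K₁) {t : S'.EnhancedState} {b : ℕ} (hb : b ∈ t.ones) : b ∉ K := by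
  have := t.ones_subset hb
  rw [h.crossings] at this
  exact (Finset.mem_sdiff.1 this).2

theorem lower_ones_sdiff (t : S'.EnhancedState) : (h.lower t).ones \ K = t.ones := by
  ext b
  rw [lower_ones, Finset.mem_sdiff, Finset.mem_union]
  constructor
  · rintro ⟨hb | hb, hbK⟩
    · exact hb
    · exact absurd (h.subset₁ hb) hbK
  · exact fun hb => ⟨Or.inl hb, h.notMem_of_mem hb⟩

theorem mem_lower_iff (t : S'.EnhancedState) {b : ℕ} (hb : b ∈ K) :
    b ∈ (h.lower t).ones ↔ b ∈ K₁ := by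
  rw [lower_ones, Finset.mem_union]
  exact ⟨fun h' => h'.resolve_left fun h' => h.notMem_of_mem h' hb, Or.inr⟩

theorem lower_injective : Function.Injective h.lower := by
  intro t u htu
  refine EnhancedState.ext ?_ (congrArg EnhancedState.plus htu :)
  rw [← h.lower_ones_sdiff t, htu, h.lower_ones_sdiff]

theorem eq_lower {s : S.EnhancedState} {t : S'.EnhancedState} (h1 : t.ones = s.ones \ K)
    (h2 : ∀ b ∈ K, b ∈ s.ones ↔ b ∈ K₁) (h3 : ∀ p ∈ S.points, s.mark p = t.mark p) :
    s = h.lower t := by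
  refine EnhancedState.ext_mark ?_ h3
  ext b
  rw [lower_ones, h1, Finset.mem_union, Finset.mem_sdiff]
  by_cases hb : b ∈ K
  · simp [hb, h2 b hb]
  · simp [hb, show b ∉ K₁ from fun hb1 => hb (h.subset₁ hb1)]

theorem exists_lower {s : S.EnhancedState} (h2 : ∀ b ∈ K, b ∈ s.ones ↔ b ∈ K₁) :
    ∃ t, s = h.lower t := by
  have ho : s.ones \ K ⊆ S'.crossings := by
    rw [h.crossings]; exact Finset.sdiff_subset_sdiff s.ones_subset subset_rfl
  have hu : s.ones \ K ∪ K₁ = s.ones := by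
    ext b
    rw [Finset.mem_union, Finset.mem_sdiff]
    by_cases hb : b ∈ K
    · simp [hb, h2 b hb]
    · simp [hb, show b ∉ K₁ from fun hb1 => hb (h.subset₁ hb1)]
  refine ⟨⟨s.ones \ K, ho, s.plus, h.points ▸ s.plus_subset, fun p q hpq => ?_⟩, ?_⟩
  · rw [h.sameLoop _ ho, hu] at hpq
    exact s.plus_iff p q hpq
  · exact h.eq_lower rfl h2 fun p _ => rfl

/-- The map which takes `lower t` to `t`, up to the sign `σ`, and all other enhanced states to zero. -/
def proj (σ : Finset ℕ → ℚ) : S.Chain →ₗ[ℚ] S'.Chain :=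
  ofCoeff fun s t => if s = h.lower t then σ s.ones else 0

theorem proj_lower (σ : Finset ℕ → ℚ) (t : S'.EnhancedState) :
    h.proj σ (h.lower t).chain = σ (h.lower t).ones • t.chain := by
  ext u
  rw [proj, ofCoeff_chain_apply, Finsupp.smul_apply, EnhancedState.chain_apply, smul_eq_mul]
  by_cases htu : t = u
  · rw [if_pos (congrArg _ htu), if_pos htu, mul_one]
  · rw [if_neg fun e => htu (h.lower_injective e), if_neg htu, mul_zero]

theorem proj_eq_zero (σ : Finset ℕ → ℚ) {s : S.EnhancedState} {b : ℕ} (hb : b ∈ K)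
    (hs : ¬ (b ∈ s.ones ↔ b ∈ K₁)) : h.proj σ s.chain = 0 := by
  ext u
  rw [proj, ofCoeff_chain_apply, if_neg]
  · rfl
  · rintro rfl
    exact hs (h.mem_lower_iff u hb)

/-- The sign `σ` makes up for the missing crossings. -/
def IsSign (S' : Pattern P) (K₁ : Finset ℕ) (σ : Finset ℕ → ℚ) : Prop :=
  ∀ o ⊆ S'.crossings, ∀ b ∈ S'.crossings, b ∉ o →
    (-1) ^ ((o ∪ K₁).filter (· < b)).card * σ (insert b (o ∪ K₁)) =
      σ (o ∪ K₁) * (-1) ^ (o.filter (· < b)).card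

theorem localCoeff_lower (E : EdgeTable) {b : ℕ} (hb : b ∈ S'.crossings) (t v : S'.EnhancedState) :
    localCoeff E b (h.lower t) (h.lower v) = localCoeff E b t v := by
  rw [localCoeff_eq, localCoeff_eq]
  simp only [h.mark_lower, h.lower_ones, ← h.sameLoop _ t.ones_subset, h.corner b hb, h.points]

/-- Two lowered states agree on `K`, so an edge between them is at a crossing of `S'`, where the
loops and the marks are the same in both patterns. Only the sign of the edge differs, and `σ`
absorbs this. -/
theorem edgeCoeff_lower {σ : Finset ℕ → ℚ} (hσ : IsSign S' K₁ σ) (E : EdgeTable)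
    (t v : S'.EnhancedState) : edgeCoeff E (h.lower t) (h.lower v) * σ (h.lower v).ones =
      σ (h.lower t).ones * edgeCoeff E t v := by
  by_cases hb : ∃ b ∈ S'.crossings, b ∉ t.ones ∧ v.ones = insert b t.ones
  · obtain ⟨b, hb, hbt, hv⟩ := hb
    have hb' : b ∈ S.crossings \ K := h.crossings ▸ hb
    rw [Finset.mem_sdiff] at hb'
    have hv' : (h.lower v).ones = insert b (h.lower t).ones := by
      rw [lower_ones, lower_ones, hv, Finset.insert_union]
    have hbt' : b ∉ (h.lower t).ones := by
      rw [lower_ones, Finset.mem_union, not_or]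
      exact ⟨hbt, fun hb1 => hb'.2 (h.subset₁ hb1)⟩
    rw [edgeCoeff_eq hb hbt hv, edgeCoeff_eq hb'.1 hbt' hv', h.localCoeff_lower E hb, hv',
      lower_ones]
    linear_combination localCoeff E b t v * hσ _ t.ones_subset b hb hbt
  · push Not at hb
    rw [edgeCoeff_eq_zero hb, edgeCoeff_eq_zero, zero_mul, mul_zero]
    intro b _ hbt hv
    have hbK : b ∉ K := fun hbK => hbt ((h.mem_lower_iff t hbK).2 ((h.mem_lower_iff v hbK).1
      (hv ▸ Finset.mem_insert_self _ _)))
    have hbv : b ∈ v.ones := by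
      rw [← h.lower_ones_sdiff, hv]
      exact Finset.mem_sdiff.2 ⟨Finset.mem_insert_self _ _, hbK⟩
    refine hb b (v.ones_subset hbv) (fun h' => hbt (Finset.mem_union_left _ h')) ?_
    rw [← h.lower_ones_sdiff, hv, Finset.insert_sdiff_of_notMem _ hbK, h.lower_ones_sdiff]

/-- The target `v` receives only from `lower v`, so this is `edgeCoeff_lower` in matrix form. It
holds for every table, hence for `d` and for `Φ`, but only on lowered states: another state may have
an edge into a lowered one. -/
theorem proj_edge {σ : Finset ℕ → ℚ} (hσ : IsSign S' K₁ σ) (E : EdgeTable) (t : S'.EnhancedState) :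
    h.proj σ (ofCoeff (edgeCoeff E) (h.lower t).chain) =
      ofCoeff (edgeCoeff E) (h.proj σ (h.lower t).chain) := by
  rw [proj_lower, map_smul]
  ext v
  rw [map_ofCoeff_chain, Finsupp.smul_apply, ofCoeff_chain_apply, smul_eq_mul,
    ← h.edgeCoeff_lower hσ, Finsupp.finsetSum_apply, Finset.sum_eq_single (h.lower v)]
  · rw [proj, Finsupp.smul_apply, ofCoeff_chain_apply, if_pos rfl, smul_eq_mul]
  · intro u _ hu
    rw [proj, Finsupp.smul_apply, ofCoeff_chain_apply, if_neg hu, smul_zero]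
  · simp

end Removal

/-! ### Resolving a crossing -/

theorem ofCoeff_ofCoeff_apply {Q R : Type} {S : Pattern P} {T : Pattern Q} {U : Pattern R}
    (a : S.EnhancedState → T.EnhancedState → ℚ) (b : T.EnhancedState → U.EnhancedState → ℚ)
    (s : S.EnhancedState) (u : U.EnhancedState) :
    ofCoeff b (ofCoeff a s.chain) u = ∑ t, a s t * b t u := by
  rw [map_ofCoeff_chain, Finsupp.finsetSum_apply]
  exact Finset.sum_congr rfl fun t _ => by
    rw [Finsupp.smul_apply, ofCoeff_chain_apply, smul_eq_mul]

/-- If `c` is `0`-smoothed, the arcs at the handle lie on one loop, and the handle pinches off the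
small loop of the kink. Removing this loop selects the part `z ⊗ v₋` of `Δ(z)`, so the composite is
the identity on marks. States with `c` `1`-smoothed are killed by the Reidemeister I map. -/
theorem resolveMap_eq_proj {S S' : Pattern P} (hS : S.Surgical) {c : ℕ}
    (h : Removal S S' {c} ∅) : resolveMap S S' c = h.proj fun _ => 1 := by
  have hc : c ∈ S.crossings := h.subset (Finset.mem_singleton_self c)
  refine chain_ext fun s => Finsupp.ext fun u => ?_
  rw [resolveMap, LinearMap.comp_apply, unkinkMap, handleMap, ofCoeff_ofCoeff_apply, Removal.proj,
    ofCoeff_chain_apply]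
  have hcu : c ∉ (h.lower u).ones := by
    rw [h.mem_lower_iff u (Finset.mem_singleton_self c)]; simp
  by_cases hones : s.ones = u.ones
  swap
  · rw [if_neg, Finset.sum_eq_zero]
    · intro t _
      by_cases h1 : t.ones = s.ones
      · rw [if_neg (c := _ ∧ _ ∧ _) (fun h' => hones (h1.symm.trans h'.2.1.symm)), mul_zero]
      · rw [if_neg (fun h' => h1 h'.1), zero_mul]
    · rintro rfl
      exact hones (by simp)
  have hcs : c ∉ s.ones := by
    rw [hones]; intro h'; exact h.notMem_of_mem h' (Finset.mem_singleton_self c)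
  -- the only enhanced state in between
  have hinr : ∀ o, c ∉ o → ∀ p q, (S.handle c).Link o p q →
      (∃ p' q', p = Sum.inl p' ∧ q = Sum.inl q' ∧ S.SameLoop o p' q') ∨
      (p = Sum.inr false ∧ q = Sum.inr true) := by
    intro o hco p q hpq
    rcases hpq with hpq | ⟨b, hb, hpq⟩
    · rcases p with p | p <;> rcases q with q | q
      · refine Or.inl ⟨p, q, rfl, rfl, ?_⟩
        rcases hpq with hpq | ⟨rfl, rfl⟩
        · exact .rel _ _ (Or.inl hpq)
        · exact .rel _ _ (Or.inr ⟨c, hc, by rw [if_neg hco]; exact Or.inl ⟨rfl, rfl⟩⟩)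
      · exact hpq.elim
      · exact hpq.elim
      · obtain ⟨rfl, rfl⟩ := hpq
        exact Or.inr ⟨rfl, rfl⟩
    · by_cases hbc : b = c
      · subst hbc
        rw [if_neg hco] at hpq
        simp only [handle, if_true] at hpq
        rcases hpq with ⟨rfl, rfl⟩ | ⟨rfl, rfl⟩
        · exact Or.inr ⟨rfl, rfl⟩
        · exact Or.inl ⟨_, _, rfl, rfl, .rel _ _ (Or.inr ⟨b, hc, by
            rw [if_neg hco]; exact Or.inr ⟨rfl, rfl⟩⟩)⟩
      · simp only [handle, if_neg hbc] at hpq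
        split_ifs at hpq with hbo <;> rcases hpq with ⟨rfl, rfl⟩ | ⟨rfl, rfl⟩ <;>
          refine Or.inl ⟨_, _, rfl, rfl, .rel _ _ (Or.inr ⟨b, hb, ?_⟩)⟩ <;> simp [hbo]
  let t : (S.handle c).EnhancedState :=
    { ones := s.ones
      ones_subset := s.ones_subset
      plus := u.plus.map Function.Embedding.inl
      plus_subset := by
        intro p hp
        obtain ⟨q, hq, rfl⟩ := Finset.mem_map.1 hp
        exact Finset.inl_mem_disjSum.2 (h.points ▸ u.plus_subset hq)
      plus_iff := fun p q hpq => by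
        refine eqvGen_le (R := fun p q => p ∈ u.plus.map Function.Embedding.inl ↔
          q ∈ u.plus.map Function.Embedding.inl) ⟨fun _ => Iff.rfl, Iff.symm, Iff.trans⟩ ?_ hpq
        intro p q hpq
        rcases hinr _ hcs p q hpq with ⟨p, q, rfl, rfl, hpq'⟩ | ⟨rfl, rfl⟩
        · have := u.plus_iff p q ((h.sameLoop _ u.ones_subset p q).2 (by
            rw [Finset.union_empty, ← hones]; exact hpq'))
          simpa using this
        · simp }
  have ht : ∀ p, t.mark (Sum.inl p) = u.mark p := fun p =>
    EnhancedState.mark_eq_mark.2 (by simp [t])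
  have ht' : ∀ e, t.mark (Sum.inr e) = .minus := fun e =>
    EnhancedState.mark_eq_minus.2 (by simp [t])
  have huniq : ∀ v : (S.handle c).EnhancedState, v.ones = s.ones →
      v.mark (Sum.inr false) = .minus → (∀ p ∈ S.points, v.mark (Sum.inl p) = u.mark p) →
      v = t := by
    intro v hv1 hv2 hv3
    refine EnhancedState.ext_mark hv1 fun p hp => ?_
    rcases p with p | e
    · rw [hv3 p (Finset.inl_mem_disjSum.1 hp), ht]
    · rw [ht']
      cases e
      · exact hv2
      · rw [← hv2]
        refine (v.mark_congr (.rel _ _ (Or.inl ?_))).symm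
        exact ⟨rfl, rfl⟩
  rw [Finset.sum_eq_single t]
  · have hsl : S.SameLoop s.ones (S.corner c 0) (S.corner c 1) :=
      .rel _ _ (Or.inr ⟨c, hc, by rw [if_neg hcs]; exact Or.inl ⟨rfl, rfl⟩⟩)
    have hx := hS.corner_mem c hc 0
    have h1 : c ∉ t.ones ∧ u.ones = t.ones ∧ t.mark (Sum.inr false) = .minus ∧
        ∀ p ∈ S.points, t.mark (Sum.inl p) = u.mark p := ⟨hcs, hones.symm, ht' _, fun p _ => ht p⟩
    rw [if_pos h1, mul_one, surgeryCoeff, if_pos hsl, ht, ht']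
    by_cases hsu : s = h.lower u
    · have hm : ∀ p, s.mark p = u.mark p := fun p => by rw [hsu]; rfl
      rw [if_pos hsu, if_pos ⟨rfl, fun p _ _ => by rw [ht, hm]⟩, hm]
      cases u.mark (S.corner c 0) <;> rfl
    · rw [if_neg hsu]
      split_ifs with h2
      -- Equal marks on the pinched loop would make `s` the lowering of `u`. For different marks the
      -- coefficient in `Δ` with second factor `v₋` is zero.
      · by_cases h3 : s.mark (S.corner c 0) = u.mark (S.corner c 0)
        · refine absurd (h.eq_lower ?_ (by simpa using hcs) fun p hp => ?_) hsu
          · rw [← hones, Finset.sdiff_singleton_eq_erase, Finset.erase_eq_of_notMem hcs]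
          · by_cases h4 : S.SameLoop s.ones p (S.corner c 0)
            · rw [s.mark_congr h4, h3]
              refine u.mark_congr ((h.sameLoop _ u.ones_subset _ _).2 ?_)
              rw [Finset.union_empty, ← hones]
              exact h4.symm
            · rw [h2.2 p hp, ht]
              rintro a (rfl | rfl)
              · exact h4
              · exact fun h5 => h4 (h5.trans hsl.symm)
        · revert h3
          cases s.mark (S.corner c 0) <;> cases u.mark (S.corner c 0) <;> simp [khovanovTable]
      · rfl
  · intro v _ hv
    by_cases h1 : v.ones = s.ones
    · rw [if_neg (c := _ ∧ _ ∧ _) (fun h' => hv (huniq v h1 h'.2.2.1 h'.2.2.2)), mul_zero]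
    · rw [if_neg (fun h' => h1 h'.1), zero_mul]
  · simp

theorem Removal.isSign_one {S' : Pattern P} : IsSign S' ∅ fun _ => 1 := by
  intro o _ b _ _
  simp

/-- The states with `c` `1`-smoothed span a subcomplex, because edges never undo a `1`-smoothing.
The map is the projection to the quotient. -/
theorem resolveMap_d {S S' : Pattern P} (hS : S.Surgical) {c : ℕ} (h : Removal S S' {c} ∅)
    (z : S.Chain) : S'.d (resolveMap S S' c z) = resolveMap S S' c (S.d z) := by
  suffices h' : S'.d ∘ₗ resolveMap S S' c = resolveMap S S' c ∘ₗ S.d from LinearMap.congr_fun h' z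
  rw [resolveMap_eq_proj hS h]
  refine chain_ext fun s => ?_
  rw [LinearMap.comp_apply, LinearMap.comp_apply]
  by_cases hc : c ∈ s.ones
  · have hk : ∀ v : S.EnhancedState, c ∈ v.ones → h.proj (fun _ => 1) v.chain = 0 := fun v hv =>
      h.proj_eq_zero _ (Finset.mem_singleton_self c) (by simp [hv])
    rw [hk s hc, map_zero, d, map_ofCoeff_chain, Finset.sum_eq_zero]
    intro v _
    by_cases hv : c ∈ v.ones
    · rw [hk v hv, smul_zero]
    · rw [edgeCoeff_eq_zero, zero_smul]
      intro b _ _ e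
      exact hv (e ▸ Finset.mem_insert_of_mem hc)
  · obtain ⟨t, rfl⟩ := h.exists_lower (s := s) (by simpa using hc)
    exact (h.proj_edge Removal.isSign_one _ t).symm

end Pattern

/-! ### The Reidemeister II map is a chain map. -/

namespace Pattern
variable {P : Type}

/-- The diagrams before and after a Reidemeister II move between two parallel strands. -/
structure Bigon (S S' : Pattern P) (c c' : ℕ) (x o y : P) : Prop
    extends Removal S S' {c, c'} {c'} where
  ne : c ≠ c'
  adjacent : ∀ b ∈ S'.crossings, b < c ↔ b < c'
  mem_x : x ∈ S.points
  mem_y : y ∈ S.points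
  mem_o : o ∈ S.points
  -- The last three fields treat the smoothings of the pair in which both crossings turn back, only
  -- `c'` does, and neither does.
  circle : ∀ w ⊆ S.crossings, c ∈ w → c' ∉ w → ¬ S.SameLoop w o x ∧ ¬ S.SameLoop w o y ∧
    (S.SameLoop w o (S.corner c 0) ↔ ¬ S.SameLoop w o (S.corner c 2)) ∧
    ∀ b ∈ S'.crossings, ¬ S.SameLoop w o (S.corner b 0) ∧ ¬ S.SameLoop w o (S.corner b 2)
  before : ∀ w ⊆ S.crossings, c ∉ w → c' ∉ w →
    S.SameLoop w o (S.corner c 0) ∧ S.SameLoop w o (S.corner c 2) ∧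
    S.SameLoop w (S.corner c' 0) x ∧ S.SameLoop w (S.corner c' 2) y ∧
    (S.SameLoop w o x ∨ S.SameLoop w o y)
  after : ∀ w ⊆ S.crossings, c ∉ w → c' ∈ w →
    S.SameLoop w (S.corner c' 0) y ∧ S.SameLoop w (S.corner c' 2) x

namespace Bigon
variable {S S' : Pattern P} {c c' : ℕ} {x o y : P} (h : Bigon S S' c c' x o y)

/-- The sign in the Reidemeister II map. -/
def sign (c c' : ℕ) (w : Finset ℕ) : ℚ := (-1) ^ (w.filter (max c c' < ·)).card

theorem sign_insert {w : Finset ℕ} {b : ℕ} (hb : b ∉ w) :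
    sign c c' (insert b w) = (if max c c' < b then -1 else 1) * sign c c' w :=
  neg_one_pow_filter_insert hb _

theorem ne_of_mem (h : Bigon S S' c c' x o y) {b : ℕ} (hb : b ∈ S'.crossings) : b ≠ c ∧ b ≠ c' := by
  rw [h.crossings, Finset.mem_sdiff, Finset.mem_insert, Finset.mem_singleton, not_or] at hb
  exact hb.2

theorem mem_c (h : Bigon S S' c c' x o y) : c ∈ S.crossings := h.subset (by simp)
theorem mem_c' (h : Bigon S S' c c' x o y) : c' ∈ S.crossings := h.subset (by simp)

/-- The extra `1`-smoothed crossing `c'` changes the sign of the edge at `b` exactly if `c' < b`. As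
`c` and `c'` are neighbours in the order, this is the condition `max c c' < b` under which `sign`
changes. -/
theorem isSign (h : Bigon S S' c c' x o y) : Removal.IsSign S' {c'} (sign c c') := by
  intro w hw b hb hbw
  have hc'w : c' ∉ w := fun h' => (h.ne_of_mem (hw h')).2 rfl
  obtain ⟨h1, h2⟩ := h.ne_of_mem hb
  have hadj := h.adjacent b hb
  have hbw' : b ∉ insert c' w := by simp [hbw, h2]
  rw [Finset.union_comm, ← Finset.insert_eq, sign_insert hbw', neg_one_pow_filter_insert hc'w (· < b)]
  have hiff : max c c' < b ↔ c' < b := by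
    rw [max_lt_iff]; omega
  rw [if_congr hiff rfl rfl]
  split_ifs <;> ring

/-- The coefficients of the Reidemeister II map. -/
theorem map_apply (s : S.EnhancedState) (u : S'.EnhancedState) :
    reidemeisterTwoMap S S' c c' x o y s.chain u = sign c c' s.ones *
      if u.ones = (s.ones.erase c).erase c' then
        if c ∉ s.ones ∧ c' ∈ s.ones ∧ ∀ p ∈ S.points, s.mark p = u.mark p then 1
        else if c ∈ s.ones ∧ c' ∉ s.ones ∧ s.mark o = .minus ∧ AgreeOff id {x, y, o} s u then
          -surgeryCoeff khovanovTable s u x y x y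
        else 0
      else 0 := by
  rw [reidemeisterTwoMap, ofCoeff_chain_apply, sign]

theorem map_eq_proj {s : S.EnhancedState} (hs : c' ∈ s.ones) :
    reidemeisterTwoMap S S' c c' x o y s.chain = h.toRemoval.proj (sign c c') s.chain := by
  ext u
  rw [map_apply, Removal.proj, ofCoeff_chain_apply]
  by_cases hsu : s = h.lower u
  · rw [if_pos hsu, if_pos, if_pos, mul_one]
    · refine ⟨?_, hs, fun p _ => by rw [hsu]; rfl⟩
      rw [hsu, h.mem_lower_iff u (by simp)]
      simpa using h.ne
    · conv_lhs => rw [← h.lower_ones_sdiff u, ← hsu]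
      ext b; simp; tauto
  · rw [if_neg hsu]
    split_ifs with h1 h2 h3
    · refine absurd (h.eq_lower ?_ ?_ h2.2.2) hsu
      · rw [h1]; ext b; simp; tauto
      · intro b hb
        rw [Finset.mem_insert, Finset.mem_singleton] at hb
        rcases hb with rfl | rfl
        · simp [h2.1, h.ne]
        · simp [hs]
    · exact absurd hs h3.2.1
    · simp
    · simp

theorem map_eq_zero {s : S.EnhancedState} (h1 : c ∈ s.ones ↔ c' ∈ s.ones) :
    reidemeisterTwoMap S S' c c' x o y s.chain = 0 := by
  ext u
  rw [map_apply, if_neg (c := _ ∧ _ ∧ _) (by tauto), if_neg (c := _ ∧ _ ∧ _) (by tauto)]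
  simp

theorem map_eq_zero_of_plus {s : S.EnhancedState} (h1 : c' ∉ s.ones) (h2 : s.mark o = .plus) :
    reidemeisterTwoMap S S' c c' x o y s.chain = 0 := by
  ext u
  rw [map_apply, if_neg (c := _ ∧ _ ∧ _) (by tauto), if_neg (c := _ ∧ _ ∧ _) (by simp [h2])]
  simp

variable (hS : S.Surgical)

/-- The loops over the corner of the cube with the small circle, away from the circle. -/
theorem sameLoop_off_circle (h : Bigon S S' c c' x o y) (hS : S.Surgical) {w : Finset ℕ}
    (hw : w ⊆ S.crossings) (hc : c ∉ w) (hc' : c' ∉ w) {p q : P} (hp : p ∈ S.points)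
    (hq : q ∈ S.points) (hpo : ¬ S.SameLoop (insert c w) o p)
    (hqo : ¬ S.SameLoop (insert c w) o q) : S.SameLoop w p q ↔ S.SameLoop (insert c w) p q := by
  obtain ⟨-, -, h3, -⟩ := h.circle (insert c w) (Finset.insert_subset h.mem_c hw)
    (Finset.mem_insert_self _ _) (by simp [hc', h.ne.symm])
  obtain ⟨k1, k2, -⟩ := h.before w hw hc hc'
  have hE := S.sameLoop_equivalence (insert c w)
  rcases hS.surgery w hw c h.mem_c hc with ⟨h4, -⟩ | ⟨h4, h5⟩
  · exact absurd (k1.symm.trans k2) h4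
  · rw [h5 p hp q hq, Join]
    have := @hE.symm; have := @hE.trans
    grind

/-- Both opposite ends of `c` lie on the loop of `o`, so the surgery at `c` is a split and the loops
after it refine those before. -/
theorem sameLoop_of_insert (h : Bigon S S' c c' x o y) (hS : S.Surgical) {w : Finset ℕ}
    (hw : w ⊆ S.crossings) (hc : c ∉ w) (hc' : c' ∉ w) {p q : P} (hp : p ∈ S.points)
    (hpq : S.SameLoop (insert c w) p q) : S.SameLoop w p q := by
  obtain ⟨k1, k2, -⟩ := h.before w hw hc hc'
  rcases hS.surgery w hw c h.mem_c hc with ⟨h4, -⟩ | ⟨h4, h5⟩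
  · exact absurd (k1.symm.trans k2) h4
  · exact (h5 p hp q ((hS.sameLoop_mem hpq).1 hp)).2 (Or.inl hpq)

/-- Splitting off the small circle with the mark `v₋` keeps all other marks. -/
theorem localCoeff_circle (h : Bigon S S' c c' x o y) (hS : S.Surgical) {r v : S.EnhancedState}
    (hc : c ∉ r.ones) (hc' : c' ∉ r.ones) (hv : v.ones = insert c r.ones)
    (hvo : v.mark o = .minus) : localCoeff khovanovTable c r v =
      if ∀ q ∈ S.points, ¬ S.SameLoop v.ones o q → v.mark q = r.mark q then 1 else 0 := by
  have hcirc := h.circle (insert c r.ones) (Finset.insert_subset h.mem_c r.ones_subset)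
    (Finset.mem_insert_self _ _) (by simp [hc', h.ne.symm])
  obtain ⟨-, -, h3, -⟩ := hcirc
  obtain ⟨k1, k2, -⟩ := h.before r.ones r.ones_subset hc hc'
  have hoff := fun {p q} => h.sameLoop_off_circle hS r.ones_subset hc hc' (p := p) (q := q)
  have hle := fun {p q} => h.sameLoop_of_insert hS r.ones_subset hc hc' (p := p) (q := q)
  have hc0 := hS.corner_mem c h.mem_c 0
  have hc2 := hS.corner_mem c h.mem_c 2
  rw [localCoeff_eq, if_pos (k1.symm.trans k2), hv]
  -- `e'` is on the circle and `e` is not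
  obtain ⟨e, e', he, he', heo, heo', hre, hoffe, hcom⟩ : ∃ e e', e ∈ S.points ∧ e' ∈ S.points ∧
      ¬ S.SameLoop (insert c r.ones) o e ∧ S.SameLoop (insert c r.ones) o e' ∧
      S.SameLoop r.ones o e ∧
      (∀ q, (¬ S.SameLoop r.ones q (S.corner c 0) → ¬ S.SameLoop r.ones q (S.corner c 2) →
        r.mark q = v.mark q) ↔ (¬ S.SameLoop r.ones q e → r.mark q = v.mark q)) ∧
      khovanovTable.comul (r.mark (S.corner c 0)) (v.mark (S.corner c 0)) (v.mark (S.corner c 2)) =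
        if v.mark e = r.mark e then 1 else 0 := by
    have hq : ∀ q, S.SameLoop r.ones q (S.corner c 0) ↔ S.SameLoop r.ones q (S.corner c 2) :=
      fun q => ⟨fun h' => h'.trans (k1.symm.trans k2), fun h' => h'.trans (k2.symm.trans k1)⟩
    by_cases h4 : S.SameLoop (insert c r.ones) o (S.corner c 2)
    · refine ⟨_, _, hc0, hc2, fun h' => h3.1 h' h4, h4, k1, fun q => ?_, ?_⟩
      · rw [hq]; tauto
      · rw [show v.mark (S.corner c 2) = .minus by rw [← hvo]; exact (v.mark_congr (hv ▸ h4)).symm]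
        cases r.mark (S.corner c 0) <;> cases v.mark (S.corner c 0) <;> simp [khovanovTable]
    · refine ⟨_, _, hc2, hc0, h4, h3.2 h4, k2, fun q => ?_, ?_⟩
      · rw [hq]; tauto
      · rw [show v.mark (S.corner c 0) = .minus by
          rw [← hvo]; exact (v.mark_congr (hv ▸ h3.2 h4)).symm,
          r.mark_congr (k1.symm.trans k2)]
        cases r.mark (S.corner c 2) <;> cases v.mark (S.corner c 2) <;> simp [khovanovTable]
  rw [hcom, if_congr (forall₂_congr fun q _ => hoffe q) rfl rfl]
  rw [← ite_and]
  refine if_congr ⟨?_, ?_⟩ rfl rfl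
  · rintro ⟨h4, h5⟩ q hq hqo
    by_cases hqe : S.SameLoop r.ones q e
    · rw [r.mark_congr hqe, ← h5]
      refine v.mark_congr ?_
      rw [hv]
      exact (hoff hq he hqo heo).1 hqe
    · exact (h4 q hq hqe).symm
  · intro h4
    refine ⟨fun q hq hqe => (h4 q hq fun hqo => hqe ?_).symm, h4 e he heo⟩
    exact (hle h.mem_o hqo).symm.trans hre

/-- The enhanced state obtained by splitting off the small circle, marked by `v₋`. -/
theorem exists_split (h : Bigon S S' c c' x o y) (hS : S.Surgical) {r : S.EnhancedState}
    (hc : c ∉ r.ones) (hc' : c' ∉ r.ones) : ∃ v : S.EnhancedState, v.ones = insert c r.ones ∧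
      v.mark o = .minus ∧ ∀ q ∈ S.points, ¬ S.SameLoop v.ones o q → v.mark q = r.mark q := by
  have hle := fun {p q} => h.sameLoop_of_insert hS r.ones_subset hc hc' (p := p) (q := q)
  refine ⟨⟨insert c r.ones, Finset.insert_subset h.mem_c r.ones_subset,
    r.plus.filter fun q => ¬ S.SameLoop (insert c r.ones) o q,
    (Finset.filter_subset _ _).trans r.plus_subset, fun p q hpq => ?_⟩, rfl, ?_, fun q hq hqo => ?_⟩
  · have h1 : S.SameLoop (insert c r.ones) o p ↔ S.SameLoop (insert c r.ones) o q :=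
      ⟨fun h' => h'.trans hpq, fun h' => h'.trans hpq.symm⟩
    rw [Finset.mem_filter, Finset.mem_filter, h1]
    by_cases hp : p ∈ S.points
    · rw [r.plus_iff p q (hle hp hpq)]
    · have hq : q ∉ S.points := fun hq => hp ((hS.sameLoop_mem hpq).2 hq)
      exact iff_of_false (fun h' => hp (r.plus_subset h'.1)) (fun h' => hq (r.plus_subset h'.1))
  · rw [EnhancedState.mark_eq_minus]
    simp [SameLoop.refl]
  · rw [EnhancedState.mark_eq_mark]
    simp only at hqo
    simp [hqo]

theorem split_unique {r v v' : S.EnhancedState}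
    (hv : v.ones = insert c r.ones) (hv' : v'.ones = insert c r.ones)
    (hvo : v.mark o = .minus) (hvo' : v'.mark o = .minus)
    (hm : ∀ q ∈ S.points, ¬ S.SameLoop v.ones o q → v.mark q = r.mark q)
    (hm' : ∀ q ∈ S.points, ¬ S.SameLoop v'.ones o q → v'.mark q = r.mark q) : v = v' := by
  refine EnhancedState.ext_mark (hv.trans hv'.symm) fun q hq => ?_
  by_cases hqo : S.SameLoop v.ones o q
  · rw [← v.mark_congr hqo, hvo, ← v'.mark_congr (hv' ▸ hv ▸ hqo), hvo']
  · rw [hm q hq hqo, hm' q hq (hv' ▸ hv ▸ hqo)]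

/-- Every enhanced state with a small circle marked by `v₋` arises in this way. -/
theorem exists_merge (h : Bigon S S' c c' x o y) (hS : S.Surgical) {v : S.EnhancedState}
    (hc : c ∈ v.ones) (hc' : c' ∉ v.ones) : ∃ r : S.EnhancedState, r.ones = v.ones.erase c ∧
      ∀ q ∈ S.points, ¬ S.SameLoop v.ones o q → v.mark q = r.mark q := by
  have hcw : c ∉ v.ones.erase c := by simp
  have hc'w : c' ∉ v.ones.erase c := by simp [hc']
  have hw : v.ones.erase c ⊆ S.crossings := (Finset.erase_subset _ _).trans v.ones_subset
  have hins : insert c (v.ones.erase c) = v.ones := Finset.insert_erase hc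
  obtain ⟨-, -, h3, -⟩ := h.circle v.ones v.ones_subset hc hc'
  obtain ⟨k1, k2, -⟩ := h.before _ hw hcw hc'w
  have hE := S.sameLoop_equivalence v.ones
  have hsurg := hS.surgery _ hw c h.mem_c hcw
  rw [hins] at hsurg
  obtain ⟨h4, h5⟩ := hsurg.resolve_left fun h' => h'.1 (k1.symm.trans k2)
  -- `e` is the end of `c` which is not on the circle; the merged state gives the circle the mark at
  -- `e`.
  obtain ⟨e, heo, hje⟩ : ∃ e, ¬ S.SameLoop v.ones o e ∧
      ∀ p q, Join (S.SameLoop v.ones) (S.corner c 0) (S.corner c 2) p q →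
        S.SameLoop v.ones p q ∨ (S.SameLoop v.ones o p ∧ S.SameLoop v.ones e q) ∨
          (S.SameLoop v.ones o q ∧ S.SameLoop v.ones e p) := by
    have := @hE.symm; have := @hE.trans
    unfold Join
    by_cases h6 : S.SameLoop v.ones o (S.corner c 2)
    · exact ⟨S.corner c 0, fun h' => h3.1 h' h6, by grind⟩
    · exact ⟨S.corner c 2, h6, by grind⟩
  refine ⟨⟨v.ones.erase c, hw, S.points.filter fun q =>
    if S.SameLoop v.ones o q then e ∈ v.plus else q ∈ v.plus, Finset.filter_subset _ _,
    fun p q hpq => ?_⟩, rfl, fun q hq hqo => ?_⟩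
  · rw [Finset.mem_filter, Finset.mem_filter, ← hS.sameLoop_mem hpq]
    refine and_congr_right fun hp => ?_
    have hq := (hS.sameLoop_mem hpq).1 hp
    rcases hje p q ((h5 p hp q hq).1 hpq) with h6 | ⟨h6, h7⟩ | ⟨h6, h7⟩
    · have h1 : S.SameLoop v.ones o p ↔ S.SameLoop v.ones o q :=
        ⟨fun h' => h'.trans h6, fun h' => h'.trans h6.symm⟩
      rw [h1, v.plus_iff p q h6]
    · rw [if_pos h6, if_neg fun h' => heo (h'.trans h7.symm), v.plus_iff _ _ h7]
    · rw [if_pos h6, if_neg fun h' => heo (h'.trans h7.symm), v.plus_iff _ _ h7]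
  · rw [EnhancedState.mark_eq_mark]
    simp [hqo, hq]

end Bigon

end Pattern

namespace Pattern
variable {P : Type}

theorem agreeOff_triple {S T : Pattern P} {x y o : P} {s : S.EnhancedState} {u : T.EnhancedState} :
    AgreeOff id {x, y, o} s u ↔ ∀ q ∈ S.points, ¬ S.SameLoop s.ones q x →
      ¬ S.SameLoop s.ones q y → ¬ S.SameLoop s.ones q o → s.mark q = u.mark q := by
  simp [AgreeOff]

namespace Bigon
variable {S S' : Pattern P} {c c' : ℕ} {x o y : P}

/-- The saddle in the Reidemeister II map is the edge map at `c'`. -/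
theorem localCoeff_saddle (h : Bigon S S' c c' x o y) (hS : S.Surgical) {r v : S.EnhancedState}
    {u : S'.EnhancedState} (hc : c ∉ r.ones) (hc' : c' ∉ r.ones) (hv : v.ones = insert c r.ones)
    (hm : ∀ q ∈ S.points, ¬ S.SameLoop v.ones o q → v.mark q = r.mark q) (hu : u.ones = r.ones) :
    localCoeff khovanovTable c' r (h.lower u) = if AgreeOff id {x, y, o} v u then
      surgeryCoeff khovanovTable v u x y x y else 0 := by
  obtain ⟨hox, hoy, -⟩ := h.circle (insert c r.ones) (Finset.insert_subset h.mem_c r.ones_subset)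
    (Finset.mem_insert_self _ _) (by simp [hc', h.ne.symm])
  obtain ⟨-, -, k1, k2, k3⟩ := h.before r.ones r.ones_subset hc hc'
  have hoff := fun {p q} => h.sameLoop_off_circle hS r.ones_subset hc hc' (p := p) (q := q)
  have hle := fun {p q} => h.sameLoop_of_insert hS r.ones_subset hc hc' (p := p) (q := q)
  have hlu : (h.lower u).ones = insert c' r.ones := by
    rw [h.lower_ones, hu, Finset.union_comm, Finset.insert_eq]
  obtain ⟨a1, a2⟩ := h.after (h.lower u).ones (h.lower u).ones_subset
    (by rw [hlu]; simp [hc, h.ne]) (by rw [hlu]; simp)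
  have hsurg := hS.surgery r.ones r.ones_subset c' h.mem_c' hc'
  rw [← hlu] at hsurg
  have m0 := hS.corner_mem c' h.mem_c' 0
  have m2 := hS.corner_mem c' h.mem_c' 2
  have hE := S.sameLoop_equivalence r.ones
  have hEu := S.sameLoop_equivalence (h.lower u).ones
  have hR0 : ∀ q, S.SameLoop r.ones q (S.corner c' 0) ↔ S.SameLoop r.ones q x :=
    fun q => ⟨fun h' => h'.trans k1, fun h' => h'.trans k1.symm⟩
  have hR2 : ∀ q, S.SameLoop r.ones q (S.corner c' 2) ↔ S.SameLoop r.ones q y :=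
    fun q => ⟨fun h' => h'.trans k2, fun h' => h'.trans k2.symm⟩
  have hxy : S.SameLoop r.ones (S.corner c' 0) (S.corner c' 2) ↔ S.SameLoop v.ones x y := by
    rw [hR2, hv, ← hoff h.mem_x h.mem_y hox hoy]
    exact ⟨fun h' => k1.symm.trans h', fun h' => k1.trans h'⟩
  have hmx : v.mark x = r.mark x := hm x h.mem_x (hv ▸ hox)
  have hmy : v.mark y = r.mark y := hm y h.mem_y (hv ▸ hoy)
  have hagree : (∀ q ∈ S.points, ¬ S.SameLoop r.ones q (S.corner c' 0) →
      ¬ S.SameLoop r.ones q (S.corner c' 2) → r.mark q = (h.lower u).mark q) ↔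
      AgreeOff id {x, y, o} v u := by
    rw [agreeOff_triple]
    refine forall₂_congr fun q hq => ?_
    rw [hR0, hR2, h.mark_lower]
    by_cases hqo : S.SameLoop v.ones o q
    -- A point of the circle is exempt on both sides: through `o` in `v`, and in `r` because there
    -- its loop passes through `x` or `y`.
    · refine iff_of_true (fun h1 h2 => ?_) (fun _ _ h3 => absurd hqo.symm h3)
      have hqo' := hle h.mem_o (hv ▸ hqo)
      exact (k3.elim (fun h' => h1 (hqo'.symm.trans h')) (fun h' => h2 (hqo'.symm.trans h'))).elim
    · rw [hm q hq hqo, hv, hoff hq h.mem_x (hv ▸ hqo) hox, hoff hq h.mem_y (hv ▸ hqo) hoy]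
      refine ⟨fun h' h1 h2 _ => h' h1 h2, fun h' h1 h2 => h' h1 h2 fun h3 => hqo ?_⟩
      rw [hv]; exact h3.symm
  rw [localCoeff_eq, if_congr hagree rfl rfl, surgeryCoeff, if_congr hxy rfl rfl, r.mark_congr k1,
    r.mark_congr k2, (h.lower u).mark_congr a1, (h.lower u).mark_congr a2, hmx, hmy]
  simp only [h.mark_lower]
  split_ifs with h1 h2
  -- After the surgery the corners `0` and `2` of `c'` lie on the loops of `y` and `x`, in exchanged
  -- order. This is harmless for a split since `Δ` is cocommutative, and for a merge since there is
  -- only one loop.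
  · cases r.mark x <;> cases u.mark x <;> cases u.mark y <;> simp [khovanovTable]
  · have h3 : (h.lower u).mark (S.corner c' 0) = (h.lower u).mark (S.corner c' 2) := by
      refine (h.lower u).mark_congr ?_
      rcases hsurg with ⟨-, h4⟩ | ⟨-, h4⟩
      · exact (h4 _ m0 _ m2).2 (Or.inr (Or.inl ⟨hE.refl _, hE.refl _⟩))
      · exact absurd (hxy.1 ((h4 _ m0 _ m2).2 (Or.inr (Or.inl ⟨hEu.refl _, hEu.refl _⟩)))) h2
    rw [(h.lower u).mark_congr a1, (h.lower u).mark_congr a2] at h3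
    rw [← h.mark_lower u y, h3, h.mark_lower]
  · rfl

/-- Only the edge at `c` turns `c` into a `1`-smoothed crossing, and in `Δ(z)` the circle is marked
`v₋` only in the term where the other loop keeps the mark `z`. So exactly one such state occurs in
the boundary of `r`, with coefficient `±1`. -/
theorem edgeCoeff_circle (h : Bigon S S' c c' x o y) (hS : S.Surgical) {r v v₀ : S.EnhancedState}
    (hc : c ∉ r.ones) (hc' : c' ∉ r.ones) (hv₀ : v₀.ones = insert c r.ones)
    (hvo₀ : v₀.mark o = .minus)
    (hm₀ : ∀ q ∈ S.points, ¬ S.SameLoop v₀.ones o q → v₀.mark q = r.mark q)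
    (hcv : c ∈ v.ones) (hvo : v.mark o = .minus) :
    edgeCoeff khovanovTable r v = if v = v₀ then (-1) ^ (r.ones.filter (· < c)).card else 0 := by
  by_cases hv : v.ones = insert c r.ones
  · rw [edgeCoeff_eq h.mem_c hc hv, h.localCoeff_circle hS hc hc' hv hvo]
    by_cases hvv : v = v₀
    · subst hvv
      rw [if_pos hm₀, if_pos rfl, mul_one]
    · rw [if_neg hvv, if_neg, mul_zero]
      exact fun hm => hvv (split_unique hv hv₀ hvo hvo₀ hm hm₀)
  · rw [if_neg, edgeCoeff_eq_zero]
    · intro b _ _ e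
      rcases Finset.mem_insert.1 (e ▸ hcv) with rfl | h'
      · exact hv e
      · exact hc h'
    · rintro rfl
      exact hv hv₀

/-- The Reidemeister II map vanishes on the boundaries of the enhanced states in which `c` and `c'`
are `0`-smoothed. -/
theorem map_d_before (h : Bigon S S' c c' x o y) (hS : S.Surgical) {r : S.EnhancedState}
    (hc : c ∉ r.ones) (hc' : c' ∉ r.ones) :
    reidemeisterTwoMap S S' c c' x o y (S.d r.chain) = 0 := by
  obtain ⟨v₀, hv₀, hvo₀, hm₀⟩ := h.exists_split hS hc hc'
  have hedge := fun {v} => h.edgeCoeff_circle hS hc hc' hv₀ hvo₀ hm₀ (v := v)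
  have hcv₀ : c ∈ v₀.ones := by rw [hv₀]; simp
  have hc'v₀ : c' ∉ v₀.ones := by rw [hv₀]; simp [h.ne.symm, hc']
  ext u
  have hcu : c ∉ (h.lower u).ones := by rw [h.mem_lower_iff u (by simp)]; simpa using h.ne
  have hc'u : c' ∈ (h.lower u).ones := by rw [h.mem_lower_iff u (by simp)]; simp
  -- Only two terms of the boundary can contribute to `u`: `v₀`, through the saddle, and the
  -- lowering of `u`, through the projection. They cancel by the minus sign of the saddle in the
  -- Reidemeister II map, since the edges at the neighbours `c` and `c'` carry the same sign.
  rw [d, map_ofCoeff_chain, Finsupp.finsetSum_apply, Finsupp.zero_apply,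
    Finset.sum_eq_add v₀ (h.lower u)]
  · rw [Finsupp.smul_apply, Finsupp.smul_apply, smul_eq_mul, smul_eq_mul, map_apply,
      h.map_eq_proj hc'u, Removal.proj, ofCoeff_chain_apply, if_pos rfl, hedge hcv₀ hvo₀, if_pos rfl]
    have herase : (v₀.ones.erase c).erase c' = r.ones := by
      rw [hv₀, Finset.erase_insert hc, Finset.erase_eq_of_notMem hc']
    by_cases hu : u.ones = r.ones
    · have hlu : (h.lower u).ones = insert c' r.ones := by
        rw [h.lower_ones, hu, Finset.union_comm, Finset.insert_eq]
      have hfil : r.ones.filter (· < c) = r.ones.filter (· < c') := by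
        refine Finset.filter_congr fun b hb => h.adjacent b ?_
        rw [← hu] at hb
        exact u.ones_subset hb
      rw [edgeCoeff_eq h.mem_c' hc' hlu, h.localCoeff_saddle hS hc hc' hv₀ hm₀ hu, hlu, hv₀,
        sign_insert hc, sign_insert hc', ← hv₀, herase, if_pos hu, hfil,
        if_neg (c := c ∉ v₀.ones ∧ c' ∈ v₀.ones ∧ ∀ p ∈ S.points, v₀.mark p = u.mark p)
          (fun h' => h'.1 hcv₀),
        if_neg (c := max c c' < c) (by simp), if_neg (c := max c c' < c') (by simp)]
      by_cases hA : AgreeOff id {x, y, o} v₀ u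
      · rw [if_pos ⟨hcv₀, hc'v₀, hvo₀, hA⟩, if_pos hA]; ring
      · rw [if_neg (fun h' => hA h'.2.2.2), if_neg hA]; ring
    · rw [herase, if_neg hu, edgeCoeff_eq_zero]
      · ring
      intro b _ _ e
      rcases Finset.mem_insert.1 (e ▸ hc'u) with rfl | h'
      · refine hu ?_
        rw [← h.lower_ones_sdiff u, e]
        ext a
        simp only [Finset.mem_sdiff, Finset.mem_insert, Finset.mem_singleton]
        constructor
        · tauto
        · intro ha
          refine ⟨Or.inr ha, ?_⟩
          rintro (rfl | rfl)
          · exact hc ha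
          · exact hc' ha
      · exact hc' h'
  · rintro rfl; exact hcu hcv₀
  · intro v _ hv
    by_cases hc'v : c' ∈ v.ones
    · rw [h.map_eq_proj hc'v, Removal.proj, Finsupp.smul_apply, ofCoeff_chain_apply, if_neg hv.2,
        smul_zero]
    by_cases hcv : c ∈ v.ones
    · cases hvo : v.mark o with
      | plus => rw [map_eq_zero_of_plus hc'v hvo]; simp
      | minus => rw [hedge hcv hvo, if_neg hv.1, zero_smul]; rfl
    · rw [map_eq_zero (iff_of_false hcv hc'v)]; simp
  · simp
  · simp

/-- Once `c'` is `1`-smoothed it stays so along all edges, and there the Reidemeister II map is the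
projection. For the table of `Φ` this is the commutation used on lifts. -/
theorem map_edge_lower (h : Bigon S S' c c' x o y) (E : EdgeTable) (t : S'.EnhancedState) :
    reidemeisterTwoMap S S' c c' x o y (ofCoeff (edgeCoeff E) (h.lower t).chain) =
      ofCoeff (edgeCoeff E) (reidemeisterTwoMap S S' c c' x o y (h.lower t).chain) := by
  have hc' : c' ∈ (h.lower t).ones := by rw [h.mem_lower_iff t (by simp)]; simp
  rw [h.map_eq_proj hc', ← h.proj_edge h.isSign, map_ofCoeff_chain, map_ofCoeff_chain]
  refine Finset.sum_congr rfl fun v _ => ?_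
  by_cases hv : c' ∈ v.ones
  · rw [h.map_eq_proj hv]
  · rw [edgeCoeff_eq_zero, zero_smul, zero_smul]
    intro b _ _ e
    exact hv (e ▸ Finset.mem_insert_of_mem hc')

/-- The Reidemeister II map is a chain map. -/
theorem map_d (h : Bigon S S' c c' x o y) (hS : S.Surgical) (z : S.Chain) :
    S'.d (reidemeisterTwoMap S S' c c' x o y z) = reidemeisterTwoMap S S' c c' x o y (S.d z) := by
  set ρ := reidemeisterTwoMap S S' c c' x o y with hρ
  suffices h' : S'.d ∘ₗ ρ - ρ ∘ₗ S.d = 0 by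
    exact sub_eq_zero.1 (LinearMap.congr_fun h' z)
  -- The defect of commutation. It vanishes directly on all generators except those with a small
  -- circle marked `v₋`.
  set δ := S'.d ∘ₗ ρ - ρ ∘ₗ S.d with hδ
  have hδ' : ∀ z, δ z = S'.d (ρ z) - ρ (S.d z) := fun z => rfl
  have hsub : ∀ {s v : S.EnhancedState}, edgeCoeff khovanovTable s v ≠ 0 → s.ones ⊆ v.ones := by
    intro s v hsv
    by_contra hn
    refine hsv (edgeCoeff_eq_zero fun b _ _ e => hn ?_)
    rw [e]; exact Finset.subset_insert _ _
  have hsum : ∀ s : S.EnhancedState, (∀ v, edgeCoeff khovanovTable s v ≠ 0 → ρ v.chain = 0) →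
      ρ (S.d s.chain) = 0 := by
    intro s hs
    rw [d, map_ofCoeff_chain]
    refine Finset.sum_eq_zero fun v _ => ?_
    by_cases hv : edgeCoeff khovanovTable s v = 0
    · rw [hv, zero_smul]
    · rw [hs v hv, smul_zero]
  -- the four corners of the cube
  have h00 : ∀ s : S.EnhancedState, c ∉ s.ones → c' ∉ s.ones → δ s.chain = 0 := by
    intro s h1 h2
    rw [hδ', hρ, h.map_d_before hS h1 h2, map_eq_zero (iff_of_false h1 h2), map_zero, sub_zero]
  have h11 : ∀ s : S.EnhancedState, c ∈ s.ones → c' ∈ s.ones → δ s.chain = 0 := by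
    intro s h1 h2
    rw [hδ', hsum, hρ, map_eq_zero (iff_of_true h1 h2), map_zero, sub_zero]
    intro v hv
    exact map_eq_zero (iff_of_true (hsub hv h1) (hsub hv h2))
  have h01 : ∀ s : S.EnhancedState, c ∉ s.ones → c' ∈ s.ones → δ s.chain = 0 := by
    intro s h1 h2
    obtain ⟨t, rfl⟩ := h.exists_lower (s := s) (by
      intro b hb
      rw [Finset.mem_insert, Finset.mem_singleton] at hb
      rcases hb with rfl | rfl
      · simp [h1, h.ne]
      · simp [h2])
    rw [hδ', d, d, hρ, h.map_edge_lower, sub_self]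
  have h10 : ∀ s : S.EnhancedState, c ∈ s.ones → c' ∉ s.ones → s.mark o = .plus →
      δ s.chain = 0 := by
    intro s h1 h2 h3
    rw [hδ', hsum, hρ, map_eq_zero_of_plus h2 h3, map_zero, sub_zero]
    intro v hv
    by_cases hc'v : c' ∈ v.ones
    · exact map_eq_zero (iff_of_true (hsub hv h1) hc'v)
    -- The other crossings do not touch the circle, so the mark `v₊` survives in the boundary.
    · refine map_eq_zero_of_plus hc'v ?_
      by_contra hvo
      refine hv ?_
      by_cases hb : ∃ b ∈ S.crossings, b ∉ s.ones ∧ v.ones = insert b s.ones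
      · obtain ⟨b, hb, hbs, e⟩ := hb
        have hbc : b ∈ S'.crossings := by
          rw [h.crossings, Finset.mem_sdiff, Finset.mem_insert, Finset.mem_singleton]
          refine ⟨hb, ?_⟩
          rintro (rfl | rfl)
          · exact hbs h1
          · exact hc'v (e ▸ Finset.mem_insert_self _ _)
        obtain ⟨k1, k2⟩ := (h.circle s.ones s.ones_subset h1 h2).2.2.2 b hbc
        rw [edgeCoeff_eq hb hbs e, localCoeff_eq, if_neg, mul_zero]
        intro h4
        exact hvo ((h4 o h.mem_o k1 k2).symm.trans h3)
      · push Not at hb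
        exact edgeCoeff_eq_zero hb
  refine chain_ext fun s => ?_
  rw [LinearMap.zero_apply]
  by_cases h1 : c ∈ s.ones <;> by_cases h2 : c' ∈ s.ones
  · exact h11 s h1 h2
  · cases h3 : s.mark o with
    | plus => exact h10 s h1 h2 h3
    -- Up to sign, `s` is the only term of the boundary of a state `r` on which `δ` is not yet known
    -- to vanish. But `δ (d r) = d (ρ (d r)) - ρ (d (d r)) = 0`, since `ρ (d r) = 0`.
    | minus =>
      obtain ⟨r, hr, hm⟩ := h.exists_merge hS h1 h2
      have hcr : c ∉ r.ones := by simp [hr]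
      have hc'r : c' ∉ r.ones := by simp [hr, h2]
      have hs : s.ones = insert c r.ones := by rw [hr, Finset.insert_erase h1]
      have hedge := fun {v} => h.edgeCoeff_circle hS hcr hc'r hs h3 hm (v := v)
      have h4 : δ (S.d r.chain) = 0 := by
        rw [hδ', d_d hS, hρ, h.map_d_before hS hcr hc'r, map_zero, map_zero, sub_zero]
      rw [d, map_ofCoeff_chain, Finset.sum_eq_single s, hedge h1 h3, if_pos rfl] at h4
      · exact (smul_eq_zero.1 h4).resolve_left (pow_ne_zero _ (by norm_num))
      · intro v _ hvs
        by_cases hcv : c ∈ v.ones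
        · by_cases hc'v : c' ∈ v.ones
          · rw [h11 v hcv hc'v, smul_zero]
          · cases hvo : v.mark o with
            | plus => rw [h10 v hcv hc'v hvo, smul_zero]
            | minus => rw [hedge hcv hvo, if_neg hvs, zero_smul]
        · by_cases hc'v : c' ∈ v.ones
          · rw [h01 v hcv hc'v, smul_zero]
          · rw [h00 v hcv hc'v, smul_zero]
      · simp
  · exact h01 s h1 h2
  · exact h00 s h1 h2

end Bigon

end Pattern

/-! ### Diagrams realise these removals and bigons. -/

namespace Diagram

/-- Smoothing the crossings in `K` so that the strands run vertically. -/
theorem removal {D D' : Diagram} (hlen : D'.len = D.len) (hlevel : D'.level = D.level)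
    {K K₁ : Finset ℕ} (h₁ : K₁ ⊆ K) (hK : ∀ k ∉ K, D'.slice k = D.slice k)
    (hK' : ∀ k ∈ K, k < D.len ∧ D'.slice k = .straight ∧
      ∃ i b, D.slice k = .cross i b ∧ (b = true ↔ k ∉ K₁)) :
    Pattern.Removal D.pattern D'.pattern K K₁ := by
  have hcr : D'.pattern.crossings = D.pattern.crossings \ K := by
    ext k
    simp only [pattern, Finset.mem_filter, Finset.mem_range, Finset.mem_sdiff, hlen]
    by_cases hk : k ∈ K
    · simp [hk, (hK' k hk).2.1, Slice.IsCrossing]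
    · simp [hk, hK k hk]
  have hnot : ∀ o ⊆ D'.pattern.crossings, ∀ k ∈ K, k ∉ o := fun o ho k hk hko =>
    (Finset.mem_sdiff.1 (hcr ▸ ho hko)).2 hk
  refine ⟨?_, hcr, ?_, h₁, ?_, ?_⟩
  · simp only [pattern, hlen, hlevel]
  · intro k hk
    obtain ⟨h2, -, i, b, h3, -⟩ := hK' k hk
    exact Finset.mem_filter.2 ⟨Finset.mem_range.2 h2, by rw [h3]; trivial⟩
  · intro k hk
    have : k ∉ K := (Finset.mem_sdiff.1 (hcr ▸ hk)).2
    simp only [pattern, hK k this]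
  · intro o ho p q
    rw [sameLoop_iff, sameLoop_iff, hlen]
    suffices h : D'.smoothed o = D.smoothed (o ∪ K₁) by rw [h]
    funext k
    unfold smoothed
    by_cases hk : k ∈ K
    · obtain ⟨-, h2, i, b, h3, h4⟩ := hK' k hk
      rw [h2, h3]
      simp only [Slice.smooth, Finset.mem_union, hnot o ho k hk, false_or, h4]
      rw [if_neg (by tauto)]
    · have : k ∉ K₁ := fun h' => hk (h₁ h')
      rw [hK k hk]
      simp [this]

theorem smoothed_cross {D : Diagram} {k a : ℕ} {b : Bool} (h : D.slice k = .cross a b)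
    (w : Finset ℕ) : D.smoothed w k = if k ∈ w ↔ b = true then .hook a else .straight := by
  rw [smoothed, h]
  simp only [Slice.smooth]
  congr

section bigon
variable {D : Diagram} {k₁ k₂ a : ℕ} {w : Finset ℕ}

theorem sameLoop_of_straight {k : ℕ} (hk : k < D.len) (h : D.smoothed w k = .straight) (m : ℕ) :
    D.pattern.SameLoop w (k, m) (k + 1, m) := by
  rw [sameLoop_iff]
  exact .rel _ _ ⟨k, hk, by rw [h]; exact ⟨m, rfl, rfl⟩⟩

theorem sameLoop_of_hook {k : ℕ} (hk : k < D.len) (h : D.smoothed w k = .hook a) :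
    D.pattern.SameLoop w (k, a) (k, a + 1) ∧ D.pattern.SameLoop w (k + 1, a) (k + 1, a + 1) := by
  rw [sameLoop_iff, sameLoop_iff]
  exact ⟨.rel _ _ ⟨k, hk, by rw [h]; exact Or.inr (Or.inl ⟨rfl, rfl⟩)⟩,
    .rel _ _ ⟨k, hk, by rw [h]; exact Or.inr (Or.inr ⟨rfl, rfl⟩)⟩⟩

theorem sameLoop_column (m : ℕ) {k l : ℕ} (hkl : k ≤ l) (hl : l ≤ D.len)
    (h : ∀ j, k ≤ j → j < l → D.smoothed w j = .straight) :
    D.pattern.SameLoop w (k, m) (l, m) := by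
  induction l, hkl using Nat.le_induction with
  | base => exact Pattern.SameLoop.refl _ _ _
  | succ l hkl ih =>
    exact (ih (by omega) fun j h1 h2 => h j h1 (by omega)).trans
      (sameLoop_of_straight (by omega) (h l hkl (by omega)) m)

/-- The small circle between two hooks. -/
theorem mem_circle (h : k₁ < k₂) (h₁ : D.smoothed w k₁ = .hook a) (h₂ : D.smoothed w k₂ = .hook a)
    (hb : ∀ k, k₁ < k → k < k₂ → D.smoothed w k = .straight) {q : ℕ × ℕ}
    (hq : D.pattern.SameLoop w (k₁ + 1, a) q) :
    k₁ < q.1 ∧ q.1 ≤ k₂ ∧ (q.2 = a ∨ q.2 = a + 1) := by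
  rw [sameLoop_iff] at hq
  have key : ∀ p q, Relation.EqvGen (Smoothed.Arc D.len (D.smoothed w)) p q →
      ((k₁ < p.1 ∧ p.1 ≤ k₂ ∧ (p.2 = a ∨ p.2 = a + 1)) ↔
        (k₁ < q.1 ∧ q.1 ≤ k₂ ∧ (q.2 = a ∨ q.2 = a + 1))) := by
    intro p q
    refine eqvGen_le (R := fun p q : ℕ × ℕ => (k₁ < p.1 ∧ p.1 ≤ k₂ ∧ (p.2 = a ∨ p.2 = a + 1)) ↔
        (k₁ < q.1 ∧ q.1 ≤ k₂ ∧ (q.2 = a ∨ q.2 = a + 1)))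
        ⟨fun _ => Iff.rfl, Iff.symm, Iff.trans⟩ ?_
    rintro p q ⟨k, hk, hpq⟩
    by_cases e1 : k = k₁
    · subst e1
      rw [h₁] at hpq
      rcases hpq with ⟨j, h3, h4, rfl, rfl⟩ | ⟨rfl, rfl⟩ | ⟨rfl, rfl⟩ <;> dsimp only <;> omega
    by_cases e2 : k = k₂
    · subst e2
      rw [h₂] at hpq
      rcases hpq with ⟨j, h3, h4, rfl, rfl⟩ | ⟨rfl, rfl⟩ | ⟨rfl, rfl⟩ <;> dsimp only <;> omega
    by_cases e3 : k₁ < k ∧ k < k₂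
    · rw [hb k e3.1 e3.2] at hpq
      obtain ⟨j, rfl, rfl⟩ := hpq
      simp only; omega
    · rcases Smoothed.join_spec ((D.stack w).fits k hk) hpq with ⟨i, j, rfl, rfl, -⟩ |
        ⟨i, j, rfl, rfl, -⟩ | ⟨i, j, rfl, rfl, -⟩ <;> simp only <;> omega
  exact (key _ _ hq).1 ⟨by simp, h, Or.inl rfl⟩

/-- Two adjacent crossings `τ`, `τ⁻¹` and the diagram without them. -/
theorem bigon {D' : Diagram} (hlen : D'.len = D.len) (hlevel : D'.level = D.level) {b : Bool}
    {c c' : ℕ} (hb : (b = true ∧ c = k₁ ∧ c' = k₂) ∨ (b = false ∧ c = k₂ ∧ c' = k₁))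
    (h : k₁ < k₂) (hk₂ : k₂ < D.len) (hs₁ : D.slice k₁ = .cross a b)
    (hs₂ : D.slice k₂ = .cross a (!b)) (hs : ∀ k, k₁ < k → k < k₂ → D.slice k = .straight)
    (hs' : ∀ k, k ≠ k₁ → k ≠ k₂ → D'.slice k = D.slice k) (hs₁' : D'.slice k₁ = .straight)
    (hs₂' : D'.slice k₂ = .straight) :
    Pattern.Bigon D.pattern D'.pattern c c' (k₁, a) (k₁ + 1, a) (k₂ + 1, a + 1) := by
  have hk₁ : k₁ < D.len := by omega
  have hrem : Pattern.Removal D.pattern D'.pattern {c, c'} {c'} := by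
    refine removal hlen hlevel (by simp) ?_ ?_
    · intro k hk
      rw [Finset.mem_insert, Finset.mem_singleton, not_or] at hk
      refine hs' k ?_ ?_ <;> rcases hb with ⟨-, rfl, rfl⟩ | ⟨-, rfl, rfl⟩ <;> tauto
    · intro k hk
      rw [Finset.mem_insert, Finset.mem_singleton] at hk
      rcases hb with ⟨rfl, rfl, rfl⟩ | ⟨rfl, rfl, rfl⟩ <;> rcases hk with rfl | rfl
      · exact ⟨hk₁, hs₁', _, _, hs₁, by simp [h.ne]⟩
      · exact ⟨hk₂, hs₂', _, _, hs₂, by simp⟩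
      · exact ⟨hk₂, hs₂', _, _, hs₂, by simp [h.ne']⟩
      · exact ⟨hk₁, hs₁', _, _, hs₁, by simp⟩
  have hbetween : ∀ w k, k₁ < k → k < k₂ → D.smoothed w k = .straight := by
    intro w k h1 h2
    rw [smoothed, hs k h1 h2]; rfl
  have hout : ∀ k ∈ D'.pattern.crossings, k < k₁ ∨ k₂ < k := by
    intro k hk
    have hk' := hk
    rw [hrem.crossings, Finset.mem_sdiff, Finset.mem_insert, Finset.mem_singleton] at hk
    by_contra hn
    have hne : k ≠ k₁ ∧ k ≠ k₂ := by
      rcases hb with ⟨-, rfl, rfl⟩ | ⟨-, rfl, rfl⟩ <;> tauto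
    obtain ⟨-, i, b', e⟩ := D.exists_cross hk.1
    rw [hs k (by omega) (by omega)] at e
    exact Slice.noConfusion e
  have hS := D.surgical
  have m1 : (k₁, a) ∈ D.pattern.points ∧ (k₁ + 1, a) ∈ D.pattern.points ∧
      (k₂ + 1, a + 1) ∈ D.pattern.points := by
    have c1 : k₁ ∈ D.pattern.crossings :=
      Finset.mem_filter.2 ⟨Finset.mem_range.2 hk₁, by rw [hs₁]; trivial⟩
    have c2 : k₂ ∈ D.pattern.crossings :=
      Finset.mem_filter.2 ⟨Finset.mem_range.2 hk₂, by rw [hs₂]; trivial⟩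
    have e1 := hS.corner_mem _ c1
    have e2 := hS.corner_mem _ c2
    rw [D.corner_of_cross hs₁] at e1
    rw [D.corner_of_cross hs₂] at e2
    cases b
    · exact ⟨e1 1, e1 2, e2 2⟩
    · exact ⟨e1 0, e1 1, e2 3⟩
  have hcol : ∀ w m, D.pattern.SameLoop w (k₁ + 1, m) (k₂, m) := fun w m =>
    sameLoop_column m h (by omega) fun j h1 h2 => hbetween w j (by omega) h2
  refine { hrem with
    ne := by rcases hb with ⟨-, rfl, rfl⟩ | ⟨-, rfl, rfl⟩ <;> omega
    adjacent := fun k hk => by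
      have := hout k hk
      rcases hb with ⟨-, rfl, rfl⟩ | ⟨-, rfl, rfl⟩ <;> omega
    mem_x := m1.1
    mem_y := m1.2.2
    mem_o := m1.2.1
    circle := ?_
    before := ?_
    after := ?_ }
  · intro w _ hc hc'
    have g₁ : D.smoothed w k₁ = .hook a := by
      rw [smoothed_cross hs₁, if_pos]
      rcases hb with ⟨rfl, rfl, rfl⟩ | ⟨rfl, rfl, rfl⟩ <;> simp [hc, hc']
    have g₂ : D.smoothed w k₂ = .hook a := by
      rw [smoothed_cross hs₂, if_pos]
      rcases hb with ⟨rfl, rfl, rfl⟩ | ⟨rfl, rfl, rfl⟩ <;> simp [hc, hc']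
    have hcirc := fun {q} => mem_circle h g₁ g₂ (hbetween w) (q := q)
    refine ⟨fun h' => by simpa using hcirc h', fun h' => by simpa using hcirc h', ?_, ?_⟩
    · rcases hb with ⟨rfl, rfl, rfl⟩ | ⟨rfl, rfl, rfl⟩
      · rw [D.corner_of_cross hs₁]
        refine iff_of_false (fun h' => by simpa [Slice.corner] using hcirc h') (not_not.2 ?_)
        exact (sameLoop_of_hook hk₁ g₁).2
      · rw [D.corner_of_cross hs₂]
        refine iff_of_true (hcol w a) fun h' => by simpa [Slice.corner] using hcirc h'
    · intro k hk
      have hk' := hout k hk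
      have hk2 : k ∈ D.pattern.crossings := by
        rw [hrem.crossings] at hk; exact (Finset.mem_sdiff.1 hk).1
      obtain ⟨-, i, b', e⟩ := D.exists_cross hk2
      rw [D.corner_of_cross e]
      constructor <;> intro h' <;> have := hcirc h' <;> cases b' <;>
        simp [Slice.corner] at this <;> omega
  · intro w _ hc hc'
    have hE := D.pattern.sameLoop_equivalence w
    have hsymm := @hE.symm
    have htrans := @hE.trans
    have ha := hcol w a
    have ha' := hcol w (a + 1)
    rcases hb with ⟨rfl, rfl, rfl⟩ | ⟨rfl, rfl, rfl⟩
    · have g₁ := sameLoop_of_straight hk₁ (w := w) (by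
        rw [smoothed_cross hs₁, if_neg (by simp [hc])])
      obtain ⟨g₂, g₃⟩ := sameLoop_of_hook hk₂ (w := w) (a := a) (by
        rw [smoothed_cross hs₂, if_pos (by simp [hc'])])
      have g1a := g₁ a
      have g1b := g₁ (a + 1)
      clear g₁
      rw [D.corner_of_cross hs₁, D.corner_of_cross hs₂]
      refine ⟨hsymm g1a, htrans ha (htrans g₂ (hsymm ha')),
        htrans (hsymm g₂) (htrans (hsymm ha) (hsymm g1a)), g₃, Or.inl (hsymm g1a)⟩
    · have g₁ := sameLoop_of_straight hk₂ (w := w) (by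
        rw [smoothed_cross hs₂, if_neg (by simp [hc])])
      obtain ⟨g₂, g₃⟩ := sameLoop_of_hook hk₁ (w := w) (a := a) (by
        rw [smoothed_cross hs₁, if_pos (by simp [hc'])])
      have g1b := g₁ (a + 1)
      have hoy := htrans g₃ (htrans ha' g1b)
      rw [D.corner_of_cross hs₁, D.corner_of_cross hs₂]
      exact ⟨ha, hoy, hsymm g₂, hoy, Or.inr hoy⟩
  · intro w _ hc hc'
    have hE := D.pattern.sameLoop_equivalence w
    have hsymm := @hE.symm
    have htrans := @hE.trans
    have ha := hcol w a
    have ha' := hcol w (a + 1)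
    have g₁ := sameLoop_of_straight hk₁ (w := w) (by
      rw [smoothed_cross hs₁, if_neg]
      rcases hb with ⟨rfl, rfl, rfl⟩ | ⟨rfl, rfl, rfl⟩ <;> simp [hc, hc'])
    have g₂ := sameLoop_of_straight hk₂ (w := w) (by
      rw [smoothed_cross hs₂, if_neg]
      rcases hb with ⟨rfl, rfl, rfl⟩ | ⟨rfl, rfl, rfl⟩ <;> simp [hc, hc'])
    rcases hb with ⟨rfl, rfl, rfl⟩ | ⟨rfl, rfl, rfl⟩
    · rw [D.corner_of_cross hs₂]
      exact ⟨g₂ (a + 1), hsymm (htrans (g₁ a) (htrans ha (g₂ a)))⟩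
    · rw [D.corner_of_cross hs₁]
      exact ⟨htrans (g₁ (a + 1)) (htrans ha' (g₂ (a + 1))), hsymm (g₁ a)⟩

end bigon

end Diagram

/-! ### Braid words in the box and their lifts. -/

namespace BoxExterior
variable {n height : ℕ} (X : BoxExterior n height)

theorem fill_slice_box {w : BraidWord n} {j : ℕ} (hj : j < height) {g : Option (Letter n)}
    (hg : w[j]? = some g) : (X.fill w).slice (X.base + j) = letterSlice X.left.length g := by
  have : X.base ≤ X.base + j ∧ X.base + j < X.base + height := by omega
  simp only [fill, if_pos this]
  rw [Nat.add_sub_cancel_left, List.getD_eq_getElem?_getD, hg, Option.getD_some]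

theorem fill_slice_congr {w w' : BraidWord n} {k : ℕ}
    (h : ∀ j, k = X.base + j → w'[j]? = w[j]?) : (X.fill w').slice k = (X.fill w).slice k := by
  simp only [fill]
  split_ifs with hk
  · rw [List.getD_eq_getElem?_getD, List.getD_eq_getElem?_getD, h _ (by omega)]
  · rfl

/-- The positions of the inverse generators in the braid word. -/
def negatives (w : BraidWord n) : Finset ℕ :=
  ((Finset.range height).filter fun j => ∃ i, w[j]? = some (some (i, false))).image (X.base + ·)

theorem mem_negatives {w : BraidWord n} (hw : w.length = height) {k : ℕ} :
    k ∈ X.negatives w ↔ ∃ j i, k = X.base + j ∧ w[j]? = some (some (i, false)) := by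
  simp only [negatives, Finset.mem_image, Finset.mem_filter, Finset.mem_range]
  constructor
  · rintro ⟨j, ⟨-, i, h⟩, rfl⟩
    exact ⟨j, i, rfl, h⟩
  · rintro ⟨j, i, rfl, h⟩
    exact ⟨j, ⟨hw ▸ (List.getElem?_eq_some_iff.1 h).1, i, h⟩, rfl⟩

theorem isLift_iff {w : BraidWord n} {s : X.trivialPattern.EnhancedState}
    {s' : (X.braidPattern w).EnhancedState} :
    X.IsLift w s s' ↔ s'.ones = s.ones ∪ X.negatives w ∧ s'.plus = s.plus := Iff.rfl

/-- The positions of the generators and their inverses in the braid word. -/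
def letters (w : BraidWord n) : Finset ℕ :=
  ((Finset.range height).filter fun j => ∃ g, w[j]? = some (some g)).image (X.base + ·)

theorem mem_letters {w : BraidWord n} (hw : w.length = height) {k : ℕ} :
    k ∈ X.letters w ↔ ∃ j g, k = X.base + j ∧ w[j]? = some (some g) := by
  simp only [letters, Finset.mem_image, Finset.mem_filter, Finset.mem_range]
  constructor
  · rintro ⟨j, ⟨-, g, h⟩, rfl⟩
    exact ⟨j, g, rfl, h⟩
  · rintro ⟨j, g, rfl, h⟩
    exact ⟨j, ⟨hw ▸ (List.getElem?_eq_some_iff.1 h).1, g, h⟩, rfl⟩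

/-- The smoothing in the lift makes every braid crossing vertical, so the loops are those of the
diagram with the trivial braid. The lowering along this removal is the lift itself. -/
theorem removal_trivial {w : BraidWord n} (hw : w.length = height) :
    Pattern.Removal (X.braidPattern w) X.trivialPattern (X.letters w) (X.negatives w) := by
  refine Diagram.removal (D := X.fill w) (D' := X.fill (List.replicate height none)) rfl rfl
    ?_ ?_ ?_
  · intro k hk
    obtain ⟨j, i, rfl, h⟩ := (X.mem_negatives hw).1 hk
    exact (X.mem_letters hw).2 ⟨j, _, rfl, h⟩
  · intro k hk
    simp only [fill]
    split_ifs with h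
    · have hj : k - X.base < w.length := by omega
      have hg : w[k - X.base]? = some none := by
        rw [List.getElem?_eq_getElem hj]
        cases hg : w[k - X.base] with
        | none => rfl
        | some g =>
          refine absurd ((X.mem_letters hw).2 ⟨k - X.base, g, by omega, ?_⟩) hk
          rw [List.getElem?_eq_getElem hj, hg]
      rw [List.getD_eq_getElem?_getD, List.getD_eq_getElem?_getD, hg, List.getElem?_replicate]
      split_ifs <;> rfl
    · rfl
  · intro k hk
    obtain ⟨j, ⟨i, b⟩, rfl, h⟩ := (X.mem_letters hw).1 hk
    have hj : j < height := hw ▸ (List.getElem?_eq_some_iff.1 h).1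
    refine ⟨?_, ?_, _, _, X.fill_slice_box hj h, ?_⟩
    · have := X.base_le
      change X.base + j < X.len
      omega
    · exact X.fill_slice_box hj (g := none) (by rw [List.getElem?_replicate, if_pos hj])
    · rw [X.mem_negatives hw]
      constructor
      · rintro rfl ⟨j', i', e, h'⟩
        obtain rfl : j = j' := by omega
        rw [h] at h'
        simp at h'
      · intro h'
        by_contra hb
        refine h' ⟨j, i, rfl, ?_⟩
        rw [h, Bool.eq_false_of_not_eq_true hb]

theorem removal_set {w : BraidWord n} (hw : w.length = height) {j : ℕ} {i : Fin (n - 1)}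
    (hj : w[j]? = some (some (i, true))) :
    Pattern.Removal (X.braidPattern w) (X.braidPattern (w.set j none)) {X.base + j} ∅ := by
  have hj' : j < height := hw ▸ (List.getElem?_eq_some_iff.1 hj).1
  refine Diagram.removal (D := X.fill w) (D' := X.fill (w.set j none)) rfl rfl
    (Finset.empty_subset _) ?_ ?_
  · intro k hk
    refine X.fill_slice_congr fun m hm => List.getElem?_set_ne ?_
    rintro rfl
    exact hk (Finset.mem_singleton.2 hm)
  · intro k hk
    obtain rfl := Finset.mem_singleton.1 hk
    refine ⟨?_, ?_, _, _, X.fill_slice_box hj' hj, by simp⟩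
    · have := X.base_le
      change X.base + j < X.len
      omega
    · exact X.fill_slice_box hj' (g := none) (List.getElem?_set_self (by omega))

theorem bigon_set {w : BraidWord n} (hw : w.length = height) {j j' c c' : ℕ} {i : Fin (n - 1)}
    {b : Bool} (hb : (b = true ∧ c = X.base + j ∧ c' = X.base + j') ∨
      (b = false ∧ c = X.base + j' ∧ c' = X.base + j)) (hjj : j < j')
    (hj : w[j]? = some (some (i, b))) (hj' : w[j']? = some (some (i, !b)))
    (hm : ∀ m, j < m → m < j' → w[m]? = some none) :
    Pattern.Bigon (X.braidPattern w) (X.braidPattern ((w.set j none).set j' none)) c c'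
      (X.point j i) (X.point (j + 1) i) (X.point (j' + 1) (i + 1)) := by
  have h1 : j < height := hw ▸ (List.getElem?_eq_some_iff.1 hj).1
  have h2 : j' < height := hw ▸ (List.getElem?_eq_some_iff.1 hj').1
  have := X.base_le
  refine Diagram.bigon (D := X.fill w) (D' := X.fill ((w.set j none).set j' none))
    (k₁ := X.base + j) (k₂ := X.base + j') (a := X.left.length + i) rfl rfl hb (by omega)
    (by change X.base + j' < X.len; omega) (X.fill_slice_box h1 hj) (X.fill_slice_box h2 hj')
    ?_ ?_ ?_ ?_
  · intro k k1 k2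
    obtain ⟨m, rfl⟩ := Nat.exists_eq_add_of_le (show X.base ≤ k by omega)
    exact X.fill_slice_box (by omega) (hm m (by omega) (by omega))
  · intro k k1 k2
    refine X.fill_slice_congr fun m hm => ?_
    rw [List.getElem?_set_ne (by omega), List.getElem?_set_ne (by omega)]
  · refine X.fill_slice_box (g := none) h1 ?_
    rw [List.getElem?_set_ne (by omega), List.getElem?_set_self (by omega)]
  · refine X.fill_slice_box (g := none) h2 (List.getElem?_set_self (by simp; omega))

/-- A removal of crossings which is compatible with the braid words takes lifts to lifts. -/
theorem exists_lift_lower {w w' : BraidWord n} (hw' : w'.length = height)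
    {K K₁ : Finset ℕ} (h : Pattern.Removal (X.braidPattern w) (X.braidPattern w') K K₁)
    (hK : ∀ k ∈ K, ∃ j < height, k = X.base + j)
    (hneg : X.negatives w = X.negatives w' ∪ K₁) {s : X.trivialPattern.EnhancedState}
    {s' : (X.braidPattern w).EnhancedState} (hs : X.IsLift w s s') :
    ∃ t, s' = h.lower t ∧ X.IsLift w' s t := by
  obtain ⟨h1, h2⟩ := X.isLift_iff.1 hs
  have hsK : ∀ k ∈ K, k ∉ s.ones := by
    intro k hk hks
    obtain ⟨j, hj, rfl⟩ := hK k hk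
    obtain ⟨-, i, b, e⟩ := Diagram.exists_cross _ (s.ones_subset hks)
    rw [X.fill_slice_box hj (g := none) (by rw [List.getElem?_replicate, if_pos hj])] at e
    exact Slice.noConfusion e
  have hnegK : ∀ k ∈ K, k ∉ X.negatives w' := by
    intro k hk hkn
    obtain ⟨j, hj, rfl⟩ := hK k hk
    obtain ⟨j', i, e, hl⟩ := (X.mem_negatives hw').1 hkn
    obtain rfl : j = j' := by omega
    have hcr : X.base + j ∈ (X.braidPattern w').crossings := by
      refine Finset.mem_filter.2 ⟨Finset.mem_range.2 ?_, ?_⟩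
      · have := X.base_le
        change X.base + j < X.len
        omega
      · rw [X.fill_slice_box hj hl]; trivial
    rw [h.crossings] at hcr
    exact (Finset.mem_sdiff.1 hcr).2 hk
  have hones : s'.ones = s.ones ∪ X.negatives w' ∪ K₁ := by
    rw [h1, hneg, Finset.union_assoc]
  obtain ⟨t, ht⟩ := h.exists_lower (s := s') (by
    intro k hk
    rw [hones, Finset.mem_union, Finset.mem_union]
    have := hsK k hk
    have := hnegK k hk
    tauto)
  refine ⟨t, ht, X.isLift_iff.2 ⟨?_, ?_⟩⟩
  · rw [← h.lower_ones_sdiff t, ← ht, hones]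
    ext k
    simp only [Finset.mem_sdiff, Finset.mem_union]
    have := hsK k
    have := hnegK k
    have := @h.subset₁ k
    tauto
  · rw [← h2, ht]; rfl

end BoxExterior

/-! ### The lift is a cycle; induction over the moves. -/

namespace BoxExterior
variable {n height : ℕ} (X : BoxExterior n height)

theorem isLift_lower {w : BraidWord n} (hw : w.length = height)
    (s : X.trivialPattern.EnhancedState) : X.IsLift w s ((X.removal_trivial hw).lower s) :=
  ⟨rfl, rfl⟩

/-- The lift of a state cycle is a state cycle. -/
theorem isStateCycle_lower {w : BraidWord n} (hw : w.length = height)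
    {s : X.trivialPattern.EnhancedState} (hs : s.IsStateCycle) (hp : X.BraidParallel s) :
    ((X.removal_trivial hw).lower s).IsStateCycle := by
  set h := X.removal_trivial hw
  have hz : ∀ v, Pattern.edgeCoeff khovanovTable s v = 0 := by
    intro v
    have := DFunLike.congr_fun (show X.trivialPattern.d s.chain = 0 from hs) v
    rwa [Pattern.d, Pattern.ofCoeff_chain_apply] at this
  change (X.braidPattern w).d _ = 0
  ext u
  rw [Pattern.d, Pattern.ofCoeff_chain_apply, Finsupp.zero_apply]
  by_cases hb : ∃ b ∈ (X.braidPattern w).crossings, b ∉ (h.lower s).ones ∧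
      u.ones = insert b (h.lower s).ones
  swap
  · push Not at hb
    exact Pattern.edgeCoeff_eq_zero hb
  obtain ⟨b, hb, hbs, hu⟩ := hb
  rw [Pattern.edgeCoeff_eq hb hbs hu]
  -- At a crossing of the braid the edge starts from a `0`-smoothing, so the crossing is positive
  -- and its strands run vertically. Braid-parallelism puts them on distinct loops marked `v₋`, and
  -- `v₋ ⊗ v₋ ↦ 0`.
  by_cases hbK : b ∈ X.letters w
  · obtain ⟨j, ⟨i, e⟩, rfl, hl⟩ := (X.mem_letters hw).1 hbK
    have hj : j < height := hw ▸ (List.getElem?_eq_some_iff.1 hl).1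
    have he : e = true := by
      by_contra he
      refine hbs (Finset.mem_union_right _ ((X.mem_negatives hw).2 ⟨j, i, rfl, ?_⟩))
      rw [hl, Bool.eq_false_of_not_eq_true he]
    subst he
    have hcorner := Diagram.corner_of_cross _ (X.fill_slice_box hj hl)
    have hcol : ∀ m l, l ≤ height → X.trivialPattern.SameLoop s.ones (X.point 0 m)
        (X.base + l, X.left.length + m) := by
      intro m l hl
      refine Diagram.sameLoop_column _ (by omega) ?_ ?_
      · have := X.base_le
        change X.base + l ≤ X.len
        omega
      · intro k h1 h2
        obtain ⟨a, rfl⟩ := Nat.exists_eq_add_of_le (show X.base ≤ k by omega)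
        rw [Diagram.smoothed, X.fill_slice_box (show a < height by omega) (g := none)
          (by rw [List.getElem?_replicate, if_pos (by omega)])]
        rfl
    have hi := i.2
    have c0 := hcol i j hj.le
    have c2 := hcol (i + 1) (j + 1) hj
    have m0 : s.mark (X.base + j, X.left.length + i) = .minus := by
      rw [← s.mark_congr c0]; exact hp.2 i (by omega)
    have m2 : s.mark (X.base + (j + 1), X.left.length + (i + 1)) = .minus := by
      rw [← s.mark_congr c2]; exact hp.2 (i + 1) (by omega)
    have hne : ¬ X.trivialPattern.SameLoop s.ones (X.base + j, X.left.length + i)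
        (X.base + (j + 1), X.left.length + (i + 1)) := fun h' =>
      hp.1 i (by omega) (i + 1) (by omega) (by omega) ((c0.trans h').trans c2.symm)
    rw [Pattern.localCoeff_eq, hcorner]
    rw [h.sameLoop _ s.ones_subset] at hne
    have e0 : (Slice.cross (X.left.length + i) true).corner (X.base + j) 0 =
      (X.base + j, X.left.length + i) := rfl
    have e2 : (Slice.cross (X.left.length + i) true).corner (X.base + j) 2 =
      (X.base + (j + 1), X.left.length + (i + 1)) := rfl
    rw [e0, e2, h.mark_lower, h.mark_lower, m0, m2]
    split_ifs with h1 h2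
    · exact absurd h2 hne
    · simp [khovanovTable]
    · simp
  -- At a crossing of `D` the target is again a lowered state, so the coefficient is, up to sign, an
  -- entry of the zero chain `d s`.
  · obtain ⟨v, rfl⟩ := h.exists_lower (s := u) (by
      intro k hk
      rw [hu, Finset.mem_insert, h.mem_lower_iff s hk]
      have : k ≠ b := by rintro rfl; exact hbK hk
      tauto)
    have hbT : b ∈ X.trivialPattern.crossings := by
      rw [h.crossings]; exact Finset.mem_sdiff.2 ⟨hb, hbK⟩
    have hbs' : b ∉ s.ones := fun h' => hbs (Finset.mem_union_left _ h')
    have hv : v.ones = insert b s.ones := by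
      rw [← h.lower_ones_sdiff v, hu, Finset.insert_sdiff_of_notMem _ hbK, h.lower_ones_sdiff]
    have := hz v
    rw [Pattern.edgeCoeff_eq hbT hbs' hv] at this
    rw [h.localCoeff_lower _ hbT, (mul_eq_zero.1 this).resolve_left
      (pow_ne_zero _ (by norm_num)), mul_zero]

/-- What the induction over the moves shows about a Jacobsson map. -/
structure Good (w : BraidWord n) (Ψ : (X.braidPattern w).Chain →ₗ[ℚ] X.trivialPattern.Chain) :
    Prop where
  length_eq : w.length = height
  comm : ∀ z, X.trivialPattern.d (Ψ z) = Ψ ((X.braidPattern w).d z)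
  -- Commutation with `Φ` is recorded on lifts only.
  lift : ∀ s s', X.IsLift w s s' → ∃ ε : ℤˣ, Ψ s'.chain = ((ε : ℤ) : ℚ) • s.chain ∧
    Ψ ((X.braidPattern w).lee s'.chain) = X.trivialPattern.lee (Ψ s'.chain)

variable {X}

/-- The inductive step shared by both kinds of moves: a lift goes to `±` a lift for the shorter
word, the signs multiply, and commutation with `Φ` is passed on from lift to lift. -/
theorem Good.comp {w w' : BraidWord n} {Ψ : (X.braidPattern w').Chain →ₗ[ℚ] X.trivialPattern.Chain}
    (hΨ : X.Good w' Ψ) (hw : w.length = height) {K K₁ : Finset ℕ}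
    (h : Pattern.Removal (X.braidPattern w) (X.braidPattern w') K K₁)
    (hK : ∀ k ∈ K, ∃ j < height, k = X.base + j)
    (hneg : X.negatives w = X.negatives w' ∪ K₁)
    (ρ : (X.braidPattern w).Chain →ₗ[ℚ] (X.braidPattern w').Chain)
    (hd : ∀ z, (X.braidPattern w').d (ρ z) = ρ ((X.braidPattern w).d z))
    (hρ : ∀ t, ∃ ε : ℤˣ, ρ (h.lower t).chain = ((ε : ℤ) : ℚ) • t.chain)
    (hlee : ∀ t, ρ ((X.braidPattern w).lee (h.lower t).chain) =
      (X.braidPattern w').lee (ρ (h.lower t).chain)) : X.Good w (Ψ ∘ₗ ρ) where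
  length_eq := hw
  comm z := by rw [LinearMap.comp_apply, LinearMap.comp_apply, hΨ.comm, hd]
  lift s s' hs := by
    obtain ⟨t, rfl, ht⟩ := X.exists_lift_lower hΨ.length_eq h hK hneg hs
    obtain ⟨ε, h1⟩ := hρ t
    obtain ⟨ε', h2, h3⟩ := hΨ.lift s t ht
    refine ⟨ε * ε', ?_, ?_⟩
    · rw [LinearMap.comp_apply, h1, map_smul, h2, smul_smul]
      push_cast
      rfl
    · rw [LinearMap.comp_apply, LinearMap.comp_apply, hlee, h1, map_smul, map_smul, map_smul, h3,
        map_smul]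

theorem exists_unit_neg_one_pow (k : ℕ) : ∃ ε : ℤˣ, (-1 : ℚ) ^ k = ((ε : ℤ) : ℚ) :=
  ⟨(-1) ^ k, by simp⟩

theorem Good.comp_bigon {w : BraidWord n} {j j' c c' : ℕ}
    {Ψ : (X.braidPattern ((w.set j none).set j' none)).Chain →ₗ[ℚ] X.trivialPattern.Chain}
    (hΨ : X.Good ((w.set j none).set j' none) Ψ) {i : Fin (n - 1)} {b : Bool}
    (hb : (b = true ∧ c = X.base + j ∧ c' = X.base + j') ∨
      (b = false ∧ c = X.base + j' ∧ c' = X.base + j)) (hjj : j < j')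
    (hj : w[j]? = some (some (i, b))) (hj' : w[j']? = some (some (i, !b)))
    (hm : ∀ m, j < m → m < j' → w[m]? = some none) :
    X.Good w (Ψ ∘ₗ Pattern.reidemeisterTwoMap (X.braidPattern w)
      (X.braidPattern ((w.set j none).set j' none)) c c'
      (X.point j i) (X.point (j + 1) i) (X.point (j' + 1) (i + 1))) := by
  have hw : w.length = height := by simpa using hΨ.length_eq
  have h1 : j < height := hw ▸ (List.getElem?_eq_some_iff.1 hj).1
  have h2 : j' < height := hw ▸ (List.getElem?_eq_some_iff.1 hj').1
  have h := X.bigon_set hw hb hjj hj hj' hm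
  refine hΨ.comp hw h.toRemoval ?_ ?_ _ (h.map_d (Diagram.surgical _)) ?_ ?_
  · intro k hk
    rw [Finset.mem_insert, Finset.mem_singleton] at hk
    rcases hb with ⟨-, rfl, rfl⟩ | ⟨-, rfl, rfl⟩ <;> rcases hk with rfl | rfl
    exacts [⟨j, h1, rfl⟩, ⟨j', h2, rfl⟩, ⟨j', h2, rfl⟩, ⟨j, h1, rfl⟩]
  · ext k
    rw [Finset.mem_union, Finset.mem_singleton, X.mem_negatives hw, X.mem_negatives hΨ.length_eq]
    constructor
    · rintro ⟨m, i', rfl, hl⟩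
      by_cases hmj : m = j
      · subst hmj
        rw [hj] at hl
        rcases hb with ⟨rfl, rfl, rfl⟩ | ⟨rfl, rfl, rfl⟩
        · simp at hl
        · exact Or.inr rfl
      by_cases hmj' : m = j'
      · subst hmj'
        rw [hj'] at hl
        rcases hb with ⟨rfl, rfl, rfl⟩ | ⟨rfl, rfl, rfl⟩
        · exact Or.inr rfl
        · simp at hl
      · refine Or.inl ⟨m, i', rfl, ?_⟩
        rw [List.getElem?_set_ne (Ne.symm hmj'), List.getElem?_set_ne (Ne.symm hmj), hl]
    · rintro (⟨m, i', rfl, hl⟩ | rfl)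
      · by_cases hmj' : m = j'
        · subst hmj'
          rw [List.getElem?_set_self (by simpa [hw] using h2)] at hl
          simp at hl
        rw [List.getElem?_set_ne (Ne.symm hmj')] at hl
        by_cases hmj : m = j
        · subst hmj
          rw [List.getElem?_set_self (by omega)] at hl
          simp at hl
        rw [List.getElem?_set_ne (Ne.symm hmj)] at hl
        exact ⟨m, i', rfl, hl⟩
      · rcases hb with ⟨rfl, rfl, rfl⟩ | ⟨rfl, rfl, rfl⟩
        · exact ⟨j', i, rfl, hj'⟩
        · exact ⟨j, i, rfl, hj⟩
  · intro t
    obtain ⟨ε, hε⟩ := exists_unit_neg_one_pow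
      ((h.lower t).ones.filter (max c c' < ·)).card
    refine ⟨ε, ?_⟩
    rw [h.map_eq_proj ((h.mem_lower_iff t (by simp)).2 (by simp)), h.proj_lower,
      Pattern.Bigon.sign, hε]
  · exact h.map_edge_lower leeTable

theorem Good.comp_resolve {w : BraidWord n} {j : ℕ}
    {Ψ : (X.braidPattern (w.set j none)).Chain →ₗ[ℚ] X.trivialPattern.Chain}
    (hΨ : X.Good (w.set j none) Ψ) {i : Fin (n - 1)} (hj : w[j]? = some (some (i, true))) :
    X.Good w (Ψ ∘ₗ Pattern.resolveMap (X.braidPattern w) (X.braidPattern (w.set j none))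
      (X.base + j)) := by
  have hw : w.length = height := by simpa using hΨ.length_eq
  have h1 : j < height := hw ▸ (List.getElem?_eq_some_iff.1 hj).1
  have h := X.removal_set hw hj
  have hS := (X.fill w).surgical
  refine hΨ.comp hw h ?_ ?_ _ (Pattern.resolveMap_d hS h) ?_ ?_
  · intro k hk
    exact ⟨j, h1, Finset.mem_singleton.1 hk⟩
  · ext k
    rw [Finset.union_empty, X.mem_negatives hw, X.mem_negatives hΨ.length_eq]
    refine exists₂_congr fun m i' => and_congr_right fun _ => ?_
    by_cases hmj : m = j
    · subst hmj
      rw [hj, List.getElem?_set_self (by omega)]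
      simp
    · rw [List.getElem?_set_ne (Ne.symm hmj)]
  · intro t
    refine ⟨1, ?_⟩
    rw [Pattern.resolveMap_eq_proj hS h, h.proj_lower]
    simp
  · intro t
    rw [Pattern.resolveMap_eq_proj hS h]
    exact h.proj_edge Pattern.Removal.isSign_one leeTable t

/-- Both orders of a cancelling pair are instances of one bigon, in which `c` is always the positive
crossing. -/
theorem IsJacobssonMap.good {w : BraidWord n}
    {Ψ : (X.braidPattern w).Chain →ₗ[ℚ] X.trivialPattern.Chain} (h : X.IsJacobssonMap w Ψ) :
    X.Good w Ψ := by
  induction h with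
  | done =>
    refine ⟨by simp, fun _ => rfl, fun s s' hs => ⟨1, ?_, rfl⟩⟩
    obtain ⟨h1, h2⟩ := X.isLift_iff.1 hs
    have hneg : X.negatives (List.replicate height (none : Option (Letter n))) = ∅ := by
      refine Finset.eq_empty_of_forall_notMem fun k hk => ?_
      obtain ⟨j, i, -, hl⟩ := (X.mem_negatives (by simp)).1 hk
      rw [List.getElem?_replicate] at hl
      split_ifs at hl
      simp at hl
    rw [hneg, Finset.union_empty] at h1
    obtain rfl : s' = s := Pattern.EnhancedState.ext h1 h2
    simp
  | resolve w j i Ψ hj _ ih => exact ih.comp_resolve hj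
  | cancelPosNeg w j j' i Ψ hjj hj hj' hm _ ih =>
    exact ih.comp_bigon (b := true) (Or.inl ⟨rfl, rfl, rfl⟩) hjj hj hj' hm
  | cancelNegPos w j j' i Ψ hjj hj hj' hm _ ih =>
    exact ih.comp_bigon (b := false) (Or.inr ⟨rfl, rfl, rfl⟩) hjj hj hj' hm

theorem Good.descends {w : BraidWord n}
    {Ψ : (X.braidPattern w).Chain →ₗ[ℚ] X.trivialPattern.Chain} (h : X.Good w Ψ) :
    Pattern.Descends Ψ where
  cycle z hz := by rw [h.comm, hz, map_zero]
  boundary x := ⟨Ψ x, (h.comm x).symm⟩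

/-! ### Existence of Jacobsson maps -/

variable (X)

theorem exists_of_word_eq {w w' : BraidWord n} (e : w = w') (h : ∃ Ψ, X.IsJacobssonMap w Ψ) :
    ∃ Ψ, X.IsJacobssonMap w' Ψ :=
  e ▸ h

theorem exists_resolve {L R : BraidWord n} {i : Fin (n - 1)}
    (h : ∃ Ψ, X.IsJacobssonMap (L ++ none :: R) Ψ) :
    ∃ Ψ, X.IsJacobssonMap (L ++ some (i, true) :: R) Ψ := by
  have e : (L ++ some (i, true) :: R).set L.length none = L ++ none :: R := by simp
  rw [← e] at h
  obtain ⟨Ψ, hΨ⟩ := h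
  exact ⟨_, .resolve _ L.length i Ψ (by simp) hΨ⟩

/-- Removed letters leave trivial slices behind and the height of the box is fixed, so a pair is
cancelled across `m` trivial slices. -/
theorem exists_cancel {L R : BraidWord n} (m : ℕ) (g : Letter n)
    (h : ∃ Ψ, X.IsJacobssonMap (L ++ List.replicate (m + 2) none ++ R) Ψ) :
    ∃ Ψ, X.IsJacobssonMap
      (L ++ some g :: (List.replicate m none ++ some (g.1, !g.2) :: R)) Ψ := by
  obtain ⟨i, b⟩ := g
  set w := L ++ some (i, b) :: (List.replicate m none ++ some (i, !b) :: R) with hw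
  have e : (w.set L.length none).set (L.length + (m + 1)) none =
      L ++ List.replicate (m + 2) none ++ R := by
    rw [hw, List.set_append_right _ _ le_rfl, Nat.sub_self, List.set_cons_zero,
      List.set_append_right _ _ (by omega), Nat.add_sub_cancel_left, List.set_cons_succ,
      List.set_append_right _ _ (by simp)]
    rw [List.replicate_succ, List.replicate_succ']
    simp
  have h1 : w[L.length]? = some (some (i, b)) := by simp [hw]
  have h2 : w[L.length + (m + 1)]? = some (some (i, !b)) := by
    rw [hw, List.getElem?_append_right (by omega), Nat.add_sub_cancel_left, List.getElem?_cons_succ,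
      List.getElem?_append_right (by simp)]
    simp
  have h3 : ∀ k, L.length < k → k < L.length + (m + 1) → w[k]? = some none := by
    intro k k1 k2
    obtain ⟨l, rfl⟩ := Nat.exists_eq_add_of_lt k1
    rw [hw, List.getElem?_append_right (by omega), show L.length + l + 1 - L.length = l + 1 by omega,
      List.getElem?_cons_succ, List.getElem?_append_left (by simp; omega),
      List.getElem?_replicate, if_pos (by omega)]
  rw [← e] at h
  obtain ⟨Ψ, hΨ⟩ := h
  cases b
  · exact ⟨_, .cancelNegPos w _ _ i Ψ (by omega) h1 h2 h3 hΨ⟩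
  · exact ⟨_, .cancelPosNeg w _ _ i Ψ (by omega) h1 h2 h3 hΨ⟩

/-- The innermost pair is the last letter of `ω` and the first letter of the inverse word. Hence the
induction removes letters from the end of `ω`, and each cancellation widens the gap by two slices.
-/
theorem exists_conjugate (ω : List (Letter n)) : ∀ (m : ℕ) (L R : BraidWord n),
    (∃ Ψ, X.IsJacobssonMap (L ++ List.replicate (2 * ω.length + m) none ++ R) Ψ) →
    ∃ Ψ, X.IsJacobssonMap (L ++ (ω.map some ++ (List.replicate m none ++
      ((ω.map fun g => (g.1, !g.2)).reverse.map some ++ R)))) Ψ := by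
  induction ω using List.reverseRecOn with
  | nil => intro m L R h; exact X.exists_of_word_eq (by simp) h
  | append_singleton ω g ih =>
    intro m L R h
    have h' := ih (m + 2) L R (by
      rwa [List.length_append, List.length_singleton,
        show 2 * (ω.length + 1) + m = 2 * ω.length + (m + 2) by ring] at h)
    have := X.exists_cancel (L := L ++ ω.map some)
      (R := (ω.map fun g => (g.1, !g.2)).reverse.map some ++ R) m g
      (X.exists_of_word_eq (by simp) h')
    exact X.exists_of_word_eq (by simp) this

/-- The conjugates are removed from the bottom to the top; `k` counts the trivial slices which the
earlier ones have left. -/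
theorem exists_isJacobssonMap (B : QuasipositiveBraid n) : ∀ k : ℕ, k + B.word.length = height →
    ∃ Ψ, X.IsJacobssonMap (List.replicate k none ++ B.word) Ψ := by
  induction B with
  | nil =>
    intro k hk
    have : height = k := by simpa [QuasipositiveBraid.word] using hk.symm
    subst this
    exact X.exists_of_word_eq (by simp [QuasipositiveBraid.word]) ⟨_, .done⟩
  | cons f B ih =>
    intro k hk
    have hword : QuasipositiveBraid.word (f :: B) = f.1.map some ++ some (f.2, true) ::
        ((f.1.map fun g => (g.1, !g.2)).reverse.map some ++ QuasipositiveBraid.word B) := by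
      simp [QuasipositiveBraid.word]
    rw [hword] at hk ⊢
    -- A factor `ω τ ω⁻¹` turns into `2 * f.1.length + 1` trivial slices. The one in the middle
    -- comes from resolving `τ`, which is the initial gap `1` for `exists_conjugate`.
    have h := ih (k + (2 * f.1.length + 1)) (by
      rw [← hk]; simp; ring)
    rw [List.replicate_add] at h
    have h2 := X.exists_conjugate f.1 1 (List.replicate k none) _ h
    have h3 := X.exists_resolve (L := List.replicate k none ++ f.1.map some)
      (R := (f.1.map fun g => (g.1, !g.2)).reverse.map some ++ QuasipositiveBraid.word B)
      (i := f.2) (X.exists_of_word_eq (by simp) h2)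
    exact X.exists_of_word_eq (by simp) h3

end BoxExterior

/-! ### Passage to homology -/

namespace Pattern
variable {P Q : Type} {S : Pattern P} {T : Pattern Q}

theorem Kh.map_mk {f : S.Chain →ₗ[ℚ] T.Chain} (hf : Descends f) {z : S.Chain} (hz : S.d z = 0) :
    Kh.map f hf (Kh.mk z hz) = Kh.mk (f z) (hf.cycle z hz) :=
  rfl

theorem Kh.mk_congr {z z' : S.Chain} (h : z = z') (hz : S.d z = 0) :
    Kh.mk z hz = Kh.mk z' (h ▸ hz) := by
  subst h
  rfl

theorem Kh.mk_eq_units_smul (ε : ℤˣ) {z z' : S.Chain} (h : z = ((ε : ℤ) : ℚ) • z')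
    (hz : S.d z = 0) (hz' : S.d z' = 0) : Kh.mk z hz = ε • Kh.mk z' hz' := by
  rw [Kh.mk_congr h]
  rcases Int.units_eq_one_or ε with rfl | rfl
  · rw [one_smul]
    exact Kh.mk_congr (by simp) _
  · rw [Units.neg_smul, one_smul]
    exact (Kh.mk_congr (z' := -z') (by simp) _).trans
      (Submodule.Quotient.mk_neg _ (x := (⟨z', hz'⟩ : LinearMap.ker S.d)))

theorem Kh.map_units_smul {f : S.Chain →ₗ[ℚ] T.Chain} (hf : Descends f) (ε : ℤˣ) (x : S.Kh) :
    Kh.map f hf (ε • x) = ε • Kh.map f hf x := by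
  rcases Int.units_eq_one_or ε with rfl | rfl <;> simp

end Pattern

end LeeLift

end

theorem mainTheorem3 {n : ℕ} (B : QuasipositiveBraid n) (X : BoxExterior n B.word.length)
    (α : X.trivialPattern.EnhancedState) (hα : α.IsStateCycle)
    (hnontrivial : Pattern.Kh.mk α.chain hα ≠ 0) (hparallel : X.BraidParallel α) :
    (∃ Ψ, X.IsJacobssonMap B.word Ψ) ∧
    ∃ (α' : (X.braidPattern B.word).EnhancedState) (hα' : α'.IsStateCycle)
      (hΦ : Pattern.Descends X.trivialPattern.lee)
      (hΦ' : Pattern.Descends (X.braidPattern B.word).lee),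
      X.IsLift B.word α α' ∧
      ∀ Ψ, X.IsJacobssonMap B.word Ψ →
        ∃ (hΨ : Pattern.Descends Ψ) (ε : ℤˣ),
          Pattern.Kh.map Ψ hΨ (Pattern.Kh.mk α'.chain hα') =
            ε • Pattern.Kh.mk α.chain hα ∧
          Pattern.Kh.map Ψ hΨ
              (Pattern.Kh.map (X.braidPattern B.word).lee hΦ' (Pattern.Kh.mk α'.chain hα')) =
            Pattern.Kh.map X.trivialPattern.lee hΦ
              (Pattern.Kh.map Ψ hΨ (Pattern.Kh.mk α'.chain hα')) ∧
          Pattern.Kh.map X.trivialPattern.lee hΦ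
              (Pattern.Kh.map Ψ hΨ (Pattern.Kh.mk α'.chain hα')) =
            ε • Pattern.Kh.map X.trivialPattern.lee hΦ (Pattern.Kh.mk α.chain hα) ∧
          (IsLeePair hΦ α hα → IsLeePair hΦ' α' hα') := by
  refine ⟨X.exists_of_word_eq (by simp) (X.exists_isJacobssonMap B 0 (Nat.zero_add _)),
    (X.removal_trivial rfl).lower α, X.isStateCycle_lower rfl hα hparallel,
    Pattern.descends_lee (Diagram.surgical _), Pattern.descends_lee (Diagram.surgical _),
    X.isLift_lower rfl α, fun Ψ hΨ => ?_⟩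
  have hg := hΨ.good
  obtain ⟨ε, h1, h2⟩ := hg.lift α _ (X.isLift_lower rfl α)
  have e1 := (Pattern.Kh.map_mk hg.descends (X.isStateCycle_lower rfl hα hparallel)).trans
    (Pattern.Kh.mk_eq_units_smul ε h1 _ hα)
  have e3 := Pattern.Kh.map_units_smul (Pattern.descends_lee (X.fill _).surgical) ε
    (Pattern.Kh.mk α.chain hα)
  have e2 := Pattern.Kh.mk_congr h2 (hg.descends.cycle _
    ((Pattern.descends_lee (Diagram.surgical _)).cycle _ (X.isStateCycle_lower rfl hα hparallel)))
  refine ⟨hg.descends, ε, e1, e2, (congrArg _ e1).trans e3, fun h => ⟨fun h0 => ?_, fun h0 => ?_⟩⟩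
  -- If the class of the lift or its image under `Φ` were zero, applying `Ψ` would make `ε` times
  -- the corresponding class of `D` zero, and `ε` is invertible.
  · rw [h0, map_zero] at e1
    exact h.1 ((smul_eq_zero_iff_eq ε).1 e1.symm)
  · refine h.2 ((smul_eq_zero_iff_eq ε).1 (e3.symm.trans ((congrArg _ e1).symm.trans ?_)))
    exact (e2.symm.trans (congrArg (Pattern.Kh.map Ψ hg.descends) h0)).trans (map_zero _)
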